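/- Let $G$ be a countable discrete group with a sofic approximation $\Sigma=(\sigma_n:G\to\mathrm{Sym}(V_n))_{n}$: each $V_n$ is a nonempty finite set, and as $n\to\infty$, for a proportion tending to $1$ of the $v\in V_n$ ("w.h.p. in $v$"), $\sigma_n^g\sigma_n^h(v)=\sigma_n^{gh}(v)$ (for all fixed $g,h\in G$) and $\sigma_n^g(v)\ne v$ (for all fixed $g\neq e$). A $G$-system $(X,\mu,T)$ is a measurable $\mu$-preserving action $T$ of $G$ on a standard probability space $(X,\mu)$; products and powers of systems carry the product measure and the diagonal action. Definitions. Let $(\mathcal X,d)$ be a compact metric space and $\mu$ a Borel probability measure on $\mathcal X^G$, invariant under the right shift. For $\mathbf x\in\mathcal X^{V_n}$ and $v\in V_n$ put $\Pi^{\sigma_n}_v(\mathbf x)=(x_{\sigma_n^g(v)})_{g\in G}$, $P^{\sigma_n}_{\mathbf x}=\frac1{|V_n|}\sum_{v}\delta_{\Pi^{\sigma_n}_v(\mathbf x)}$, and $\Omega(\mathcal O,\sigma_n)=\{\mathbf x: P^{\sigma_n}_{\mathbf x}\in\mathcal O\}$; let $d^{(V_n)}(\mathbf x,\mathbf y)=\frac1{|V_n|}\sum_v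 d(x_v,y_v)$. The sofic entropy is $$\mathrm h_\Sigma(\mu)=\sup_{\delta>0}\inf_{\mathcal O}\limsup_{n\to\infty}\tfrac1{|V_n|}\log\mathrm{cov}_\delta\big(\Omega(\mathcal O,\sigma_n),d^{(V_n)}\big),$$ where $\mathcal O$ ranges over the weak$^*$-neighbourhoods of $\mu$, $\mathrm{cov}_\delta(Z,d)$ is the least cardinality of a $\delta$-dense subset of $Z$, and $\log 0=-\infty$; the lower sofic entropy $\underline{\mathrm h}_\Sigma(\mu)$ is defined with $\liminf$ instead. Probability measures $\mu_i$ on $\mathcal X^{V_{n_i}}$ ($n_i\uparrow\infty$) quenched converge to $\mu$ if for every weak$^*$-neighbourhood $\mathcal O$ of $\mu$ one has $(\Pi_v^{\sigma_{n_i}})_*\mu_i\in\mathcal O$ w.h.p. in $v\in V_{n_i}$ and $\mu_i(\Omega(\mathcal O,\sigma_{n_i}))\to1$, as $i\to\infty$; they doubly-quenched converge to $\mu$ ($\mu_i\xrightarrow{\mathrm{dq}}\mu$) if $\mu_i\times\mu_i$ quenched converges to $\mu\times\mu$, viewed as measures on $(\mathcal X\times\mathcal X)^{V_{n_i}}$ and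 $(\mathcal X\times\mathcal X)^G$. The doubly-quenched model-measure sofic entropy is $$\mathrm h^{\mathrm{dq}}_\Sigma(\mu)=\sup\Big\{\sup_{\delta,\varepsilon>0}\limsup_{i\to\infty}\tfrac1{|V_{n_i}|}\log\mathrm{cov}_{\varepsilon,\delta}\big(\mu_i,d^{(V_{n_i})}\big):\ n_i\uparrow\infty,\ \mu_i\xrightarrow{\mathrm{dq}}\mu\Big\}\qquad(\sup\emptyset=-\infty),$$ where $\mathrm{cov}_{\varepsilon,\delta}(\mu_i,d^{(V_{n_i})})$ is the least cardinality of a set whose $\delta$-neighbourhood has $\mu_i$-measure larger than $1-\varepsilon$. For a $G$-system $(X,\mu,T)$, the quantities $\mathrm h_\Sigma(\mu,T)$, $\underline{\mathrm h}_\Sigma(\mu,T)$ and $\mathrm h^{\mathrm{dq}}_\Sigma(\mu,T)$ are those of the image of $\mu$ under $x\mapsto(T^hx)_{h\in G}\in X^G$, where $X$ carries a compact metric that generates its $\sigma$-algebra (they do not depend on this metric). They take values in $[-\infty,\infty]$. Theorem. Suppose that $(X,\mu,T)$ has a finite generating partition (a finite measurable partition whose translates generate the $\sigma$-algebra of $X$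 modulo $\mu$-null sets), and that $\mathrm h_\Sigma(\mu^{\times k},T^{\times k})=\underline{\mathrm h}_\Sigma(\mu^{\times k},T^{\times k})$ for all $k\ge1$. Then $$\mathrm h^{\mathrm{dq}}_\Sigma(\mu,T)=\inf\big\{\mathrm h_\Sigma(\mu\times\nu,T\times S)-\mathrm h_\Sigma(\nu,S)\big\},$$ where the infimum is over all $G$-systems $(Y,\nu,S)$ with $\mathrm h_\Sigma(\nu,S)=\underline{\mathrm h}_\Sigma(\nu,S)$ for which the difference is well defined, that is, of neither of the forms $\infty-\infty$ and $(-\infty)-(-\infty)$. Moreover, $\mathrm h^{\mathrm{dq}}_\Sigma(\mu,T)$ is the largest $c\in[-\infty,\infty]$ such that $$\mathrm h_\Sigma(\mu\times\nu,T\times S)\ \ge\ c+\mathrm h_\Sigma(\nu,S)$$ for all $G$-systems $(Y,\nu,S)$ with $\mathrm h_\Sigma(\nu,S)=\underline{\mathrm h}_\Sigma(\nu,S)$, where $\infty+(-\infty)=-\infty$. -/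

import Mathlib

open Filter Topology MeasureTheory Set
open scoped ENNReal

universe u v

/-! ### Sofic approximations -/

/-- The property `P n` holds with high probability in a uniformly random vertex of the finite
set `V n`, as `n → ∞`. -/
def WHP {V : ℕ → Type} (P : ∀ n, V n → Prop) : Prop :=
  Tendsto (fun n => (Nat.card {v : V n // P n v} : ℝ) / (Nat.card (V n) : ℝ)) atTop (𝓝 1)

/-- A sofic approximation to the group `G`: nonempty finite sets `V n` and maps
`σ n : G → Sym (V n)` which are asymptotically multiplicative and asymptotically free. -/
structure SoficApproximation (G : Type*) [Group G] where
  V : ℕ → Type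
  [fintypeV : ∀ n, Fintype (V n)]
  [nonemptyV : ∀ n, Nonempty (V n)]
  σ : ∀ n, G → Equiv.Perm (V n)
  asymp_mul : ∀ g h : G, WHP fun n v => σ n g (σ n h v) = σ n (g * h) v
  asymp_free : ∀ g : G, g ≠ 1 → WHP fun n v => σ n g v ≠ v

attribute [instance] SoficApproximation.fintypeV SoficApproximation.nonemptyV

/-! ### Pullback names, empirical distributions and good models -/

section Models

variable {G : Type*} {V : Type*} {A : Type*}

/-- The pullback name of `x ∈ A^V` at the vertex `v`, an element of `A^G`. -/
def pullbackName (σ : G → Equiv.Perm V) (v : V) (x : V → A) : G → A := fun g => x (σ g v)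

theorem measurable_pullbackName [MeasurableSpace A] (σ : G → Equiv.Perm V) (v : V) :
    Measurable (pullbackName σ v : (V → A) → (G → A)) :=
  measurable_pi_iff.mpr fun _ => measurable_pi_apply _

/-- The empirical distribution of `x ∈ A^V`: the uniform average over `v ∈ V` of the Dirac masses
at the pullback names of `x`. -/
noncomputable def empiricalDist [Fintype V] [Nonempty V] [MeasurableSpace A]
    (σ : G → Equiv.Perm V) (x : V → A) : ProbabilityMeasure (G → A) :=
  ⟨(Fintype.card V : ℝ≥0∞)⁻¹ • ∑ v : V, Measure.dirac (pullbackName σ v x), ⟨by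
    simp [ENNReal.inv_mul_cancel]⟩⟩

/-- The set of `x ∈ A^V` whose empirical distribution lies in `O`. -/
def goodModels [Fintype V] [Nonempty V] [MeasurableSpace A]
    (O : Set (ProbabilityMeasure (G → A))) (σ : G → Equiv.Perm V) : Set (V → A) :=
  {x | empiricalDist σ x ∈ O}

end Models

/-! ### Convergence of measures on model spaces

The space `ProbabilityMeasure (G → A)` carries Mathlib's topology of weak convergence, for the
product topology on `G → A`. -/

section Convergence

variable {G : Type*} [Countable G] {V : ℕ → Type} [∀ n, Fintype (V n)] [∀ n, Nonempty (V n)]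
  {A : Type*} [TopologicalSpace A] [SecondCountableTopology A] [MeasurableSpace A] [BorelSpace A]

/-- Local weak-* convergence of the measures `m n` on `A^(V n)` to the measure `μ` on `A^G`. -/
def LocalWeakConverges (σ : ∀ n, G → Equiv.Perm (V n))
    (m : ∀ n, ProbabilityMeasure (V n → A)) (μ : ProbabilityMeasure (G → A)) : Prop :=
  ∀ O ∈ 𝓝 μ, WHP fun n v => (m n).map (measurable_pullbackName (σ n) v).aemeasurable ∈ O

/-- Quenched convergence: local weak-* convergence, together with asymptotic concentration on
the good models of `μ`. -/
def QuenchedConverges (σ : ∀ n, G → Equiv.Perm (V n))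
    (m : ∀ n, ProbabilityMeasure (V n → A)) (μ : ProbabilityMeasure (G → A)) : Prop :=
  LocalWeakConverges σ m μ ∧
    ∀ O ∈ 𝓝 μ, Tendsto (fun n => (m n : Measure (V n → A)) (goodModels O (σ n))) atTop (𝓝 1)

/-- The canonical identification `A^I × B^I → (A × B)^I`. -/
def zipFun {I A B : Type*} (p : (I → A) × (I → B)) : I → A × B := fun i => (p.1 i, p.2 i)

theorem measurable_zipFun {I A B : Type*} [MeasurableSpace A] [MeasurableSpace B] :
    Measurable (zipFun : (I → A) × (I → B) → (I → A × B)) :=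
  measurable_pi_iff.mpr fun i =>
    ((measurable_pi_apply i).comp measurable_fst).prodMk
      ((measurable_pi_apply i).comp measurable_snd)

/-- The Cartesian square `μ × μ` of a measure on `A^I`, as a measure on `(A × A)^I`. -/
noncomputable def squareLaw {I A : Type*} [MeasurableSpace A]
    (μ : ProbabilityMeasure (I → A)) : ProbabilityMeasure (I → A × A) :=
  (μ.prod μ).map measurable_zipFun.aemeasurable

/-- Doubly-quenched convergence: `m n × m n` quenched converges to `μ × μ`. -/
def DoublyQuenchedConverges (σ : ∀ n, G → Equiv.Perm (V n))
    (m : ∀ n, ProbabilityMeasure (V n → A)) (μ : ProbabilityMeasure (G → A)) : Prop :=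
  QuenchedConverges σ (fun n => squareLaw (m n)) (squareLaw μ)

end Convergence

/-! ### Covering numbers -/

section Covering

/-- The Hamming average over `V` of the metric of `A`. -/
noncomputable def hammingAvg {V A : Type*} [Fintype V] [MetricSpace A] (x y : V → A) : ℝ :=
  (∑ v, dist (x v) (y v)) / (Fintype.card V : ℝ)

variable {Y : Type*}

/-- The least cardinality of a `δ`-dense subset of `Z` with respect to the distance `d`. -/
noncomputable def coverNumber (d : Y → Y → ℝ) (δ : ℝ) (Z : Set Y) : ℕ∞ :=
  sInf {c | ∃ F : Set Y, F ⊆ Z ∧ (∀ z ∈ Z, ∃ y ∈ F, d z y < δ) ∧ c = F.encard}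

/-- The least cardinality of a set `F` whose `δ`-neighbourhood has measure larger than
`1 - ε`. -/
noncomputable def measureCoverNumber [MeasurableSpace Y] (d : Y → Y → ℝ) (ε δ : ℝ)
    (m : ProbabilityMeasure Y) : ℕ∞ :=
  sInf {c | ∃ F : Set Y, 1 - ε < (m : Measure Y).real {z | ∃ y ∈ F, d z y < δ} ∧ c = F.encard}

/-- `(1 / N) * log c`, with `log 0 = -∞` and `log ∞ = ∞`. -/
noncomputable def logRate (c : ℕ∞) (N : ℕ) : EReal := ENNReal.log (c : ℝ≥0∞) / (N : EReal)

end Covering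

/-! ### Entropies of metric processes -/

namespace SoficApproximation

variable {G : Type*} [Group G] [Countable G] (S : SoficApproximation G)
  {A : Type*} [MetricSpace A] [CompactSpace A] [MeasurableSpace A] [BorelSpace A]

/-- The sofic entropy of the process law `μ` on `A^G`, computed with the metric of `A`. -/
noncomputable def processEntropy (μ : ProbabilityMeasure (G → A)) : EReal :=
  ⨆ δ : ℝ, ⨆ _ : 0 < δ, ⨅ O ∈ 𝓝 μ,
    limsup (fun n => logRate (coverNumber hammingAvg δ (goodModels O (S.σ n)))
      (Fintype.card (S.V n))) atTop

/-- The lower sofic entropy of the process law `μ` on `A^G`. -/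
noncomputable def processLowerEntropy (μ : ProbabilityMeasure (G → A)) : EReal :=
  ⨆ δ : ℝ, ⨆ _ : 0 < δ, ⨅ O ∈ 𝓝 μ,
    liminf (fun n => logRate (coverNumber hammingAvg δ (goodModels O (S.σ n)))
      (Fintype.card (S.V n))) atTop

/-- The doubly-quenched model-measure sofic entropy of the process law `μ` on `A^G`: the supremum
is over all subsequences `n 0 < n 1 < ...` and all measures `m i` on `A^(V (n i))` which
doubly-quenched converge to `μ` over that subsequence. -/
noncomputable def processDQEntropy (μ : ProbabilityMeasure (G → A)) : EReal :=
  ⨆ (n : ℕ → ℕ) (_ : StrictMono n) (m : ∀ i, ProbabilityMeasure (S.V (n i) → A))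
    (_ : DoublyQuenchedConverges (fun i => S.σ (n i)) m μ),
    ⨆ (ε : ℝ) (_ : 0 < ε) (δ : ℝ) (_ : 0 < δ),
      limsup (fun i => logRate (measureCoverNumber hammingAvg ε δ (m i))
        (Fintype.card (S.V (n i)))) atTop

end SoficApproximation

/-! ### Compact generating metrics -/

/-- A metric on the measurable space `X` which is compact and whose Borel sets are the measurable
sets of `X`. -/
structure CompactGeneratingMetric (X : Type*) [MeasurableSpace X] where
  metric : MetricSpace X
  compact : CompactSpace X
  borel : BorelSpace X

theorem CompactGeneratingMetric.nonempty_of_equiv {X : Type*} [MeasurableSpace X]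
    [StandardBorelSpace X] {K : Set ℝ} (hK : IsCompact K) (e : X ≃ K) :
    Nonempty (CompactGeneratingMetric X) := by
  have : StandardBorelSpace K := hK.isClosed.measurableSet.standardBorel
  have : CompactSpace K := isCompact_iff_compactSpace.mp hK
  let f : X ≃ᵐ K := PolishSpace.Equiv.measurableEquiv e
  let m : MetricSpace X := MetricSpace.induced f f.injective inferInstance
  have hind : IsInducing f := ⟨rfl⟩
  refine ⟨⟨m, ?_, ?_⟩⟩
  · exact (Homeomorph.symm (f.toEquiv.toHomeomorphOfIsInducing hind)).compactSpace
  · refine ⟨?_⟩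
    have hb : (Subtype.instMeasurableSpace : MeasurableSpace K) = _root_.borel K :=
      BorelSpace.measurable_eq
    exact f.measurableEmbedding.comap_eq.symm.trans
      ((congrArg (MeasurableSpace.comap (f : X → K)) hb).trans borel_comap.symm)

/-- Every standard Borel space has a compact generating metric. -/
theorem CompactGeneratingMetric.nonempty (X : Type*) [MeasurableSpace X] [StandardBorelSpace X] :
    Nonempty (CompactGeneratingMetric X) := by
  rcases finite_or_infinite X with hfin | hinf
  · obtain ⟨n, ⟨e⟩⟩ := Finite.exists_equiv_fin X
    have hinj : Function.Injective (fun i : Fin n => ((i : ℕ) : ℝ)) := fun i j h =>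
      Fin.ext (Nat.cast_injective (R := ℝ) h)
    exact nonempty_of_equiv (Set.finite_range fun i : Fin n => ((i : ℕ) : ℝ)).isCompact
      (e.trans (Equiv.ofInjective _ hinj))
  · by_cases hc : Countable X
    · have hlim : Tendsto (fun n : ℕ => 1 / ((n : ℝ) + 1)) atTop (𝓝 0) :=
        tendsto_one_div_add_atTop_nhds_zero_nat
      have hK := hlim.isCompact_insert_range
      have hinj : Function.Injective (fun n : ℕ => 1 / ((n : ℝ) + 1)) := fun i j h => by
        have h' : ((i : ℝ) + 1) = (j : ℝ) + 1 := by simpa using h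
        exact_mod_cast add_right_cancel h'
      have hcK : (insert (0 : ℝ) (Set.range fun n : ℕ => 1 / ((n : ℝ) + 1))).Countable :=
        (Set.countable_range _).insert _
      have hiK : (insert (0 : ℝ) (Set.range fun n : ℕ => 1 / ((n : ℝ) + 1))).Infinite :=
        (Set.infinite_range_of_injective hinj).mono (Set.subset_insert _ _)
      have := hcK.to_subtype
      have := hiK.to_subtype
      obtain ⟨e⟩ := nonempty_equiv_of_countable (α := X)
        (β := (insert (0 : ℝ) (Set.range fun n : ℕ => 1 / ((n : ℝ) + 1)) : Set ℝ))
      exact nonempty_of_equiv hK e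
    · have : StandardBorelSpace (Set.Icc (0 : ℝ) 1) := measurableSet_Icc.standardBorel
      have hI : ¬ Countable (Set.Icc (0 : ℝ) 1) := fun h =>
        (Cardinal.mk_Icc_real zero_lt_one ▸ Cardinal.aleph0_lt_continuum).not_ge
          (Cardinal.mk_le_aleph0_iff.mpr h)
      exact nonempty_of_equiv isCompact_Icc
        (PolishSpace.measurableEquivOfNotCountable hc hI).toEquiv

/-- A choice of a compact generating metric on a standard Borel space. -/
noncomputable def chosenMetric (X : Type*) [MeasurableSpace X] [StandardBorelSpace X] :
    CompactGeneratingMetric X :=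
  (CompactGeneratingMetric.nonempty X).some

/-! ### Systems -/

/-- A `G`-system: a probability-preserving measurable action of `G` on a standard probability
space. -/
structure GSystem (G : Type v) [Group G] where
  carrier : Type u
  [measurableSpace : MeasurableSpace carrier]
  [standardBorel : StandardBorelSpace carrier]
  [action : MulAction G carrier]
  law : ProbabilityMeasure carrier
  preserving : ∀ g : G, MeasurePreserving (fun x : carrier => g • x)
    (law : Measure carrier) (law : Measure carrier)

attribute [instance] GSystem.measurableSpace GSystem.standardBorel GSystem.action

namespace GSystem

variable {G : Type*} [Group G]

/-- The Cartesian product of two systems, with the diagonal action. -/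
noncomputable def prod (X Y : GSystem G) : GSystem G where
  carrier := X.carrier × Y.carrier
  law := X.law.prod Y.law
  preserving g := (X.preserving g).prod (Y.preserving g)

/-- The `k`-fold Cartesian power of a system, with the diagonal action. -/
noncomputable def pow (X : GSystem G) (k : ℕ) : GSystem G where
  carrier := Fin k → X.carrier
  law := ProbabilityMeasure.pi fun _ => X.law
  preserving g := measurePreserving_pi _ _ fun _ => X.preserving g

/-- There is a finite measurable partition whose translates under the action generate the whole
σ-algebra modulo null sets. The partition is given by the level sets of a measurable map to a
finite set. -/
def HasFiniteGeneratingPartition (X : GSystem G) : Prop :=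
  ∃ (r : ℕ) (φ : X.carrier → Fin r), Measurable φ ∧
    ∀ B : Set X.carrier, MeasurableSet B → ∃ C : Set X.carrier,
      MeasurableSet[⨆ g : G, MeasurableSpace.comap (fun x => φ (g • x)) ⊤] C ∧
        B =ᵐ[(X.law : Measure X.carrier)] C

/-- The equivariant map `x ↦ (T^h x)_h` from `X` to `X^G`. -/
def orbitMap (X : GSystem G) (x : X.carrier) : G → X.carrier := fun h => h • x

theorem measurable_orbitMap (X : GSystem G) : Measurable X.orbitMap :=
  measurable_pi_iff.mpr fun h => (X.preserving h).measurable

/-- The shift-invariant measure on `X^G` of the `G`-process isomorphic to the system. -/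
noncomputable def processLaw (X : GSystem G) : ProbabilityMeasure (G → X.carrier) :=
  X.law.map X.measurable_orbitMap.aemeasurable

end GSystem

/-! ### Entropies of systems -/

namespace SoficApproximation

variable {G : Type*} [Group G] [Countable G] (S : SoficApproximation G)

/-- The sofic entropy of a system: that of the associated process, for a compact generating
metric. -/
noncomputable def entropy (X : GSystem G) : EReal :=
  letI := (chosenMetric X.carrier).metric
  haveI := (chosenMetric X.carrier).compact
  haveI := (chosenMetric X.carrier).borel
  S.processEntropy X.processLaw

/-- The lower sofic entropy of a system. -/
noncomputable def lowerEntropy (X : GSystem G) : EReal :=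
  letI := (chosenMetric X.carrier).metric
  haveI := (chosenMetric X.carrier).compact
  haveI := (chosenMetric X.carrier).borel
  S.processLowerEntropy X.processLaw

/-- The doubly-quenched model-measure sofic entropy of a system. -/
noncomputable def dqEntropy (X : GSystem G) : EReal :=
  letI := (chosenMetric X.carrier).metric
  haveI := (chosenMetric X.carrier).compact
  haveI := (chosenMetric X.carrier).borel
  S.processDQEntropy X.processLaw

end SoficApproximation

/-- The difference `a - b` of extended real numbers is well defined, that is, it is neither
`∞ - ∞` nor `(-∞) - (-∞)`. -/
def SubWellDefined (a b : EReal) : Prop := ¬ (a = ⊤ ∧ b = ⊤) ∧ ¬ (a = ⊥ ∧ b = ⊥)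

-- The theorem follows from two inequalities.
--
-- Product inequality: `dqEntropy X + lowerEntropy Y ≤ entropy (X.prod Y)`. Let measures on models
-- doubly-quenched converge to μ, and let y be a good model for ν. To a sample x and a finite
-- pattern attach the centred indicator of the occurrences of the pattern, a function on the
-- vertices. For two independent samples these functions are nearly orthogonal, and Cauchy–Schwarz
-- then makes those of a typical sample nearly orthogonal to any fixed function (`sum_vip_sq_le`),
-- in particular to the pattern indicators of y. So for every y most x form with y a model of μ × ν
-- (`exists_joint_tolerance`). Pairing many separated y with many separated x multiplies the
-- covering numbers (`exists_prod_models`).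
--
-- Converse: suppose c + h(ν) ≤ h(μ × ν) for all admissible ν. The powers of μ are admissible, and
-- induction gives h(μ^k) ≥ kc. Through the finite generator this yields roughly exp(kc|V|) many
-- k-tuples of finite words, any two of which form a model of μ × μ. Draw such a tuple uniformly and
-- reveal its coordinates one by one. By the chain rule the conditional laws have average entropy at
-- least c|V|, up to a small loss. The vectors `patternFeature` of different coordinates are nearly
-- orthogonal, and a martingale argument (`sum_norm_condAvg_le`) makes the conditional means of
-- these vectors small on average. So one conditional law has large entropy and small energy
-- (`exists_condLaw`). Small energy makes two independent samples typically uncorrelated, that is, a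
-- model of μ × μ (`exists_energy_bound`). A diagonal sequence of such laws, carried to the metric
-- space by codes that approximately invert the generator, doubly-quenched converges to μ and has
-- large covering numbers (`le_processDQEntropy`).
--
-- Throughout, weak-* neighbourhoods and metrics are traded for finite-valued observables:
-- `exists_nhds_isModel` passes from good models to finite ones, `exists_realization` and
-- `exists_shadows_subset` pass back.

universe w w'

/-! ### Frequencies of vertices -/

section Freq

variable {V : Type*} [Fintype V]

/-- The proportion of the elements of `V` that lie in `s`. -/
noncomputable def freq (s : Set V) : ℝ := (s.ncard : ℝ) / Fintype.card V

theorem freq_nonneg (s : Set V) : 0 ≤ freq s := by unfold freq; positivity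

theorem freq_mono {s t : Set V} (h : s ⊆ t) : freq s ≤ freq t := by
  unfold freq
  have := Set.ncard_le_ncard h (Set.toFinite t)
  gcongr

theorem freq_union_le (s t : Set V) : freq (s ∪ t) ≤ freq s + freq t := by
  unfold freq
  rw [← add_div]
  have := Set.ncard_union_le s t
  gcongr
  exact_mod_cast this

theorem freq_le_add {r s t : Set V} (h : r ⊆ s ∪ t) : freq r ≤ freq s + freq t :=
  (freq_mono h).trans (freq_union_le s t)

theorem freq_empty : freq (∅ : Set V) = 0 := by simp [freq]

theorem freq_univ [Nonempty V] : freq (univ : Set V) = 1 := by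
  unfold freq
  rw [Set.ncard_univ, Nat.card_eq_fintype_card]
  exact div_self (by positivity)

theorem freq_compl [Nonempty V] (s : Set V) : freq sᶜ = 1 - freq s := by
  have h := Set.ncard_add_ncard_compl s
  have h0 : (Fintype.card V : ℝ) ≠ 0 := by positivity
  unfold freq
  rw [Nat.card_eq_fintype_card] at h
  have h' : (s.ncard : ℝ) + (sᶜ.ncard : ℝ) = Fintype.card V := by exact_mod_cast h
  field_simp
  linarith

theorem freq_le_one [Nonempty V] (s : Set V) : freq s ≤ 1 := by
  have := freq_nonneg sᶜ
  rw [freq_compl] at this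
  linarith

open Classical in
theorem freq_eq_sum (s : Set V) :
    freq s = (∑ v, if v ∈ s then (1 : ℝ) else 0) / Fintype.card V := by
  unfold freq
  congr 1
  rw [Finset.sum_ite, Finset.sum_const_zero, add_zero, Finset.sum_const, nsmul_eq_mul, mul_one,
    Set.ncard_eq_toFinset_card']
  congr 2
  ext v
  simp

theorem freq_biUnion_le {ι : Type*} (F : Finset ι) (s : ι → Set V) :
    freq (⋃ i ∈ F, s i) ≤ ∑ i ∈ F, freq (s i) := by
  classical
  induction F using Finset.induction_on with
  | empty => simp [freq_empty]
  | insert i F hi ih =>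
    rw [Finset.sum_insert hi, Finset.set_biUnion_insert]
    exact (freq_union_le _ _).trans (by gcongr)

/-- The average of `f` is bounded by `a + b * freq s` when `f ≤ a` off `s` and `f ≤ a + b`
on `s`. -/
theorem sum_div_card_le [Nonempty V] {f : V → ℝ} {a b : ℝ} {s : Set V}
    (h1 : ∀ v, v ∉ s → f v ≤ a) (h2 : ∀ v, v ∈ s → f v ≤ a + b) :
    (∑ v, f v) / Fintype.card V ≤ a + b * freq s := by
  classical
  have h0 : (Fintype.card V : ℝ) ≠ 0 := by positivity
  have : ∑ v, f v ≤ ∑ v, (a + b * if v ∈ s then (1 : ℝ) else 0) := by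
    refine Finset.sum_le_sum fun v _ => ?_
    by_cases hv : v ∈ s
    · simpa [hv] using h2 v hv
    · simpa [hv] using h1 v hv
  rw [freq_eq_sum]
  calc (∑ v, f v) / Fintype.card V
      ≤ (∑ v, (a + b * if v ∈ s then (1 : ℝ) else 0)) / Fintype.card V := by gcongr
    _ = _ := by
      rw [Finset.sum_add_distrib, ← Finset.mul_sum]
      simp only [Finset.sum_const, nsmul_eq_mul, Finset.card_univ]
      field_simp

/-- Markov's inequality for the uniform measure on the vertices. -/
theorem mul_freq_le_sum_div {f : V → ℝ} {b : ℝ} {s : Set V} (h0 : ∀ v, 0 ≤ f v)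
    (h2 : ∀ v, v ∈ s → b ≤ f v) : b * freq s ≤ (∑ v, f v) / Fintype.card V := by
  classical
  rw [freq_eq_sum, ← mul_div_assoc, Finset.mul_sum]
  gcongr with v
  by_cases hv : v ∈ s
  · simpa [hv] using h2 v hv
  · simpa [hv] using h0 v

end Freq

/-- An event holds with high probability iff its frequency tends to one. -/
theorem whp_iff {V : ℕ → Type} [∀ n, Fintype (V n)] {P : ∀ n, V n → Prop} :
    WHP P ↔ Tendsto (fun n => freq {v | P n v}) atTop (𝓝 1) := by
  have : (fun n => (Nat.card {v : V n // P n v} : ℝ) / (Nat.card (V n) : ℝ)) =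
      fun n => freq {v | P n v} := by
    funext n
    unfold freq
    rw [Nat.card_eq_fintype_card (α := V n)]
    rfl
  unfold WHP
  rw [this]

/-! ### The averaged metric -/

section Hamming

variable {V A : Type*} [Fintype V] [MetricSpace A]

theorem hammingAvg_self (x : V → A) : hammingAvg x x = 0 := by simp [hammingAvg]

theorem hammingAvg_comm (x y : V → A) : hammingAvg x y = hammingAvg y x := by
  simp [hammingAvg, dist_comm]

theorem hammingAvg_triangle (x y z : V → A) :
    hammingAvg x z ≤ hammingAvg x y + hammingAvg y z := by
  unfold hammingAvg
  rw [← add_div, ← Finset.sum_add_distrib]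
  gcongr
  exact dist_triangle _ _ _

end Hamming

/-! ### Covering and separation -/

section Cover

variable {Y : Type*} {d : Y → Y → ℝ}

/-- If `δ`-dense subsets of `Z` have at least `M` elements, then `Z` has a `δ`-separated subset
with `M` elements. -/
theorem exists_separated (hself : ∀ y, d y y = 0) (hsymm : ∀ y z, d y z = d z y) {δ : ℝ}
    (hδ : 0 < δ) {Z : Set Y} {M : ℕ}
    (h : ∀ F : Set Y, F ⊆ Z → (∀ z ∈ Z, ∃ y ∈ F, d z y < δ) → (M : ℕ∞) ≤ F.encard) :
    ∃ s : Finset Y, s.card = M ∧ (∀ y ∈ s, y ∈ Z) ∧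
      ∀ y ∈ s, ∀ z ∈ s, y ≠ z → δ ≤ d y z := by
  classical
  suffices H : ∀ j ≤ M, ∃ s : Finset Y, s.card = j ∧ (∀ y ∈ s, y ∈ Z) ∧
      ∀ y ∈ s, ∀ z ∈ s, y ≠ z → δ ≤ d y z from H M le_rfl
  intro j
  induction j with
  | zero => intro _; exact ⟨∅, by simp⟩
  | succ j ih =>
    intro hj
    obtain ⟨s, hs, hsZ, hsep⟩ := ih (by omega)
    -- With fewer than `M` points, `s` cannot be `δ`-dense, so it can be extended greedily.
    have : ∃ z ∈ Z, ∀ y ∈ s, δ ≤ d z y := by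
      by_contra! hcon
      have := h s hsZ hcon
      rw [Set.encard_coe_eq_coe_finsetCard, hs] at this
      have : M ≤ j := by exact_mod_cast this
      omega
    obtain ⟨z, hz, hzs⟩ := this
    have hzn : z ∉ s := fun hmem => by
      have := hzs z hmem
      rw [hself] at this
      linarith
    refine ⟨insert z s, by rw [Finset.card_insert_of_notMem hzn, hs], ?_, ?_⟩
    · intro y hy
      rcases Finset.mem_insert.1 hy with rfl | hy
      · exact hz
      · exact hsZ y hy
    · intro y hy w hw hne
      rcases Finset.mem_insert.1 hy with hy | hy <;> rcases Finset.mem_insert.1 hw with hw | hw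
      · exact absurd (hy.trans hw.symm) hne
      · exact hy ▸ hzs w hw
      · rw [hsymm]; exact hw ▸ hzs y hy
      · exact hsep y hy w hw hne

theorem exists_separated_of_le_coverNumber (hself : ∀ y, d y y = 0)
    (hsymm : ∀ y z, d y z = d z y) {δ : ℝ}
    (hδ : 0 < δ) {Z : Set Y} {M : ℕ} (h : (M : ℕ∞) ≤ coverNumber d δ Z) :
    ∃ s : Finset Y, s.card = M ∧ (∀ y ∈ s, y ∈ Z) ∧
      ∀ y ∈ s, ∀ z ∈ s, y ≠ z → δ ≤ d y z :=
  exists_separated hself hsymm hδ fun F hF hd => h.trans (sInf_le ⟨F, hF, hd, rfl⟩)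

/-- The image of a separated set cannot be covered by fewer balls of half the radius. -/
theorem le_coverNumber_of_separated (hsymm : ∀ y z, d y z = d z y)
    (htri : ∀ x y z, d x z ≤ d x y + d y z) {δ : ℝ} {Z : Set Y} {ι : Type*} (s : Finset ι)
    (f : ι → Y) (hZ : ∀ i ∈ s, f i ∈ Z)
    (hsep : ∀ i ∈ s, ∀ j ∈ s, i ≠ j → δ ≤ d (f i) (f j)) :
    (s.card : ℕ∞) ≤ coverNumber d (δ / 2) Z := by
  refine le_sInf ?_
  rintro _ ⟨F, -, hF, rfl⟩
  have h1 : ∀ i : s, ∃ y : F, d (f i) y < δ / 2 := fun i => by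
    obtain ⟨y, hy, h⟩ := hF (f i) (hZ i i.2)
    exact ⟨⟨y, hy⟩, h⟩
  choose g hg using h1
  -- Two points served by the same centre would be closer than `δ`.
  have hinj : Function.Injective g := by
    intro i j hij
    by_contra hne
    have h2 := hsep i i.2 j j.2 (fun h => hne (Subtype.ext h))
    have h3 := htri (f i) (g i) (f j)
    have h4 := hg i
    have h5 := hg j
    rw [hsymm (g i : Y), ← hij] at *
    linarith
  have h2 : ENat.card s ≤ ENat.card F := ENat.card_le_card_of_injective hinj
  rw [ENat.card_coe_set_eq] at h2
  simpa using h2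

/-- If a map to a finite type has fibres of small diameter on `Z`, then `Z` has a small cover. -/
theorem coverNumber_le_card {T : Type*} [Finite T] {δ : ℝ} {Z : Set Y} (f : Y → T)
    {R : Set T} (hR : ∀ y ∈ Z, f y ∈ R)
    (h : ∀ y ∈ Z, ∀ z ∈ Z, f y = f z → d y z < δ) :
    coverNumber d δ Z ≤ (R.ncard : ℕ∞) := by
  classical
  have h1 : ∀ t : f '' Z, ∃ y ∈ Z, f y = t := fun t => t.2
  choose g hgZ hg using h1
  have h2 : coverNumber d δ Z ≤ (range g).encard := by
    refine sInf_le ⟨range g, ?_, ?_, rfl⟩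
    · rintro _ ⟨t, rfl⟩; exact hgZ t
    · intro z hz
      exact ⟨_, ⟨⟨f z, z, hz, rfl⟩, rfl⟩, h _ hz _ (hgZ _) (hg ⟨f z, z, hz, rfl⟩).symm⟩
  refine h2.trans ?_
  rw [← Set.image_univ]
  refine (Set.encard_image_le _ _).trans ?_
  rw [Set.encard_univ, ENat.card_coe_set_eq, (Set.toFinite R).cast_ncard_eq]
  exact Set.encard_le_encard (by rintro _ ⟨y, hy, rfl⟩; exact hR y hy)

end Cover

/-! ### Exponential rates -/

section Rate

/-- Natural numbers replace extended counts so that counts can be multiplied; an infinite count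
supplies an `M` as large as needed. -/
theorem exists_nat_of_lt_logRate {a : ℝ} {c : ℕ∞} {N : ℕ} (hN : 0 < N)
    (h : (a : EReal) < logRate c N) : ∃ M : ℕ, (M : ℕ∞) ≤ c ∧ Real.exp (a * N) < M := by
  unfold logRate at h
  rw [EReal.lt_div_iff (by exact_mod_cast hN) (EReal.natCast_ne_top N)] at h
  induction c using ENat.recTopCoe with
  | top =>
    obtain ⟨M, hM⟩ := exists_nat_gt (Real.exp (a * N))
    exact ⟨M, le_top, hM⟩
  | coe M =>
    refine ⟨M, le_rfl, ?_⟩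
    rcases Nat.eq_zero_or_pos M with rfl | hM
    · simp at h
    have h1 : ((M : ℕ∞) : ℝ≥0∞) = ENNReal.ofReal M := by simp
    rw [h1, ENNReal.log_ofReal_of_pos (by exact_mod_cast hM)] at h
    have h2 : a * N < Real.log M := by exact_mod_cast h
    exact (Real.lt_log_iff_exp_lt (by exact_mod_cast hM)).1 h2

theorem le_logRate {a : ℝ} {c : ℕ∞} {N : ℕ} (hN : 0 < N) {M : ℕ} (hM : (M : ℕ∞) ≤ c)
    (h : Real.exp (a * N) ≤ M) : (a : EReal) ≤ logRate c N := by
  unfold logRate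
  rw [EReal.le_div_iff_mul_le (by exact_mod_cast hN) (EReal.natCast_ne_top N)]
  have hM0 : (0 : ℝ) < M := (Real.exp_pos _).trans_le h
  have h1 : ENNReal.ofReal M ≤ (c : ℝ≥0∞) := by
    have : ((M : ℕ∞) : ℝ≥0∞) ≤ (c : ℝ≥0∞) := by exact_mod_cast hM
    simpa using this
  refine le_trans ?_ (ENNReal.log_le_log h1)
  rw [ENNReal.log_ofReal_of_pos hM0]
  have : a * N ≤ Real.log M := (Real.le_log_iff_exp_le hM0).2 h
  exact_mod_cast this

theorem logRate_mono {c c' : ℕ∞} (h : c ≤ c') (N : ℕ) : logRate c N ≤ logRate c' N := by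
  unfold logRate
  have : (c : ℝ≥0∞) ≤ (c' : ℝ≥0∞) := by exact_mod_cast h
  exact EReal.div_le_div_right_of_nonneg (by simp) (ENNReal.log_le_log this)

theorem logRate_one (N : ℕ) : logRate 1 N = 0 := by
  simp [logRate]

end Rate

/-! ### Finite-valued measurable maps -/

section FinMeas

/-- All fibres over subsets are measurable. -/
def FinMeas {A T : Type*} [MeasurableSpace A] (ψ : A → T) : Prop :=
  ∀ S : Set T, MeasurableSet (ψ ⁻¹' S)

variable {A B T T' : Type*} [MeasurableSpace A] [MeasurableSpace B]

theorem FinMeas.of_fibre [Countable T] {ψ : A → T} (h : ∀ t, MeasurableSet (ψ ⁻¹' {t})) :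
    FinMeas ψ := fun S => by
  rw [← Set.biUnion_preimage_singleton]
  exact MeasurableSet.biUnion (Set.to_countable S) fun t _ => h t

theorem FinMeas.comp_left {ψ : A → T} (h : FinMeas ψ) (θ : T → T') : FinMeas (θ ∘ ψ) :=
  fun S => h (θ ⁻¹' S)

theorem FinMeas.comp_measurable {ψ : A → T} (h : FinMeas ψ) {f : B → A} (hf : Measurable f) :
    FinMeas (ψ ∘ f) := fun S => hf (h S)

theorem FinMeas.pi {ι : Type*} [Finite ι] {T : ι → Type*} [∀ i, Finite (T i)]
    {ψ : ∀ i, A → T i} (h : ∀ i, FinMeas (ψ i)) : FinMeas (fun a i => ψ i a) := by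
  refine FinMeas.of_fibre fun t => ?_
  have : (fun a i => ψ i a) ⁻¹' {t} = ⋂ i, ψ i ⁻¹' {t i} := by
    ext a; simp [funext_iff]
  rw [this]
  exact MeasurableSet.iInter fun i => h i _

theorem FinMeas.prodMk [Finite T] [Finite T'] {ψ : A → T} {ψ' : A → T'} (h : FinMeas ψ)
    (h' : FinMeas ψ') : FinMeas (fun a => (ψ a, ψ' a)) := by
  refine FinMeas.of_fibre fun t => ?_
  have : (fun a => (ψ a, ψ' a)) ⁻¹' {t} = ψ ⁻¹' {t.1} ∩ ψ' ⁻¹' {t.2} := by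
    ext a; simp [Prod.ext_iff]
  rw [this]
  exact (h _).inter (h' _)

theorem FinMeas.measurable [MeasurableSpace T] {ψ : A → T} (h : FinMeas ψ) : Measurable ψ :=
  fun S _ => h S

theorem Measurable.finMeas [Countable T] [MeasurableSpace T] [MeasurableSingletonClass T]
    {ψ : A → T} (h : Measurable ψ) : FinMeas ψ :=
  FinMeas.of_fibre fun _ => h (measurableSet_singleton _)

end FinMeas

/-! ### Finite models -/

section IsModel

variable {G V A T T' : Type*}

/-- The pattern of `y` seen through the window `F` at the vertex `v`. -/
def window (σ : G → Equiv.Perm V) (F : Finset G) (y : V → T) (v : V) : F → T :=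
  fun g => y (σ g v)

/-- The pattern of `ψ` along `z` in the window `F`. -/
def readWindow (ψ : A → T) (F : Finset G) (z : G → A) : F → T := fun g => ψ (z g)

/-- The law of the windows `F` of `y` is `η`-close to that of the process `ψ` under `P`. -/
def IsModel [Fintype V] [MeasurableSpace A] (P : ProbabilityMeasure (G → A)) (ψ : A → T)
    (F : Finset G) (η : ℝ) (σ : G → Equiv.Perm V) (y : V → T) : Prop :=
  ∀ S : Set (F → T), |freq {v | window σ F y v ∈ S} -
    (P : Measure (G → A)).real {z | readWindow ψ F z ∈ S}| < η

theorem FinMeas.readWindow [MeasurableSpace A] [Finite T] {ψ : A → T} (h : FinMeas ψ)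
    (F : Finset G) : FinMeas (readWindow ψ F) :=
  FinMeas.pi (ψ := fun (g : F) (z : G → A) => ψ (z g))
    fun _ => h.comp_measurable (measurable_pi_apply _)

variable [Fintype V] [MeasurableSpace A] {P : ProbabilityMeasure (G → A)}

theorem IsModel.map {ψ : A → T} {F : Finset G} {η : ℝ} {σ : G → Equiv.Perm V} {y : V → T}
    (h : IsModel P ψ F η σ y) (θ : T → T') : IsModel P (θ ∘ ψ) F η σ (θ ∘ y) :=
  fun S => h {p | θ ∘ p ∈ S}

theorem IsModel.mono {ψ : A → T} {F F' : Finset G} {η η' : ℝ} {σ : G → Equiv.Perm V} {y : V → T}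
    (h : IsModel P ψ F η σ y) (hF : F' ⊆ F) (hη : η ≤ η') : IsModel P ψ F' η' σ y :=
  fun S => (h {p | (fun g : F' => p ⟨g, hF g.2⟩) ∈ S}).trans_le hη

/-- Observables that agree along the whole window off an event of probability `ε` have window laws
that differ by at most `ε`. -/
theorem IsModel.of_ae_eq {ψ ψ' : A → T} {F : Finset G} {η ε : ℝ} {σ : G → Equiv.Perm V}
    {y : V → T} (h : IsModel P ψ F η σ y)
    (hε : (P : Measure (G → A)).real {z | ∃ g ∈ F, ψ (z g) ≠ ψ' (z g)} ≤ ε) :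
    IsModel P ψ' F (η + ε) σ y := by
  intro S
  have h1 := h S
  have key : ∀ φ φ' : A → T, (P : Measure (G → A)).real {z | ∃ g ∈ F, φ (z g) ≠ φ' (z g)} ≤ ε →
      (P : Measure (G → A)).real {z | readWindow φ F z ∈ S} ≤
      (P : Measure (G → A)).real {z | readWindow φ' F z ∈ S} + ε := by
    intro φ φ' hh
    refine (measureReal_mono (s₂ := {z | readWindow φ' F z ∈ S} ∪
      {z | ∃ g ∈ F, φ (z g) ≠ φ' (z g)}) ?_).trans
      ((measureReal_union_le _ _).trans (by gcongr))
    intro z hz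
    by_cases hc : ∃ g ∈ F, φ (z g) ≠ φ' (z g)
    · exact Or.inr hc
    · push Not at hc
      left
      have : readWindow φ' F z = readWindow φ F z := funext fun g => (hc g g.2).symm
      simpa [this] using hz
  have h2 := key ψ ψ' hε
  have h3 := key ψ' ψ (by simpa only [ne_comm] using hε)
  rw [abs_lt] at h1 ⊢
  constructor <;> linarith

/-- Needed because `σ 1` need not be the identity: the symbol read at the coordinate `1` of a window
is `y (σ 1 v)`, not `y v`. -/
theorem freq_perm (σ : Equiv.Perm V) (s : Set V) : freq {v | σ v ∈ s} = freq s := by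
  unfold freq
  congr 2
  exact Set.ncard_preimage_of_injective_subset_range σ.injective (by simp [σ.surjective.range_eq])

/-- The frequency of a symbol event in a model. -/
theorem IsModel.freq_symbol {ψ : A → T} {F : Finset G} {η : ℝ} {σ : G → Equiv.Perm V} {y : V → T}
    (h : IsModel P ψ F η σ y) {g : G} (hg : g ∈ F) (S : Set T) :
    |freq {v | y v ∈ S} - (P : Measure (G → A)).real {z | ψ (z g) ∈ S}| < η := by
  have := h {p | p ⟨g, hg⟩ ∈ S}
  have h2 := freq_perm (σ g) {v | y v ∈ S}
  rw [← h2]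
  exact this

theorem empiricalDist_real [Nonempty V] (σ : G → Equiv.Perm V) (x : V → A) {E : Set (G → A)}
    (hE : MeasurableSet E) :
    (empiricalDist σ x : Measure (G → A)).real E = freq {v | pullbackName σ v x ∈ E} := by
  classical
  change ((Fintype.card V : ℝ≥0∞)⁻¹ • ∑ v : V, Measure.dirac (pullbackName σ v x)).real E = _
  rw [measureReal_ennreal_smul_apply, freq_eq_sum]
  rw [Measure.real, Measure.finsetSum_apply, ENNReal.toReal_sum (by simp)]
  simp only [Measure.dirac_apply' _ hE, ENNReal.toReal_inv, ENNReal.toReal_natCast, mem_ofPred_eq]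
  rw [div_eq_inv_mul]
  congr 1
  refine Finset.sum_congr rfl fun v _ => ?_
  by_cases hv : pullbackName σ v x ∈ E <;> simp [hv]

end IsModel

/-! ### From weak-* neighbourhoods to finite models -/

section Portmanteau

variable {G : Type*} [Countable G] {A T : Type*} [MetricSpace A] [CompactSpace A]
  [MeasurableSpace A] [BorelSpace A]

theorem eventually_real_close (P : ProbabilityMeasure (G → A)) {E : Set (G → A)}
    (h : (P : Measure (G → A)) (frontier E) = 0) {η : ℝ} (hη : 0 < η) :
    ∀ᶠ Q : ProbabilityMeasure (G → A) in 𝓝 P,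
      |(Q : Measure (G → A)).real E - (P : Measure (G → A)).real E| < η := by
  have h1 := ProbabilityMeasure.tendsto_measure_of_null_frontier_of_tendsto' (L := 𝓝 P)
    (μs := id) tendsto_id h
  have h2 := (ENNReal.tendsto_toReal (measure_ne_top _ _)).comp h1
  have := (Metric.tendsto_nhds.1 h2) η hη
  exact this

/-- Good models for a small neighbourhood of `P` are mapped to finite models by a finite-valued
map which is locally constant almost everywhere. -/
theorem exists_nhds_isModel [Finite T] (P : ProbabilityMeasure (G → A)) {ψ : A → T}
    (hm : FinMeas ψ) (F : Finset G)
    (hψ : ∀ g ∈ F, ∀ᵐ z ∂(P : Measure (G → A)), ∀ᶠ a in 𝓝 (z g), ψ a = ψ (z g))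
    {η : ℝ} (hη : 0 < η) :
    ∃ O ∈ 𝓝 P, ∀ (V : Type) [Fintype V] [Nonempty V] (σ : G → Equiv.Perm V) (x : V → A),
      x ∈ goodModels O σ → IsModel P ψ F η σ (ψ ∘ x) := by
  -- If `ψ` is locally constant at each coordinate of the window, then so is the pattern. Hence
  -- pattern events have null frontier and the portmanteau theorem applies to them.
  have hfr : ∀ S : Set (F → T), (P : Measure (G → A)) (frontier {z | readWindow ψ F z ∈ S}) = 0 := by
    intro S
    have h1 : ∀ᵐ z ∂(P : Measure (G → A)), ∀ g ∈ F, ∀ᶠ a in 𝓝 (z g), ψ a = ψ (z g) :=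
      (ae_ball_iff (Finset.countable_toSet F)).2 hψ
    refine measure_mono_null ?_ (ae_iff.1 h1)
    intro z hz hcon
    have h2 : ∀ᶠ z' in 𝓝 z, readWindow ψ F z' = readWindow ψ F z := by
      have : ∀ᶠ z' in 𝓝 z, ∀ g ∈ F, ψ (z' g) = ψ (z g) :=
        (Filter.eventually_all_finset F).2 fun g hg =>
          (continuous_apply g).continuousAt.eventually (hcon g hg)
      filter_upwards [this] with z' hz'
      exact funext fun g => hz' g g.2
    rw [frontier_eq_closure_inter_closure] at hz
    obtain ⟨a, ha1, ha2⟩ := (mem_closure_iff_frequently.1 hz.1 |>.and_eventually h2).exists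
    obtain ⟨b, hb1, hb2⟩ := (mem_closure_iff_frequently.1 hz.2 |>.and_eventually h2).exists
    simp only [mem_ofPred_eq, mem_compl_iff] at ha1 hb1
    rw [hb2] at hb1
    rw [ha2] at ha1
    exact hb1 ha1
  refine ⟨{Q | ∀ S : Set (F → T), |(Q : Measure (G → A)).real {z | readWindow ψ F z ∈ S} -
    (P : Measure (G → A)).real {z | readWindow ψ F z ∈ S}| < η},
    Filter.eventually_all.2 fun S => eventually_real_close P (hfr S) hη, ?_⟩
  intro V _ _ σ x hx S
  have := hx S
  have h2 := empiricalDist_real σ x (hm.readWindow F S)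
  change |(empiricalDist σ x : Measure (G → A)).real (readWindow ψ F ⁻¹' S) - _| < η at this
  rw [h2] at this
  exact this

end Portmanteau

/-! ### Approximation of finite-valued measurable maps -/

section Approx

variable {A T : Type*} [MetricSpace A] [CompactSpace A] [MeasurableSpace A] [BorelSpace A]
  [Finite T]

/-- The fibres of a finite-valued measurable map contain compact sets of almost full measure at
positive distance from each other. -/
theorem exists_separated_compacts (μ : Measure A) [IsFiniteMeasure μ] {ψ : A → T}
    (hm : FinMeas ψ) {ε : ℝ} (hε : 0 < ε) :
    ∃ (K : T → Set A) (κ : ℝ), 0 < κ ∧ (∀ t, IsCompact (K t)) ∧ (∀ t, K t ⊆ ψ ⁻¹' {t}) ∧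
      μ.real (⋃ t, K t)ᶜ ≤ ε ∧
      ∀ t t', t ≠ t' → ∀ a ∈ K t, ∀ a' ∈ K t', κ ≤ dist a a' := by
  have := Fintype.ofFinite T
  set N : ℝ := Fintype.card T + 1
  have hN : 0 < N := by positivity
  have h1 : ∀ t : T, ∃ K : Set A, IsClosed K ∧ K ⊆ ψ ⁻¹' {t} ∧ μ.real (ψ ⁻¹' {t} \ K) ≤ ε / N := by
    intro t
    obtain ⟨K, hK, hKc, hKm⟩ := (hm {t}).exists_isClosed_sdiff_lt (μ := μ) (measure_ne_top _ _)
      (ε := ENNReal.ofReal (ε / N)) (by simp; positivity)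
    exact ⟨K, hKc, hK, ENNReal.toReal_le_of_le_ofReal (by positivity) hKm.le⟩
  choose K hKc hKs hKm using h1
  have h2 : ∀ p : T × T, ∃ κ : ℝ, 0 < κ ∧
      (p.1 ≠ p.2 → ∀ a ∈ K p.1, ∀ a' ∈ K p.2, κ ≤ dist a a') := by
    rintro ⟨t, t'⟩
    by_cases htt : t = t'
    · exact ⟨1, one_pos, fun h => absurd htt h⟩
    have hd : Disjoint (K t) (K t') := by
      refine Set.disjoint_left.2 fun a ha ha' => htt ?_
      rw [← (hKs t ha : ψ a = t), ← (hKs t' ha' : ψ a = t')]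
    obtain ⟨κ, hκ, hdis⟩ := hd.exists_thickenings (hKc t).isCompact (hKc t')
    refine ⟨κ, hκ, fun _ a ha a' ha' => ?_⟩
    by_contra! hcon
    refine Set.disjoint_left.1 hdis (Metric.self_subset_thickening hκ _ ha) ?_
    exact Metric.mem_thickening_iff.2 ⟨a', ha', hcon⟩
  choose κ hκ hsep using h2
  obtain ⟨κ0, hκ0, hle⟩ : ∃ κ0 : ℝ, 0 < κ0 ∧ ∀ p, κ0 ≤ κ p := by
    rcases isEmpty_or_nonempty (T × T) with h | h
    · exact ⟨1, one_pos, fun p => h.elim p⟩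
    · obtain ⟨p, hp⟩ := Finite.exists_min κ
      exact ⟨κ p, hκ p, hp⟩
  refine ⟨K, κ0, hκ0, fun t => (hKc t).isCompact, hKs, ?_, fun t t' htt a ha a' ha' =>
    (hle (t, t')).trans (hsep (t, t') htt a ha a' ha')⟩
  have hsub : (⋃ t, K t)ᶜ ⊆ ⋃ t, (ψ ⁻¹' {t} \ K t) := by
    intro a ha
    simp only [mem_compl_iff, mem_iUnion, not_exists] at ha
    exact mem_iUnion.2 ⟨ψ a, rfl, ha _⟩
  calc μ.real (⋃ t, K t)ᶜ ≤ μ.real (⋃ t, (ψ ⁻¹' {t} \ K t)) := measureReal_mono hsub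
    _ ≤ ∑ t, μ.real (ψ ⁻¹' {t} \ K t) := measureReal_iUnion_fintype_le _
    _ ≤ ∑ _t : T, ε / N := Finset.sum_le_sum fun t _ => hKm t
    _ = Fintype.card T * (ε / N) := by simp
    _ ≤ ε := by
      rw [mul_div_assoc', div_le_iff₀ hN]
      have : (Fintype.card T : ℝ) ≤ N := by simp [N]
      nlinarith

/-- A finite-valued measurable map agrees, off a set of small measure, with a map that is locally
constant almost everywhere. -/
theorem exists_ae_locally_constant (μ : Measure A) [IsFiniteMeasure μ] {ψ : A → T}
    (hm : FinMeas ψ) {ε ρ : ℝ} (hε : 0 < ε) (hρ : 0 < ρ) :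
    ∃ ψ' : A → Option T, FinMeas ψ' ∧ (∀ᵐ a ∂μ, ∀ᶠ a' in 𝓝 a, ψ' a' = ψ' a) ∧
      (∀ a t, ψ' a = some t → ∃ a', dist a a' < ρ ∧ ψ a' = t) ∧
      μ.real {a | some (ψ a) ≠ ψ' a} ≤ ε := by
  classical
  have := Fintype.ofFinite T
  obtain ⟨K, κ, hκ, -, hKs, hKm, hsep⟩ := exists_separated_compacts μ hm hε
  -- Radii below `κ / 2` make the thickenings disjoint, and radii below `ρ` bound the distance to a
  -- point with the given value. Points outside all thickenings will get the value `none`.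
  have h1 : ∀ t : T, ∃ r : ℝ, r ∈ Ioo 0 (min ρ (κ / 2)) ∧
      μ (frontier (Metric.thickening r (K t))) = 0 := fun t => by
    obtain ⟨r, hr, h⟩ := exists_null_frontier_thickening μ (K t) (a := 0) (b := min ρ (κ / 2))
      (by positivity)
    exact ⟨r, hr, h⟩
  choose r hr hfr using h1
  set U : T → Set A := fun t => Metric.thickening (r t) (K t) with hU
  have hdisj : ∀ t t' a, a ∈ U t → a ∈ U t' → t = t' := by
    intro t t' a ha ha'
    by_contra hne
    obtain ⟨z, hz, hd⟩ := Metric.mem_thickening_iff.1 ha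
    obtain ⟨z', hz', hd'⟩ := Metric.mem_thickening_iff.1 ha'
    have h3 := hsep t t' hne z hz z' hz'
    have h4 := dist_triangle z a z'
    rw [dist_comm z a] at h4
    have h5 := (hr t).2.trans_le (min_le_right _ _)
    have h6 := (hr t').2.trans_le (min_le_right _ _)
    linarith
  have hopen : ∀ t, IsOpen (U t) := fun t => Metric.isOpen_thickening
  set ψ' : A → Option T := fun a => if h : ∃ t, a ∈ U t then some h.choose else none with hψ'
  have hsome : ∀ a t, ψ' a = some t ↔ a ∈ U t := by
    intro a t
    simp only [hψ']
    split_ifs with h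
    · constructor
      · intro h2
        rw [← Option.some.inj h2]
        exact h.choose_spec
      · intro h2
        rw [hdisj _ _ a h2 h.choose_spec]
    · simp only [false_iff]
      exact fun h2 => h ⟨t, h2⟩
  have hnone : ∀ a, ψ' a = none ↔ ∀ t, a ∉ U t := by
    intro a
    rw [Option.eq_none_iff_forall_ne_some]
    exact forall_congr' fun t => not_congr (hsome a t)
  refine ⟨ψ', FinMeas.of_fibre fun o => ?_, ?_, ?_, ?_⟩
  · cases o with
    | none =>
      have : ψ' ⁻¹' {none} = ⋂ t, (U t)ᶜ := by
        ext a; simpa using hnone a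
      rw [this]
      exact MeasurableSet.iInter fun t => (hopen t).measurableSet.compl
    | some t =>
      have : ψ' ⁻¹' {some t} = U t := by
        ext a; simpa using hsome a t
      rw [this]
      exact (hopen t).measurableSet
  · have h2 : ∀ᵐ a ∂μ, ∀ t, a ∉ frontier (U t) :=
      ae_all_iff.2 fun t => measure_eq_zero_iff_ae_notMem.1 (hfr t)
    filter_upwards [h2] with a ha
    by_cases hex : ∃ t, a ∈ U t
    · obtain ⟨t, ht⟩ := hex
      filter_upwards [(hopen t).mem_nhds ht] with b hb
      rw [(hsome b t).2 hb, (hsome a t).2 ht]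
    · push Not at hex
      have h3 : ∀ᶠ b in 𝓝 a, ∀ t, b ∉ U t := by
        refine Filter.eventually_all.2 fun t => ?_
        have : a ∉ closure (U t) := fun hc => ha t ⟨hc, fun hi => hex t (interior_subset hi)⟩
        filter_upwards [isClosed_closure.isOpen_compl.mem_nhds this] with b hb hbU
        exact hb (subset_closure hbU)
      filter_upwards [h3] with b hb
      rw [(hnone b).2 hb, (hnone a).2 hex]
  · intro a t hat
    obtain ⟨z, hz, hd⟩ := Metric.mem_thickening_iff.1 ((hsome a t).1 hat)
    exact ⟨z, hd.trans ((hr t).2.trans_le (min_le_left _ _)), hKs t hz⟩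
  · refine (measureReal_mono ?_).trans hKm
    intro a ha hcon
    obtain ⟨t, ht⟩ := mem_iUnion.1 hcon
    have h4 : ψ a = t := hKs t ht
    refine ha ?_
    rw [h4, eq_comm, hsome]
    exact Metric.self_subset_thickening (hr t).1 _ ht

/-- A compact metric space has a finite measurable partition into sets of small diameter. -/
theorem exists_fine_partition (A : Type*) [MetricSpace A] [CompactSpace A] [MeasurableSpace A]
    [BorelSpace A] {δ : ℝ} (hδ : 0 < δ) :
    ∃ (N : ℕ) (φ : A → Fin N), FinMeas φ ∧ ∀ a a', φ a = φ a' → dist a a' < δ := by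
  classical
  obtain ⟨s, -, hs, hcov⟩ := Metric.totallyBounded_iff.1 (isCompact_univ (X := A)).totallyBounded
    (δ / 2) (by positivity) |>.imp fun s hs => (⟨subset_univ s, hs.1, hs.2⟩ : _ ∧ _ ∧ _)
  obtain ⟨N, f, -, hf⟩ := hs.fin_param
  have hcov' : ∀ a : A, ∃ i, dist a (f i) < δ / 2 := fun a => by
    obtain ⟨y, hy, h⟩ := mem_iUnion₂.1 (hcov (mem_univ a))
    rw [← hf] at hy
    obtain ⟨i, rfl⟩ := hy
    exact ⟨i, h⟩
  -- Sending each point to the first ball that contains it makes the cover disjoint.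
  refine ⟨N, fun a => Fin.find (fun i => dist a (f i) < δ / 2) (hcov' a), ?_, ?_⟩
  · refine FinMeas.of_fibre fun i => ?_
    have : (fun a => Fin.find (fun i => dist a (f i) < δ / 2) (hcov' a)) ⁻¹' {i} =
        Metric.ball (f i) (δ / 2) ∩ ⋂ j : Fin N, ⋂ _ : j < i, (Metric.ball (f j) (δ / 2))ᶜ := by
      ext a
      simp only [mem_preimage, mem_singleton_iff, Fin.find_eq_iff, mem_inter_iff, mem_iInter,
        mem_compl_iff, Metric.mem_ball]
    rw [this]
    exact measurableSet_ball.inter (MeasurableSet.iInter fun j => MeasurableSet.iInter fun _ =>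
      measurableSet_ball.compl)
  · intro a a' h
    have h1 := Fin.find_spec (hcov' a)
    have h2 := Fin.find_spec (hcov' a')
    simp only at h
    rw [← h] at h2
    calc dist a a' ≤ dist a _ + dist a' _ := dist_triangle_right _ _ _
      _ < δ := by linarith

end Approx

/-! ### Measures close to a process law -/

section Integrals

variable {Ω Ω' W : Type*} [MeasurableSpace Ω] [MeasurableSpace Ω']

theorem abs_integral_sub_le {μ : Measure Ω} [IsProbabilityMeasure μ] {u u' : Ω → ℝ}
    (hu : Integrable u μ) (hu' : Integrable u' μ) {C ε κ : ℝ} {B : Set Ω} (hε : 0 ≤ ε)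
    (hC : ∀ ω, |u ω| ≤ C) (hC' : ∀ ω, |u' ω| ≤ C) (hB : μ.real B ≤ κ)
    (h : ∀ ω, ω ∉ B → |u ω - u' ω| ≤ ε) : |∫ ω, u ω ∂μ - ∫ ω, u' ω ∂μ| ≤ ε + 2 * C * κ := by
  have hC0 : 0 ≤ C := by
    obtain ⟨ω⟩ := μ.nonempty_of_neZero
    exact (abs_nonneg _).trans (hC ω)
  rw [← integral_sub hu hu']
  -- `B` is not assumed measurable, so its measurable hull takes its place.
  set B' := toMeasurable μ B
  have hB' : MeasurableSet B' := measurableSet_toMeasurable _ _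
  have hi : Integrable (fun ω => ε + B'.indicator (fun _ => 2 * C) ω) μ :=
    (integrable_const _).add ((integrable_const _).indicator hB')
  calc |∫ ω, (u ω - u' ω) ∂μ| ≤ ∫ ω, |u ω - u' ω| ∂μ := abs_integral_le_integral_abs
    _ ≤ ∫ ω, (ε + B'.indicator (fun _ => 2 * C) ω) ∂μ := by
      refine integral_mono (hu.sub hu').abs hi fun ω => ?_
      by_cases hω : ω ∈ B'
      · simp only [indicator_of_mem hω]
        have := abs_sub (u ω) (u' ω)
        linarith [hC ω, hC' ω]
      · simp only [indicator_of_notMem hω, add_zero]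
        exact h ω fun hb => hω (subset_toMeasurable _ _ hb)
    _ = ε + 2 * C * μ.real B := by
      rw [integral_add (integrable_const _) ((integrable_const _).indicator hB'),
        integral_indicator hB']
      simp [B', Measure.real, mul_comm]
    _ ≤ ε + 2 * C * κ := by gcongr

/-- The positive and the negative part of `x - y` are each governed by a single set `S`. -/
theorem sum_abs_sub_le {W : Type*} [Fintype W] {x y : W → ℝ} {κ : ℝ}
    (h : ∀ S : Finset W, |∑ w ∈ S, x w - ∑ w ∈ S, y w| ≤ κ) : ∑ w, |x w - y w| ≤ 2 * κ := by
  classical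
  rw [← Finset.sum_filter_add_sum_filter_not Finset.univ (fun w => y w ≤ x w)]
  have h1 := (abs_le.1 (h (Finset.univ.filter fun w => y w ≤ x w))).2
  have h2 := (abs_le.1 (h (Finset.univ.filter fun w => ¬ y w ≤ x w))).1
  rw [← Finset.sum_sub_distrib] at h1 h2
  have h3 : ∑ w with y w ≤ x w, |x w - y w| = ∑ w with y w ≤ x w, (x w - y w) :=
    Finset.sum_congr rfl fun w hw => abs_of_nonneg (by
      have := (Finset.mem_filter.1 hw).2; linarith)
  have h4 : ∑ w with ¬ y w ≤ x w, |x w - y w| = -∑ w with ¬ y w ≤ x w, (x w - y w) := by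
    rw [← Finset.sum_neg_distrib]
    exact Finset.sum_congr rfl fun w hw => abs_of_neg (by
      have := (Finset.mem_filter.1 hw).2; linarith)
  rw [h3, h4]
  linarith

theorem integral_finMeas [Fintype W] (μ : Measure Ω) [IsProbabilityMeasure μ] {a : Ω → W}
    (ha : FinMeas a) (f : W → ℝ) : ∫ ω, f (a ω) ∂μ = ∑ w, μ.real (a ⁻¹' {w}) * f w := by
  let _ : MeasurableSpace W := ⊤
  have hma : Measurable a := ha.measurable
  have := Measure.isProbabilityMeasure_map (μ := μ) hma.aemeasurable
  rw [← integral_map (φ := a) hma.aemeasurable (f := f)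
    (measurable_from_top (f := f)).aestronglyMeasurable, integral_fintype Integrable.of_finite]
  refine Finset.sum_congr rfl fun w _ => ?_
  rw [smul_eq_mul, map_measureReal_apply hma trivial]

theorem real_preimage_eq_sum [Fintype W] (μ : Measure Ω) [IsFiniteMeasure μ] {a : Ω → W}
    (ha : FinMeas a) (S : Finset W) : μ.real (a ⁻¹' S) = ∑ w ∈ S, μ.real (a ⁻¹' {w}) := by
  classical
  rw [← measureReal_biUnion_finset]
  · congr 1; ext; simp
  · intro w _ w' _ hne
    exact Set.disjoint_left.2 fun ω h h' => hne (by
      rw [← (show a ω = w from h), ← (show a ω = w' from h')])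
  · exact fun w _ => ha _

theorem integrable_finMeas {μ : Measure Ω} [IsFiniteMeasure μ] {a : Ω → W} (ha : FinMeas a)
    {f : W → ℝ} {C : ℝ} (hf : ∀ w, |f w| ≤ C) : Integrable (fun ω => f (a ω)) μ := by
  let _ : MeasurableSpace W := ⊤
  exact Integrable.of_bound (C := C)
    ((measurable_from_top (f := f)).comp ha.measurable).aestronglyMeasurable
    (ae_of_all _ fun ω => hf _)

theorem abs_integral_sub_le_of_close [Finite W] {μ : Measure Ω} [IsProbabilityMeasure μ]
    {ν : Measure Ω'} [IsProbabilityMeasure ν] {a : Ω → W} {b : Ω' → W} (ha : FinMeas a)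
    (hb : FinMeas b) {f : W → ℝ} {C κ : ℝ} (hf : ∀ w, |f w| ≤ C)
    (h : ∀ S : Set W, |μ.real (a ⁻¹' S) - ν.real (b ⁻¹' S)| ≤ κ) :
    |∫ ω, f (a ω) ∂μ - ∫ ω, f (b ω) ∂ν| ≤ 2 * C * κ := by
  have := Fintype.ofFinite W
  have hC0 : 0 ≤ C := by
    obtain ⟨ω⟩ := μ.nonempty_of_neZero
    exact (abs_nonneg _).trans (hf (a ω))
  rw [integral_finMeas μ ha, integral_finMeas ν hb, ← Finset.sum_sub_distrib]
  calc _ ≤ ∑ w, |μ.real (a ⁻¹' {w}) * f w - ν.real (b ⁻¹' {w}) * f w| :=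
        Finset.abs_sum_le_sum_abs _ _
    _ ≤ ∑ w, |μ.real (a ⁻¹' {w}) - ν.real (b ⁻¹' {w})| * C := by
        refine Finset.sum_le_sum fun w _ => ?_
        rw [← sub_mul, abs_mul]
        gcongr
        exact hf w
    _ = (∑ w, |μ.real (a ⁻¹' {w}) - ν.real (b ⁻¹' {w})|) * C := by rw [Finset.sum_mul]
    _ ≤ 2 * κ * C := by
        gcongr
        refine sum_abs_sub_le fun S => ?_
        rw [← real_preimage_eq_sum μ ha, ← real_preimage_eq_sum ν hb]
        exact h S
    _ = _ := by ring

end Integrals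

/-! ### Finite shadows of a process law -/

section Shadow

variable {G : Type*} {A : Type*} [MetricSpace A] [MeasurableSpace A]

/-- `Q` is, up to `κ` and on the window `E`, the image of a measure on a finite set `W` close to
the law of a `W`-valued observable `ψ` of `P` from which the point can be reconstructed. -/
def Shadows (P : ProbabilityMeasure (G → A)) (E : Finset G) (κ : ℝ)
    (Q : ProbabilityMeasure (G → A)) : Prop :=
  ∃ (W : Type w) (_ : Finite W) (q : W → G → A) (ψ : (G → A) → W) (Ω : Type w')
    (_ : MeasurableSpace Ω) (ν : ProbabilityMeasure Ω) (a : Ω → W) (b : Ω → G → A),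
    FinMeas ψ ∧ FinMeas a ∧ Measurable b ∧
    (Q : Measure (G → A)) = (ν : Measure Ω).map b ∧
    (P : Measure (G → A)).real {z | ∃ g ∈ E, κ ≤ dist (q (ψ z) g) (z g)} < κ ∧
    (ν : Measure Ω).real {ω | ∃ g ∈ E, b ω g ≠ q (a ω) g} < κ ∧
    ∀ S : Set W, |(ν : Measure Ω).real (a ⁻¹' S) - (P : Measure (G → A)).real (ψ ⁻¹' S)| < κ

theorem Shadows.mono {P Q : ProbabilityMeasure (G → A)} {E E' : Finset G} {κ κ' : ℝ}
    (h : Shadows.{w, w'} P E κ Q) (hE : E' ⊆ E) (hκ : κ ≤ κ') : Shadows.{w, w'} P E' κ' Q := by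
  obtain ⟨W, hW, q, ψ, Ω, hΩ, ν, a, b, h1, h2, h3, h4, h5, h6, h7⟩ := h
  refine ⟨W, hW, q, ψ, Ω, hΩ, ν, a, b, h1, h2, h3, h4, ?_, ?_, fun S => (h7 S).trans_le hκ⟩
  · refine lt_of_le_of_lt (measureReal_mono ?_) (h5.trans_le hκ)
    rintro z ⟨g, hg, hz⟩
    exact ⟨g, hE hg, hκ.trans hz⟩
  · refine lt_of_le_of_lt (measureReal_mono ?_) (h6.trans_le hκ)
    rintro z ⟨g, hg, hz⟩
    exact ⟨g, hE hg, hz⟩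

omit [MeasurableSpace A] in
-- By compactness `f` is uniformly continuous, and the product uniformity constrains only finitely
-- many coordinates.
theorem exists_window_uniform [CompactSpace A] {f : (G → A) → ℝ} (hf : Continuous f) {ε : ℝ} (hε : 0 < ε) :
    ∃ (E : Finset G) (κ : ℝ), 0 < κ ∧
      ∀ z z' : G → A, (∀ g ∈ E, dist (z g) (z' g) < κ) → |f z - f z'| < ε := by
  have h1 := CompactSpace.uniformContinuous_of_continuous hf
  have h2 := h1 (Metric.dist_mem_uniformity hε)
  rw [Filter.mem_map, Pi.uniformity] at h2
  obtain ⟨I, hI, U, hU, -, hUeq⟩ := Filter.mem_iInf'.1 h2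
  have h3 : ∀ g : G, ∃ κ : ℝ, 0 < κ ∧ ∀ z z' : G → A, dist (z g) (z' g) < κ → (z, z') ∈ U g := by
    intro g
    obtain ⟨t, ht, hsub⟩ := Filter.mem_comap.1 (hU g)
    obtain ⟨κ, hκ, h⟩ := Metric.mem_uniformity_dist.1 ht
    exact ⟨κ, hκ, fun z z' hd => hsub (h hd)⟩
  choose κ hκ hk using h3
  obtain ⟨κ0, hκ0, hle⟩ : ∃ κ0 : ℝ, 0 < κ0 ∧ ∀ g ∈ hI.toFinset, κ0 ≤ κ g := by
    rcases hI.toFinset.eq_empty_or_nonempty with h | h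
    · exact ⟨1, one_pos, by simp [h]⟩
    · obtain ⟨g, hg, hmin⟩ := Finset.exists_min_image hI.toFinset κ h
      exact ⟨κ g, hκ g, hmin⟩
  refine ⟨hI.toFinset, κ0, hκ0, fun z z' hd => ?_⟩
  have h4 : (z, z') ∈ ⋂ i ∈ I, U i := by
    refine mem_iInter₂.2 fun g hg => hk g z z' ?_
    exact (hd g (hI.mem_toFinset.2 hg)).trans_le (hle g (hI.mem_toFinset.2 hg))
  rw [← hUeq.1] at h4
  exact h4

variable [CompactSpace A] [BorelSpace A] [Countable G]

/-- Shadows of `P` are weak-* close to `P`. -/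
theorem exists_shadows_subset {P : ProbabilityMeasure (G → A)}
    {O : Set (ProbabilityMeasure (G → A))} (hO : O ∈ 𝓝 P) :
    ∃ (E : Finset G) (κ : ℝ), 0 < κ ∧ ∀ Q, Shadows.{w, w'} P E κ Q → Q ∈ O := by
  classical
  -- The sets of shadows generate a filter. The claim is that it is finer than `𝓝 P`, and this can
  -- be tested on integrals of continuous functions.
  set 𝓕 : Filter (ProbabilityMeasure (G → A)) :=
    ⨅ p : Finset G × {κ : ℝ // 0 < κ}, 𝓟 {Q | Shadows.{w, w'} P p.1 p.2 Q} with h𝓕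
  have hmem : ∀ s, s ∈ 𝓕 ↔ ∃ p : Finset G × {κ : ℝ // 0 < κ},
      {Q | Shadows.{w, w'} P p.1 p.2 Q} ⊆ s := by
    intro s
    have : Nonempty (Finset G × {κ : ℝ // 0 < κ}) := ⟨(∅, ⟨1, one_pos⟩)⟩
    rw [h𝓕, Filter.mem_iInf_of_directed]
    · simp only [mem_principal]
    · intro p q
      refine ⟨(p.1 ∪ q.1, ⟨min p.2 q.2, lt_min p.2.2 q.2.2⟩), ?_, ?_⟩
      · exact Filter.principal_mono.2 fun Q (hQ : Shadows _ _ _ _) =>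
          hQ.mono Finset.subset_union_left (min_le_left _ _)
      · exact Filter.principal_mono.2 fun Q (hQ : Shadows _ _ _ _) =>
          hQ.mono Finset.subset_union_right (min_le_right _ _)
  suffices h : Tendsto id 𝓕 (𝓝 P) by
    obtain ⟨p, hp⟩ := (hmem _).1 (h hO)
    exact ⟨p.1, p.2, p.2.2, fun Q hQ => hp hQ⟩
  rw [ProbabilityMeasure.tendsto_iff_forall_integral_tendsto]
  intro f
  rw [Metric.tendsto_nhds]
  intro ε hε
  obtain ⟨E, κ, hκ, hE⟩ := exists_window_uniform f.continuous (ε := ε / 4) (by positivity)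
  set C : ℝ := ‖f‖ + 1
  have hC : 0 < C := by positivity
  have hfC : ∀ z, |f z| ≤ C := fun z => (f.norm_coe_le_norm z).trans (by simp [C])
  refine (hmem _).2 ⟨(E, ⟨min κ (ε / (16 * C)), by positivity⟩), ?_⟩
  rintro Q ⟨W, hW, q, ψ, Ω, hΩ, ν, a, b, hψ, ha, hb, hQ, h5, h6, h7⟩
  set κ' := min κ (ε / (16 * C))
  have hκ' : C * κ' ≤ ε / 16 := by
    calc C * κ' ≤ C * (ε / (16 * C)) := by gcongr; exact min_le_right _ _
      _ = ε / 16 := by field_simp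
  have hfm : Measurable f := f.continuous.measurable
  have e1 : ∫ z, f z ∂(Q : Measure (G → A)) = ∫ ω, f (b ω) ∂(ν : Measure Ω) := by
    rw [hQ, integral_map hb.aemeasurable hfm.aestronglyMeasurable]
  -- The integral of `f` is compared along `b`, `q ∘ a`, `q ∘ ψ` and the identity. Since `2 * C * κ'
  -- ≤ ε / 8`, the three errors add up to at most `7 * ε / 8`.
  have e2 : |∫ ω, f (b ω) ∂(ν : Measure Ω) - ∫ ω, f (q (a ω)) ∂(ν : Measure Ω)| ≤
      ε / 4 + 2 * C * κ' := by
    refine abs_integral_sub_le ?_ (integrable_finMeas ha fun w => hfC (q w)) (by positivity) (fun _ => hfC _) (fun _ => hfC _)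
      h6.le ?_
    · exact Integrable.of_bound (C := C) (hfm.comp hb).aestronglyMeasurable
        (ae_of_all _ fun ω => hfC _)
    · intro ω hω
      simp only [mem_ofPred_eq, not_exists, not_and, not_not] at hω
      exact (hE _ _ fun g hg => by rw [hω g hg, dist_self]; exact hκ).le
  have e3 : |∫ z, f (q (ψ z)) ∂(P : Measure (G → A)) - ∫ z, f z ∂(P : Measure (G → A))| ≤
      ε / 4 + 2 * C * κ' := by
    refine abs_integral_sub_le (integrable_finMeas hψ fun w => hfC (q w)) ?_ (by positivity) (fun _ => hfC _) (fun _ => hfC _)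
      h5.le ?_
    · exact Integrable.of_bound (C := C) hfm.aestronglyMeasurable (ae_of_all _ fun ω => hfC _)
    · intro z hz
      simp only [mem_ofPred_eq, not_exists, not_and, not_le] at hz
      exact (hE _ _ fun g hg => (hz g hg).trans_le (min_le_left _ _)).le
  have e4 := abs_integral_sub_le_of_close (f := fun w => f (q w)) (C := C) (κ := κ') ha hψ
    (fun w => hfC _) (fun S => (h7 S).le)
  simp only [mem_ofPred_eq, id]
  rw [Real.dist_eq, e1, abs_lt]
  rw [abs_le] at e2 e3 e4
  constructor <;> linarith [e2.1, e2.2, e3.1, e3.2, e4.1, e4.2]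

end Shadow

/-! ### Uniform measures -/

section Uniform

variable {V : Type*} [Fintype V] [Nonempty V] [MeasurableSpace V]

/-- The uniform probability measure on a finite set. -/
noncomputable def uniformLaw (V : Type*) [Fintype V] [Nonempty V] [MeasurableSpace V] :
    ProbabilityMeasure V :=
  ⟨(Fintype.card V : ℝ≥0∞)⁻¹ • ∑ v : V, Measure.dirac v, ⟨by
    simp [ENNReal.inv_mul_cancel]⟩⟩

theorem uniformLaw_map {B : Type*} [MeasurableSpace B] {b : V → B} (hb : Measurable b) :
    (uniformLaw V : Measure V).map b =
      (Fintype.card V : ℝ≥0∞)⁻¹ • ∑ v : V, Measure.dirac (b v) := by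
  change Measure.map b ((Fintype.card V : ℝ≥0∞)⁻¹ • ∑ v : V, Measure.dirac v) = _
  rw [Measure.map_smul]
  congr 1
  ext s hs
  rw [Measure.map_apply hb hs]
  simp only [Measure.finsetSum_apply, Measure.dirac_apply' _ hs, Measure.dirac_apply' _ (hb hs)]
  rfl

theorem uniformLaw_real [MeasurableSingletonClass V] (s : Set V) :
    (uniformLaw V : Measure V).real s = freq s := by
  classical
  change ((Fintype.card V : ℝ≥0∞)⁻¹ • ∑ v : V, Measure.dirac v).real s = _
  rw [measureReal_ennreal_smul_apply, freq_eq_sum]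
  rw [Measure.real, Measure.finsetSum_apply, ENNReal.toReal_sum (fun v _ => measure_ne_top _ _)]
  simp only [Measure.dirac_apply, ENNReal.toReal_inv, ENNReal.toReal_natCast]
  rw [div_eq_inv_mul]
  congr 1
  refine Finset.sum_congr rfl fun v _ => ?_
  by_cases hv : v ∈ s <;> simp [hv]

end Uniform

/-! ### Shift-invariant processes -/

section ShiftInv

variable {G : Type*} [Group G] {A : Type*} [MeasurableSpace A]

/-- Invariance under the right shift. -/
def ShiftInv (P : ProbabilityMeasure (G → A)) : Prop :=
  ∀ h : G, (P : Measure (G → A)).map (fun z g => z (g * h)) = P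

theorem ShiftInv.real_eq {P : ProbabilityMeasure (G → A)} (hP : ShiftInv P) (h : G)
    {E : Set (G → A)} (hE : MeasurableSet E) :
    (P : Measure (G → A)).real {z | (fun g => z (g * h)) ∈ E} = (P : Measure (G → A)).real E := by
  have hm : Measurable (fun (z : G → A) g => z (g * h)) :=
    measurable_pi_iff.2 fun g => measurable_pi_apply _
  have := map_measureReal_apply (μ := (P : Measure (G → A))) hm hE
  rw [hP h] at this
  exact this.symm

theorem ShiftInv.map_eval {P : ProbabilityMeasure (G → A)} (hP : ShiftInv P) (g : G) :
    (P : Measure (G → A)).map (fun z => z g) = (P : Measure (G → A)).map (fun z => z 1) := by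
  conv_rhs => rw [← hP g]
  rw [Measure.map_map (g := fun z : G → A => z 1) (measurable_pi_apply _)
    (measurable_pi_iff.2 fun g => measurable_pi_apply _)]
  congr 1
  funext z
  simp

/-- The one-coordinate marginal. -/
noncomputable def marginal (P : ProbabilityMeasure (G → A)) : ProbabilityMeasure A :=
  P.map (measurable_pi_apply (1 : G)).aemeasurable

theorem ShiftInv.real_eval {P : ProbabilityMeasure (G → A)} (hP : ShiftInv P) (g : G) {E : Set A}
    (hE : MeasurableSet E) :
    (P : Measure (G → A)).real {z | z g ∈ E} = (marginal P : Measure A).real E := by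
  change _ = ((P : Measure (G → A)).map (fun z => z 1)).real E
  rw [← hP.map_eval g]
  exact (map_measureReal_apply (measurable_pi_apply _) hE).symm

theorem ShiftInv.ae_eval {P : ProbabilityMeasure (G → A)} (hP : ShiftInv P) (g : G) {p : A → Prop}
    (h : ∀ᵐ a ∂(marginal P : Measure A), p a) : ∀ᵐ z ∂(P : Measure (G → A)), p (z g) := by
  change ∀ᵐ a ∂((P : Measure (G → A)).map (fun z => z 1)), p a at h
  rw [← hP.map_eval g] at h
  exact ae_of_ae_map (measurable_pi_apply _).aemeasurable h

theorem FinMeas.measurableSet_ne {A T : Type*} [MeasurableSpace A] [Finite T] {ψ ψ' : A → T}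
    (h : FinMeas ψ) (h' : FinMeas ψ') : MeasurableSet {a | ψ a ≠ ψ' a} :=
  (h.prodMk h') {p | p.1 ≠ p.2}

/-- Union bound for a window. -/
theorem ShiftInv.real_exists_le {P : ProbabilityMeasure (G → A)} (hP : ShiftInv P) {E : Set A}
    (hE : MeasurableSet E) (F : Finset G) :
    (P : Measure (G → A)).real {z | ∃ g ∈ F, z g ∈ E} ≤
      F.card * (marginal P : Measure A).real E := by
  have : {z : G → A | ∃ g ∈ F, z g ∈ E} = ⋃ g ∈ F, {z | z g ∈ E} := by
    ext z; simp
  rw [this]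
  refine (measureReal_biUnion_finset_le _ _).trans ?_
  rw [Finset.sum_congr rfl fun g _ => hP.real_eval g hE]
  simp

/-- Shift-invariance reduces disagreement along a window to disagreement at one coordinate, at the
price of a factor `F.card`. -/
theorem IsModel.of_marginal {V T : Type*} [Fintype V] [Finite T]
    {P : ProbabilityMeasure (G → A)} (hP : ShiftInv P) {ψ ψ' : A → T} (hψ : FinMeas ψ)
    (hψ' : FinMeas ψ') {F : Finset G} {η ε : ℝ} {σ : G → Equiv.Perm V}
    {y : V → T} (h : IsModel P ψ F η σ y)
    (hε : F.card * (marginal P : Measure A).real {a | ψ a ≠ ψ' a} ≤ ε) :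
    IsModel P ψ' F (η + ε) σ y :=
  h.of_ae_eq ((hP.real_exists_le (hψ.measurableSet_ne hψ') F).trans hε)

end ShiftInv

/-! ### Passing between metric models and finite models -/

section Transfer

variable {G : Type v} [Group G] [Countable G] {A : Type*} [MetricSpace A] [CompactSpace A]
  [MeasurableSpace A] [BorelSpace A]

/-- `lab` labels the points of `A` partially, and a label determines `ψ` up to an error `ρ` in
the point. -/
def Labels {T : Type*} (lab : A → Option T) (ψ : A → T) (ρ : ℝ) : Prop :=
  ∀ a t, lab a = some t → ∃ a', dist a a' < ρ ∧ ψ a' = t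

omit [Countable G] in
-- Weak-* neighbourhoods only control observables that are continuous almost everywhere. `ψ` need
-- not be one, so it is replaced by a partial labelling that is.
theorem exists_labels {T : Type*} [Finite T] (P : ProbabilityMeasure (G → A)) {ψ : A → T}
    (hm : FinMeas ψ) {ε ρ : ℝ} (hε : 0 < ε) (hρ : 0 < ρ) :
    ∃ lab : A → Option T, FinMeas lab ∧ Labels lab ψ ρ ∧
      (∀ᵐ a ∂(marginal P : Measure A), ∀ᶠ a' in 𝓝 a, lab a' = lab a) ∧
      (marginal P : Measure A).real {a | lab a ≠ some (ψ a)} ≤ ε := by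
  obtain ⟨lab, h1, h2, h3, h4⟩ :=
    exists_ae_locally_constant (marginal P : Measure A) hm hε hρ
  exact ⟨lab, h1, h3, h2, by simpa only [ne_comm] using h4⟩

/-- Good models are labelled by finite models. -/
theorem exists_nhds_labels {T : Type*} [Finite T] {P : ProbabilityMeasure (G → A)}
    (hP : ShiftInv P) {ψ : A → T} (hm : FinMeas ψ) (F : Finset G) {η ρ : ℝ} (hη : 0 < η)
    (hρ : 0 < ρ) :
    ∃ lab : A → Option T, FinMeas lab ∧ Labels lab ψ ρ ∧
      ∃ O ∈ 𝓝 P, ∀ (V : Type) [Fintype V] [Nonempty V] (σ : G → Equiv.Perm V) (x : V → A),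
        x ∈ goodModels O σ → IsModel P (some ∘ ψ) F η σ (lab ∘ x) := by
  obtain ⟨lab, h1, h2, h3, h4⟩ := exists_labels P hm (ε := η / 2 / (F.card + 1)) (by positivity) hρ
  obtain ⟨O, hO, hmod⟩ := exists_nhds_isModel P h1 F (fun g _ => hP.ae_eval g h3)
    (η := η / 2) (by positivity)
  refine ⟨lab, h1, h2, O, hO, fun V _ _ σ x hx => ?_⟩
  have := (hmod V σ x hx).of_marginal hP h1 (hm.comp_left some) (ε := η / 2) ?_
  · simpa using this
  · calc (F.card : ℝ) * _ ≤ (F.card + 1) * (η / 2 / (F.card + 1)) := by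
          gcongr
          · linarith
          · exact h4
      _ = η / 2 := by field_simp

omit [CompactSpace A] [MeasurableSpace A] [BorelSpace A] in
/-- Points with labels in the same small piece are close on average. -/
theorem Labels.hammingAvg_le {T T₀ : Type*} {lab : A → Option T} {ψ : A → T} {ρ D : ℝ}
    (hlab : Labels lab ψ ρ) {π : T → T₀} (hfine : ∀ a a', π (ψ a) = π (ψ a') → dist a a' < ρ)
    (hρ : 0 ≤ ρ) (hD : ∀ a a' : A, dist a a' ≤ D) {V : Type*} [Fintype V] [Nonempty V]
    (x x' : V → A) :
    hammingAvg x x' ≤ 3 * ρ + D * freq {v | lab (x v) = none ∨ lab (x' v) = none ∨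
      (lab (x v)).map π ≠ (lab (x' v)).map π} := by
  refine sum_div_card_le ?_ fun v _ => (hD _ _).trans (by linarith)
  intro v hv
  simp only [mem_ofPred_eq, not_or, ne_eq, not_not] at hv
  obtain ⟨hv1, hv2, hv3⟩ := hv
  obtain ⟨t, ht⟩ := Option.ne_none_iff_exists'.1 hv1
  obtain ⟨t', ht'⟩ := Option.ne_none_iff_exists'.1 hv2
  obtain ⟨a, ha, hat⟩ := hlab _ _ ht
  obtain ⟨a', ha', hat'⟩ := hlab _ _ ht'
  rw [ht, ht'] at hv3
  have h1 := hfine a a' (by rw [hat, hat']; exact Option.some.inj hv3)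
  have h2 := dist_triangle4 (x v) a a' (x' v)
  rw [dist_comm a' (x' v)] at h2
  linarith

/-- Finite models are mapped to good models. -/
theorem exists_realization {T₀ : Type} [Finite T₀] {P : ProbabilityMeasure (G → A)}
    (hP : ShiftInv P) {φ : A → T₀} (hφ : FinMeas φ) {δ₀ : ℝ} (hδ₀ : 0 < δ₀) :
    ∃ δ : ℝ, 0 < δ ∧ ∀ O ∈ 𝓝 P, ∃ (T : Type) (_ : Finite T) (ψ : A → T) (π : T → T₀)
      (F : Finset G) (η : ℝ) (ρ : T → A), FinMeas ψ ∧ (∀ a, π (ψ a) = φ a) ∧ 0 < η ∧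
      ∀ (V : Type) [Fintype V] [Nonempty V] (σ : G → Equiv.Perm V),
        (∀ y : V → T, IsModel P ψ F η σ y → ρ ∘ y ∈ goodModels O σ) ∧
        ∀ y y' : V → T, IsModel P ψ F η σ y → IsModel P ψ F η σ y' →
          hammingAvg (ρ ∘ y) (ρ ∘ y') < δ → freq {v | π (y v) ≠ π (y' v)} < δ₀ := by
  classical
  have hne : Nonempty A := (marginal P).nonempty
  -- All that determines `δ` is chosen before `O`, because in the definition of entropy the scale
  -- comes before the neighbourhood.
  obtain ⟨K, κ, hκ, hKc, hKs, hKm, hsep⟩ := exists_separated_compacts (marginal P : Measure A) hφ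
    (ε := δ₀ / 8) (by positivity)
  refine ⟨κ * (δ₀ / 4), by positivity, fun O hO => ?_⟩
  obtain ⟨E, κ₂, hκ₂, hE⟩ := exists_shadows_subset.{v, 0} hO
  obtain ⟨N, p, hp, hpd⟩ := exists_fine_partition A hκ₂
  have hK : MeasurableSet (⋃ t, K t) := MeasurableSet.iUnion fun t => (hKc t).measurableSet
  set kap : A → Bool := fun a => decide (a ∈ ⋃ t, K t) with hkap
  have hkm : FinMeas kap := by
    refine FinMeas.of_fibre fun b => ?_
    cases b
    · convert hK.compl using 1; ext a; simp [kap]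
    · convert hK using 1; ext a; simp [kap]
  -- `φ` keeps the symbol, `p` locates the point up to `κ₂`, and `kap` records whether it lies in
  -- the compacts, where different symbols force distance at least `κ`.
  set ψ : A → T₀ × Fin N × Bool := fun a => (φ a, p a, kap a) with hψ
  have hψm : FinMeas ψ := hφ.prodMk (hp.prodMk hkm)
  set ρ : T₀ × Fin N × Bool → A := Function.invFun ψ with hρ
  have hρψ : ∀ a, ψ (ρ (ψ a)) = ψ a := fun a => Function.invFun_eq ⟨a, rfl⟩
  refine ⟨T₀ × Fin N × Bool, inferInstance, ψ, Prod.fst, insert 1 E, min κ₂ (δ₀ / 8), ρ, hψm,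
    fun a => rfl, by positivity, fun V _ _ σ => ⟨fun y hy => ?_, fun y y' hy hy' hd => ?_⟩⟩
  · refine hE _ ?_
    let _ : MeasurableSpace V := ⊤
    refine ⟨(insert 1 E : Finset G) → T₀ × Fin N × Bool, inferInstance,
      fun w g => if h : g ∈ insert 1 E then ρ (w ⟨g, h⟩) else Classical.arbitrary A,
      readWindow ψ (insert 1 E), V, inferInstance, uniformLaw V, window σ (insert 1 E) y,
      fun v => pullbackName σ v (ρ ∘ y), hψm.readWindow _, fun _ => trivial, measurable_from_top,
      (uniformLaw_map measurable_from_top).symm, ?_, ?_, fun S => ?_⟩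
    · have : {z : G → A | ∃ g ∈ E, κ₂ ≤ dist ((fun (w : (insert 1 E : Finset G) →
          T₀ × Fin N × Bool) g => if h : g ∈ insert 1 E then ρ (w ⟨g, h⟩) else
          Classical.arbitrary A) (readWindow ψ (insert 1 E) z) g) (z g)} = ∅ := by
        refine Set.eq_empty_iff_forall_notMem.2 ?_
        rintro z ⟨g, hg, hz⟩
        simp only [Finset.mem_insert_of_mem hg, dif_pos, readWindow] at hz
        have h1 : p (ρ (ψ (z g))) = p (z g) := congrArg (fun t => t.2.1) (hρψ (z g))
        exact absurd (hpd _ _ h1) (not_lt.2 hz)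
      rw [this]
      simpa using hκ₂
    · have : {v : V | ∃ g ∈ E, pullbackName σ v (ρ ∘ y) g ≠ (fun (w : (insert 1 E : Finset G) →
          T₀ × Fin N × Bool) g => if h : g ∈ insert 1 E then ρ (w ⟨g, h⟩) else
          Classical.arbitrary A) (window σ (insert 1 E) y v) g} = ∅ := by
        refine Set.eq_empty_iff_forall_notMem.2 ?_
        rintro v ⟨g, hg, hv⟩
        simp only [Finset.mem_insert_of_mem hg, dif_pos] at hv
        exact hv rfl
      rw [this]
      simpa using hκ₂
    · rw [uniformLaw_real]
      exact (hy S).trans_le (min_le_left _ _)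
  -- For symbols flagged as outside the compacts, or not attained by `ψ`, the realization `ρ` gives
  -- no separation.
  · set B : Set (T₀ × Fin N × Bool) := {t | t.2.2 = false ∨ ∀ a, ψ a ≠ t} with hB
    have hfB : ∀ y : V → T₀ × Fin N × Bool, IsModel P ψ (insert 1 E) (min κ₂ (δ₀ / 8)) σ y →
        freq {v | y v ∈ B} < δ₀ / 4 := by
      intro y hy
      have h1 := (abs_lt.1 (hy.freq_symbol (Finset.mem_insert_self 1 E) B)).2
      have h2 : (P : Measure (G → A)).real {z | ψ (z 1) ∈ B} ≤ δ₀ / 8 := by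
        have h3 : {z : G → A | ψ (z 1) ∈ B} = {z | z 1 ∈ (⋃ t, K t)ᶜ} := by
          ext z
          simp only [hB, mem_ofPred_eq, mem_compl_iff]
          constructor
          · rintro (h | h)
            · simpa [ψ, kap] using h
            · exact absurd rfl (h (z 1))
          · intro h
            left
            simpa [ψ, kap] using h
        rw [h3, hP.real_eval 1 hK.compl]
        exact hKm
      have h4 := min_le_right κ₂ (δ₀ / 8)
      linarith
    have h5 : κ * freq {v | κ ≤ dist ((ρ ∘ y) v) ((ρ ∘ y') v)} ≤ hammingAvg (ρ ∘ y) (ρ ∘ y') :=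
      mul_freq_le_sum_div (fun v => dist_nonneg) fun v hv => hv
    have h6 : freq {v | κ ≤ dist ((ρ ∘ y) v) ((ρ ∘ y') v)} < δ₀ / 4 :=
      lt_of_mul_lt_mul_left (h5.trans_lt hd) hκ.le
    have h7 : freq {v | (y v).1 ≠ (y' v).1} ≤ freq ({v | y v ∈ B} ∪ {v | y' v ∈ B}) +
        freq {v | κ ≤ dist ((ρ ∘ y) v) ((ρ ∘ y') v)} := by
      refine freq_le_add fun v hv => ?_
      by_contra hcon
      simp only [mem_union, mem_ofPred_eq, not_or, hB, Bool.not_eq_false, not_forall, not_not,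
        not_le] at hcon
      obtain ⟨⟨⟨h1, a, ha⟩, h1', a', ha'⟩, h2⟩ := hcon
      have key : ∀ (t : T₀ × Fin N × Bool) (a : A), t.2.2 = true → ψ a = t → ρ t ∈ K t.1 := by
        rintro t a ht rfl
        have h8 := hρψ a
        have h9 : kap (ρ (ψ a)) = true := (congrArg (fun t => t.2.2) h8).trans ht
        obtain ⟨s, hs⟩ := mem_iUnion.1 (of_decide_eq_true h9)
        have h10 : φ (ρ (ψ a)) = s := hKs s hs
        have h11 : φ (ρ (ψ a)) = (ψ a).1 := congrArg Prod.fst h8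
        rw [← h11, h10]
        exact hs
      exact absurd (hsep _ _ hv _ (key _ a h1 ha) _ (key _ a' h1' ha')) (not_le.2 h2)
    have h8 := freq_union_le {v | y v ∈ B} {v | y' v ∈ B}
    have h9 := hfB y hy
    have h10 := hfB y' hy'
    linarith

end Transfer

/-! ### Approximation by sets from an algebra -/

section AlgebraApprox

variable {Ω : Type*} [MeasurableSpace Ω]

/-- Every measurable set is close to a set from `𝒜`. -/
def ApproxBy (μ : Measure Ω) (𝒜 : Set (Set Ω)) : Prop :=
  ∀ B, MeasurableSet B → ∀ ε : ℝ, 0 < ε → ∃ a ∈ 𝒜, μ.real (symmDiff B a) ≤ ε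

theorem approxBy_of_generateFrom (μ : Measure Ω) [IsFiniteMeasure μ] {𝒜 : Set (Set Ω)}
    (h𝒜 : IsSetAlgebra 𝒜) (hgen : ‹MeasurableSpace Ω› = MeasurableSpace.generateFrom 𝒜) :
    ApproxBy μ 𝒜 := by
  intro B hB ε hε
  obtain ⟨a, ha, h⟩ := (Measure.MeasureDense.of_generateFrom_isSetAlgebra_finite (μ := μ) h𝒜
    hgen).approx B hB (measure_ne_top _ _) ε hε
  exact ⟨a, ha, ENNReal.toReal_le_of_le_ofReal hε.le h.le⟩

/-- The approximating sets need not partition the space, but off a small set exactly the right one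
contains the point, and `decodeFamily` then recovers the value of `ψ`. -/
theorem ApproxBy.exists_family {μ : Measure Ω} [IsFiniteMeasure μ] {𝒜 : Set (Set Ω)}
    (h : ApproxBy μ 𝒜) {T : Type*} [Finite T] {ψ : Ω → T} (hψ : FinMeas ψ) {ε : ℝ} (hε : 0 < ε) :
    ∃ a : T → Set Ω, (∀ t, a t ∈ 𝒜) ∧ μ.real {ω | ¬ ∀ t, ω ∈ a t ↔ t = ψ ω} ≤ ε := by
  have := Fintype.ofFinite T
  have h1 : ∀ t : T, ∃ a ∈ 𝒜, μ.real (symmDiff (ψ ⁻¹' {t}) a) ≤ ε / (Fintype.card T + 1) :=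
    fun t => h _ (hψ _) _ (by positivity)
  choose a ha hm using h1
  refine ⟨a, ha, ?_⟩
  calc μ.real {ω | ¬ ∀ t, ω ∈ a t ↔ t = ψ ω} ≤ μ.real (⋃ t, symmDiff (ψ ⁻¹' {t}) (a t)) := by
        refine measureReal_mono fun ω hω => ?_
        simp only [mem_ofPred_eq, not_forall] at hω
        obtain ⟨t, ht⟩ := hω
        refine mem_iUnion.2 ⟨t, ?_⟩
        rw [Set.mem_symmDiff]
        simp only [mem_preimage, mem_singleton_iff]
        rw [eq_comm] at ht
        tauto
    _ ≤ ∑ t, μ.real (symmDiff (ψ ⁻¹' {t}) (a t)) := measureReal_iUnion_fintype_le _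
    _ ≤ ∑ _t : T, ε / (Fintype.card T + 1) := Finset.sum_le_sum fun t _ => hm t
    _ = Fintype.card T * (ε / (Fintype.card T + 1)) := by simp
    _ ≤ ε := by
      rw [mul_div_assoc', div_le_iff₀ (by positivity)]
      nlinarith

open Classical in
/-- Decoding a point of `T` from the family of answers to the questions "is it `t`?". -/
noncomputable def decodeFamily {T : Type*} [Nonempty T] (p : T → Prop) : T :=
  if h : ∃ t, ∀ t', p t' ↔ t' = t then h.choose else Classical.arbitrary T

theorem decodeFamily_eq {T : Type*} [Nonempty T] {p : T → Prop} {t : T}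
    (h : ∀ t', p t' ↔ t' = t) : decodeFamily p = t := by
  have hex : ∃ t, ∀ t', p t' ↔ t' = t := ⟨t, h⟩
  rw [decodeFamily, dif_pos hex]
  exact ((hex.choose_spec t).1 ((h t).2 rfl)).symm

theorem finMeas_mem {A : Type*} [MeasurableSpace A] {E : Set A} (hE : MeasurableSet E) :
    FinMeas (fun a => a ∈ E) := by
  refine FinMeas.of_fibre fun p => ?_
  by_cases hp : p
  · convert hE using 1; ext a; simp [hp]
  · convert hE.compl using 1; ext a; simp [hp]

/-- Finite-valued maps on a product are approximated by maps which factor through finite-valued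
maps of the coordinates. -/
theorem exists_prod_approx {A B : Type*} [MeasurableSpace A] [MeasurableSpace B] (e : Ω ≃ᵐ A × B)
    (μ : Measure Ω) [IsFiniteMeasure μ] {T : Type} [Finite T] [Nonempty T] {ψ : Ω → T}
    (hψ : FinMeas ψ) {ε : ℝ} (hε : 0 < ε) :
    ∃ (T₁ T₂ : Type) (_ : Finite T₁) (_ : Finite T₂) (ψ₁ : A → T₁) (ψ₂ : B → T₂)
      (θ : T₁ × T₂ → T), FinMeas ψ₁ ∧ FinMeas ψ₂ ∧
        μ.real {ω | θ (ψ₁ (e ω).1, ψ₂ (e ω).2) ≠ ψ ω} ≤ ε := by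
  -- Sets decided by finite observables of the two coordinates form an algebra, since two
  -- observables of a coordinate can be joined into one.
  set 𝒜 : Set (Set Ω) := {s | ∃ (T₁ T₂ : Type) (_ : Finite T₁) (_ : Finite T₂) (ψ₁ : A → T₁)
    (ψ₂ : B → T₂) (S : Set (T₁ × T₂)), FinMeas ψ₁ ∧ FinMeas ψ₂ ∧
      s = {ω | (ψ₁ (e ω).1, ψ₂ (e ω).2) ∈ S}} with h𝒜
  have halg : IsSetAlgebra 𝒜 := by
    refine ⟨⟨Unit, Unit, inferInstance, inferInstance, fun _ => (), fun _ => (), ∅,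
      fun _ => MeasurableSet.const _, fun _ => MeasurableSet.const _, by ext; simp⟩, ?_, ?_⟩
    · rintro _ ⟨T₁, T₂, h1, h2, ψ₁, ψ₂, S, hψ₁, hψ₂, rfl⟩
      exact ⟨T₁, T₂, h1, h2, ψ₁, ψ₂, Sᶜ, hψ₁, hψ₂, rfl⟩
    · rintro _ _ ⟨T₁, T₂, h1, h2, ψ₁, ψ₂, S, hψ₁, hψ₂, rfl⟩
        ⟨T₁', T₂', h1', h2', ψ₁', ψ₂', S', hψ₁', hψ₂', rfl⟩
      exact ⟨T₁ × T₁', T₂ × T₂', inferInstance, inferInstance, fun a => (ψ₁ a, ψ₁' a),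
        fun b => (ψ₂ b, ψ₂' b), {p | (p.1.1, p.2.1) ∈ S ∨ (p.1.2, p.2.2) ∈ S'},
        hψ₁.prodMk hψ₁', hψ₂.prodMk hψ₂', rfl⟩
  have hmem : ∀ s ∈ 𝒜, MeasurableSet s := by
    rintro _ ⟨T₁, T₂, h1, h2, ψ₁, ψ₂, S, hψ₁, hψ₂, rfl⟩
    exact ((hψ₁.comp_measurable (measurable_fst.comp e.measurable)).prodMk
      (hψ₂.comp_measurable (measurable_snd.comp e.measurable))) S
  have hgen : ‹MeasurableSpace Ω› = MeasurableSpace.generateFrom 𝒜 := by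
    refine le_antisymm ?_ (MeasurableSpace.generateFrom_le hmem)
    have h1 : @Measurable _ _ (MeasurableSpace.generateFrom 𝒜) _ (fun ω => e ω) := by
      refine @Measurable.prod _ _ _ (MeasurableSpace.generateFrom 𝒜) _ _ _ ?_ ?_
      · intro E hE
        refine MeasurableSpace.measurableSet_generateFrom ⟨Prop, Unit, inferInstance,
          inferInstance, fun a => a ∈ E, fun _ => (), {p | p.1}, finMeas_mem hE,
          fun _ => MeasurableSet.const _, ?_⟩
        ext; simp
      · intro E hE
        refine MeasurableSpace.measurableSet_generateFrom ⟨Unit, Prop, inferInstance,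
          inferInstance, fun _ => (), fun a => a ∈ E, {p | p.2},
          fun _ => MeasurableSet.const _, finMeas_mem hE, ?_⟩
        ext; simp
    intro s hs
    have h2 := h1 (e.symm.measurable hs)
    have h3 : (fun ω => e ω) ⁻¹' (e.symm ⁻¹' s) = s := by ext; simp
    rwa [h3] at h2
  obtain ⟨a, ha, hm⟩ := (approxBy_of_generateFrom μ halg hgen).exists_family hψ hε
  choose T₁ T₂ h1 h2 ψ₁ ψ₂ S hψ₁ hψ₂ heq using ha
  refine ⟨∀ t, T₁ t, ∀ t, T₂ t, inferInstance, inferInstance, fun x t => ψ₁ t x,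
    fun x t => ψ₂ t x, fun p => decodeFamily fun t => (p.1 t, p.2 t) ∈ S t, FinMeas.pi hψ₁,
    FinMeas.pi hψ₂, (measureReal_mono ?_).trans hm⟩
  intro ω hω hcon
  refine hω (decodeFamily_eq fun t => ?_)
  rw [← hcon t, heq t]
  rfl

/-- Finite-valued maps on a power are approximated by maps which factor through a finite-valued
map of the coordinates. -/
theorem exists_pi_approx {ι A : Type*} [Finite ι] [MeasurableSpace A] (e : Ω ≃ᵐ (ι → A))
    (μ : Measure Ω) [IsFiniteMeasure μ] {T : Type} [Finite T] [Nonempty T] {ψ : Ω → T}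
    (hψ : FinMeas ψ) {ε : ℝ} (hε : 0 < ε) :
    ∃ (T₁ : Type) (_ : Finite T₁) (ψ₁ : A → T₁) (θ : (ι → T₁) → T), FinMeas ψ₁ ∧
        μ.real {ω | θ (fun i => ψ₁ (e ω i)) ≠ ψ ω} ≤ ε := by
  set 𝒜 : Set (Set Ω) := {s | ∃ (T₁ : Type) (_ : Finite T₁) (ψ₁ : A → T₁)
    (S : Set (ι → T₁)), FinMeas ψ₁ ∧ s = {ω | (fun i => ψ₁ (e ω i)) ∈ S}} with h𝒜
  have halg : IsSetAlgebra 𝒜 := by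
    refine ⟨⟨Unit, inferInstance, fun _ => (), ∅, fun _ => MeasurableSet.const _,
      by ext; simp⟩, ?_, ?_⟩
    · rintro _ ⟨T₁, h1, ψ₁, S, hψ₁, rfl⟩
      exact ⟨T₁, h1, ψ₁, Sᶜ, hψ₁, rfl⟩
    · rintro _ _ ⟨T₁, h1, ψ₁, S, hψ₁, rfl⟩ ⟨T₁', h1', ψ₁', S', hψ₁', rfl⟩
      exact ⟨T₁ × T₁', inferInstance, fun a => (ψ₁ a, ψ₁' a),
        {p | (fun i => (p i).1) ∈ S ∨ (fun i => (p i).2) ∈ S'}, hψ₁.prodMk hψ₁', rfl⟩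
  have hmem : ∀ s ∈ 𝒜, MeasurableSet s := by
    rintro _ ⟨T₁, h1, ψ₁, S, hψ₁, rfl⟩
    exact FinMeas.pi (ψ := fun i ω => ψ₁ (e ω i)) (fun i => hψ₁.comp_measurable
      ((measurable_pi_apply i).comp e.measurable)) S
  have hgen : ‹MeasurableSpace Ω› = MeasurableSpace.generateFrom 𝒜 := by
    refine le_antisymm ?_ (MeasurableSpace.generateFrom_le hmem)
    have h1 : @Measurable _ _ (MeasurableSpace.generateFrom 𝒜) _ (fun ω => e ω) := by
      refine @measurable_pi_lambda _ _ _ (MeasurableSpace.generateFrom 𝒜) _ _ fun i => ?_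
      intro E hE
      refine MeasurableSpace.measurableSet_generateFrom ⟨Prop, inferInstance,
        fun a => a ∈ E, {p | p i}, finMeas_mem hE, ?_⟩
      ext; simp
    intro s hs
    have h2 := h1 (e.symm.measurable hs)
    have h3 : (fun ω => e ω) ⁻¹' (e.symm ⁻¹' s) = s := by ext; simp
    rwa [h3] at h2
  obtain ⟨a, ha, hm⟩ := (approxBy_of_generateFrom μ halg hgen).exists_family hψ hε
  choose T₁ h1 ψ₁ S hψ₁ heq using ha
  refine ⟨∀ t, T₁ t, inferInstance, fun x t => ψ₁ t x,
    fun p => decodeFamily fun t => (fun i => p i t) ∈ S t, FinMeas.pi hψ₁,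
    (measureReal_mono ?_).trans hm⟩
  intro ω hω hcon
  refine hω (decodeFamily_eq fun t => ?_)
  rw [← hcon t, heq t]
  rfl

end AlgebraApprox

/-! ### Approximation by windows of a generator -/

section Generator

variable {G : Type v} [Group G]

/-- Finite-valued maps are approximated by functions of windows of a generator. -/
theorem GSystem.exists_window_approx (X : GSystem.{u, v} G) {r : ℕ} {φ : X.carrier → Fin r}
    (hφ : Measurable φ)
    (hgen : ∀ B : Set X.carrier, MeasurableSet B → ∃ C : Set X.carrier,
      MeasurableSet[⨆ g : G, MeasurableSpace.comap (fun x => φ (g • x)) ⊤] C ∧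
        B =ᵐ[(X.law : Measure X.carrier)] C)
    {T : Type*} [Finite T] [Nonempty T] {ψ : X.carrier → T} (hψ : FinMeas ψ) {ε : ℝ} (hε : 0 < ε) :
    ∃ (D : Finset G) (θ : (D → Fin r) → T),
      (X.law : Measure X.carrier).real {x | θ (fun g => φ ((g : G) • x)) ≠ ψ x} ≤ ε := by
  classical
  set 𝒜 : Set (Set X.carrier) := {s | ∃ (D : Finset G) (S : Set (D → Fin r)),
    s = {x | (fun g : D => φ ((g : G) • x)) ∈ S}} with h𝒜
  have halg : IsSetAlgebra 𝒜 := by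
    refine ⟨⟨∅, ∅, by ext; simp⟩, ?_, ?_⟩
    · rintro _ ⟨D, S, rfl⟩
      exact ⟨D, Sᶜ, rfl⟩
    · rintro _ _ ⟨D, S, rfl⟩ ⟨D', S', rfl⟩
      exact ⟨D ∪ D', {p | (fun g : D => p ⟨g, Finset.mem_union_left _ g.2⟩) ∈ S ∨
        (fun g : D' => p ⟨g, Finset.mem_union_right _ g.2⟩) ∈ S'}, rfl⟩
  have hmem : ∀ s ∈ 𝒜, MeasurableSet s := by
    rintro _ ⟨D, S, rfl⟩
    exact FinMeas.pi (ψ := fun (g : D) x => φ ((g : G) • x))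
      (fun g => hφ.finMeas.comp_measurable (X.preserving g).measurable) S
  have hle : MeasurableSpace.generateFrom 𝒜 ≤ X.measurableSpace :=
    MeasurableSpace.generateFrom_le hmem
  have hle' : (⨆ g : G, MeasurableSpace.comap (fun x => φ (g • x)) ⊤) ≤
      MeasurableSpace.generateFrom 𝒜 := by
    refine iSup_le fun g => ?_
    rintro _ ⟨S, -, rfl⟩
    refine MeasurableSpace.measurableSet_generateFrom
      ⟨{g}, {p | p ⟨g, Finset.mem_singleton_self g⟩ ∈ S}, rfl⟩
  -- The window sets may generate a smaller σ-algebra than that of `X`. The approximation is carried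
  -- out for the trimmed measure, after `B` is replaced by the almost equal set `C`.
  have happ : ApproxBy (X.law : Measure X.carrier) 𝒜 := by
    intro B hB ε hε
    obtain ⟨C, hC, hBC⟩ := hgen B hB
    have hC' := hle' _ hC
    obtain ⟨a, ha, hm⟩ := @approxBy_of_generateFrom _ (MeasurableSpace.generateFrom 𝒜)
      ((X.law : Measure X.carrier).trim hle) (isFiniteMeasure_trim hle) 𝒜 halg rfl C hC' ε hε
    refine ⟨a, ha, ?_⟩
    have ha' : MeasurableSet[MeasurableSpace.generateFrom 𝒜] a :=
      MeasurableSpace.measurableSet_generateFrom ha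
    rw [Measure.real, trim_measurableSet_eq hle (hC'.symmDiff ha')] at hm
    rw [measureReal_congr (hBC.symmDiff (ae_eq_refl a))]
    exact hm
  obtain ⟨a, ha, hm⟩ := happ.exists_family hψ hε
  have := Fintype.ofFinite T
  choose D S heq using ha
  refine ⟨Finset.univ.biUnion D, fun p => decodeFamily fun t => (fun g : D t => p ⟨g,
    Finset.mem_biUnion.2 ⟨t, Finset.mem_univ t, g.2⟩⟩) ∈ S t, (measureReal_mono ?_).trans hm⟩
  intro ω hω hcon
  refine hω (decodeFamily_eq fun t => ?_)
  rw [← hcon t, heq t]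
  rfl

end Generator

/-! ### Correlations over vertices -/

section Correlation

variable {V : Type*} [Fintype V]

/-- The normalized inner product of functions on vertices. -/
noncomputable def vip (f g : V → ℝ) : ℝ := (∑ v, f v * g v) / Fintype.card V

theorem vip_comm (f g : V → ℝ) : vip f g = vip g f := by
  simp [vip, mul_comm]

theorem abs_vip_le_one [Nonempty V] {f g : V → ℝ} (hf : ∀ v, |f v| ≤ 1) (hg : ∀ v, |g v| ≤ 1) :
    |vip f g| ≤ 1 := by
  unfold vip
  rw [abs_div, abs_of_nonneg (a := (Fintype.card V : ℝ)) (by positivity), div_le_one (by positivity)]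
  refine (Finset.abs_sum_le_sum_abs _ _).trans ?_
  calc ∑ v, |f v * g v| ≤ ∑ _v : V, (1 : ℝ) := Finset.sum_le_sum fun v _ => by
        rw [abs_mul]; exact mul_le_one₀ (hf v) (abs_nonneg _) (hg v)
    _ = _ := by simp

/-- The Cauchy–Schwarz inequality. -/
theorem vip_sq_le (f g : V → ℝ) : vip f g ^ 2 ≤ vip f f * vip g g := by
  unfold vip
  rw [div_pow, div_mul_div_comm, ← sq (Fintype.card V : ℝ)]
  gcongr
  have := Finset.sum_mul_sq_le_sq_mul_sq Finset.univ f g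
  simpa [sq] using this

theorem vip_sum_left {Ω : Type*} (s : Finset Ω) (c : Ω → ℝ) (f : Ω → V → ℝ) (g : V → ℝ) :
    vip (fun v => ∑ x ∈ s, c x * f x v) g = ∑ x ∈ s, c x * vip (f x) g := by
  unfold vip
  simp only [Finset.sum_mul, mul_div_assoc', Finset.mul_sum]
  rw [← Finset.sum_div, Finset.sum_comm]
  congr 1
  exact Finset.sum_congr rfl fun x _ => Finset.sum_congr rfl fun v _ => by ring

theorem vip_sum_right {Ω : Type*} (s : Finset Ω) (c : Ω → ℝ) (f : Ω → V → ℝ) (g : V → ℝ) :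
    vip g (fun v => ∑ x ∈ s, c x * f x v) = ∑ x ∈ s, c x * vip g (f x) := by
  rw [vip_comm, vip_sum_left]
  simp only [vip_comm g]

/-- If independent samples of a random function are typically uncorrelated, then it is typically
uncorrelated with any fixed function. -/
theorem sum_vip_sq_le [Nonempty V] {Ω : Type*} [Fintype Ω] {c : Ω → ℝ} (hc : ∀ x, 0 ≤ c x)
    {f : Ω → V → ℝ} (hf : ∀ x v, |f x v| ≤ 1) {g : V → ℝ} (hg : ∀ v, |g v| ≤ 1) :
    (∑ x, c x * vip (f x) g ^ 2) ^ 2 ≤ ∑ x, ∑ x', c x * c x' * |vip (f x) (f x')| := by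
  -- Weighting each `f x` by its own correlation with `g` turns the left side into the square of
  -- `vip U g`. Cauchy–Schwarz then eliminates `g`, and only correlations between samples remain.
  set U : V → ℝ := fun v => ∑ x, (c x * vip (f x) g) * f x v with hU
  have h1 : ∑ x, c x * vip (f x) g ^ 2 = vip U g := by
    rw [hU, vip_sum_left]
    exact Finset.sum_congr rfl fun x _ => by ring
  have h2 : vip g g ≤ 1 := (le_abs_self _).trans (abs_vip_le_one hg hg)
  have h3 : 0 ≤ vip U U := by
    unfold vip
    exact div_nonneg (Finset.sum_nonneg fun v _ => mul_self_nonneg _) (by positivity)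
  rw [h1]
  calc vip U g ^ 2 ≤ vip U U * vip g g := vip_sq_le _ _
    _ ≤ vip U U := by nlinarith
    _ = ∑ x, ∑ x', (c x * vip (f x) g) * ((c x' * vip (f x') g) * vip (f x) (f x')) := by
      rw [hU, vip_sum_left]
      refine Finset.sum_congr rfl fun x _ => ?_
      rw [vip_sum_right, Finset.mul_sum]
    _ ≤ _ := by
      refine Finset.sum_le_sum fun x _ => Finset.sum_le_sum fun x' _ => ?_
      have e1 := abs_vip_le_one (hf x) hg
      have e2 := abs_vip_le_one (hf x') hg
      calc _ ≤ |(c x * vip (f x) g) * ((c x' * vip (f x') g) * vip (f x) (f x'))| := le_abs_self _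
        _ = c x * c x' * (|vip (f x) g| * |vip (f x') g|) * |vip (f x) (f x')| := by
          simp only [abs_mul, abs_of_nonneg (hc x), abs_of_nonneg (hc x')]; ring
        _ ≤ c x * c x' * 1 * |vip (f x) (f x')| := by
          have := hc x
          have := hc x'
          gcongr
          exact mul_le_one₀ e1 (abs_nonneg _) e2
        _ = _ := by ring

/-- The indicator function. -/
noncomputable def ind (s : Set V) (v : V) : ℝ := s.indicator 1 v

omit [Fintype V] in
theorem abs_ind_le_one (s : Set V) (v : V) : |ind s v| ≤ 1 := by
  by_cases h : v ∈ s <;> simp [ind, h]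

omit [Fintype V] in
theorem abs_ind_sub_le_one (s : Set V) {c : ℝ} (h0 : 0 ≤ c) (h1 : c ≤ 1) (v : V) :
    |ind s v - c| ≤ 1 := by
  rw [abs_le]
  by_cases h : v ∈ s <;> simp [ind, h] <;> constructor <;> linarith

theorem vip_ind_ind (s t : Set V) : vip (ind s) (ind t) = freq (s ∩ t) := by
  classical
  unfold vip
  rw [freq_eq_sum]
  congr 1
  refine Finset.sum_congr rfl fun v _ => ?_
  by_cases h : v ∈ s <;> by_cases h' : v ∈ t <;> simp [ind, h, h']

theorem vip_sub_const_ind (s t : Set V) (c : ℝ) :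
    vip (fun v => ind s v - c) (ind t) = freq (s ∩ t) - c * freq t := by
  classical
  rw [← vip_ind_ind]
  unfold vip
  rw [freq_eq_sum, mul_div_assoc', ← sub_div, Finset.mul_sum, ← Finset.sum_sub_distrib]
  congr 1
  refine Finset.sum_congr rfl fun v _ => ?_
  by_cases h' : v ∈ t <;> simp [ind, h']

theorem vip_sub_const_sub_const [Nonempty V] (s t : Set V) (c d : ℝ) :
    vip (fun v => ind s v - c) (fun v => ind t v - d) =
      freq (s ∩ t) - c * freq t - d * freq s + c * d := by
  classical
  have h0 : (Fintype.card V : ℝ) ≠ 0 := by positivity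
  have h1 := vip_sub_const_ind s t c
  have h2 : vip (fun v => ind s v - c) (fun v => ind t v - d) =
      vip (fun v => ind s v - c) (ind t) - d * (freq s - c) := by
    unfold vip
    rw [freq_eq_sum]
    field_simp
    have : ∑ v : V, (if v ∈ s then (1 : ℝ) else 0) - c * Fintype.card V = ∑ v, (ind s v - c) := by
      rw [Finset.sum_sub_distrib]
      simp [ind, Set.indicator_apply, mul_comm]
    rw [this, Finset.mul_sum, ← Finset.sum_sub_distrib]
    refine Finset.sum_congr rfl fun v _ => by ring
  rw [h2, h1]
  ring

end Correlation

/-! ### Joint models -/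

section Joint

variable {G : Type*} {A B C : Type*} [MeasurableSpace A] [MeasurableSpace B] [MeasurableSpace C]

theorem real_nonneg_le_one {Ω : Type*} [MeasurableSpace Ω] (P : ProbabilityMeasure Ω)
    (s : Set Ω) : 0 ≤ (P : Measure Ω).real s ∧ (P : Measure Ω).real s ≤ 1 :=
  ⟨measureReal_nonneg, measureReal_le_one⟩

/-- It suffices to control the frequency of each pattern. -/
theorem isModel_of_patterns {V T : Type*} [Fintype V] [Nonempty V] [Finite T]
    {P : ProbabilityMeasure (G → A)} {ψ : A → T} (hψ : FinMeas ψ) {F : Finset G} {η τ : ℝ}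
    {σ : G → Equiv.Perm V} {y : V → T}
    (h : ∀ p : F → T, |freq {v | window σ F y v = p} -
      (P : Measure (G → A)).real {z | readWindow ψ F z = p}| ≤ τ)
    (hτ : Nat.card (F → T) * τ < η) : IsModel P ψ F η σ y := by
  classical
  intro S
  have := Fintype.ofFinite T
  let _ : MeasurableSpace V := ⊤
  have hτ0 : 0 ≤ τ := (abs_nonneg _).trans (h fun _ => y (Classical.arbitrary V))
  have h1 := real_preimage_eq_sum (uniformLaw V : Measure V) (a := window σ F y)
    (fun _ => trivial) S.toFinset
  have h2 := real_preimage_eq_sum (P : Measure (G → A)) (hψ.readWindow F) S.toFinset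
  rw [coe_toFinset] at h1 h2
  rw [uniformLaw_real] at h1
  change freq {v | window σ F y v ∈ S} = _ at h1
  change (P : Measure (G → A)).real {z | readWindow ψ F z ∈ S} = _ at h2
  rw [h1, h2, ← Finset.sum_sub_distrib]
  refine lt_of_le_of_lt ((Finset.abs_sum_le_sum_abs _ _).trans ?_) hτ
  calc _ ≤ ∑ _p ∈ S.toFinset, τ := Finset.sum_le_sum fun p _ => by
        rw [uniformLaw_real]; exact h p
    _ ≤ ∑ _p : F → T, τ := Finset.sum_le_univ_sum_of_nonneg fun _ => hτ0
    _ = _ := by simp [Nat.card_eq_fintype_card]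

/-- `R` is the law of the pair of independent processes with laws `P` and `Q`. -/
def IsProdLaw (e : C → A × B) (R : ProbabilityMeasure (G → C)) (P : ProbabilityMeasure (G → A))
    (Q : ProbabilityMeasure (G → B)) : Prop :=
  (R : Measure (G → C)).map (fun z g => e (z g)) =
    ((P : Measure (G → A)).prod (Q : Measure (G → B))).map zipFun

theorem isProdLaw_squareLaw (P : ProbabilityMeasure (G → A)) :
    IsProdLaw (G := G) id (squareLaw P) P P := by
  unfold IsProdLaw
  change Measure.map id _ = _
  rw [Measure.map_id]
  rfl

theorem IsProdLaw.real_eq {e : C → A × B} {R : ProbabilityMeasure (G → C)}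
    {P : ProbabilityMeasure (G → A)} {Q : ProbabilityMeasure (G → B)} (h : IsProdLaw e R P Q)
    (he : Measurable e) {E : Set (G → A)} {E' : Set (G → B)} (hE : MeasurableSet E)
    (hE' : MeasurableSet E') :
    (R : Measure (G → C)).real {z | (fun g => (e (z g)).1) ∈ E ∧ (fun g => (e (z g)).2) ∈ E'} =
      (P : Measure (G → A)).real E * (Q : Measure (G → B)).real E' := by
  have hm : MeasurableSet {u : G → A × B | (fun g => (u g).1) ∈ E ∧ (fun g => (u g).2) ∈ E'} :=
    ((measurable_pi_iff.2 fun g => measurable_fst.comp (measurable_pi_apply g)) hE).inter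
      ((measurable_pi_iff.2 fun g => measurable_snd.comp (measurable_pi_apply g)) hE')
  have hme : Measurable (fun (z : G → C) g => e (z g)) :=
    measurable_pi_iff.2 fun g => he.comp (measurable_pi_apply g)
  have h1 := map_measureReal_apply (μ := (R : Measure (G → C))) hme hm
  rw [h, map_measureReal_apply measurable_zipFun hm] at h1
  rw [← measureReal_prod_prod, eq_comm]
  exact h1

/-- The pair of finite-valued observables. -/
def pairMap {T T' : Type*} (e : C → A × B) (ψ : A → T) (ψ' : B → T') (c : C) : T × T' :=
  (ψ (e c).1, ψ' (e c).2)

theorem FinMeas.pairMap {T T' : Type*} [Finite T] [Finite T'] {e : C → A × B} (he : Measurable e)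
    {ψ : A → T} {ψ' : B → T'} (h : FinMeas ψ) (h' : FinMeas ψ') : FinMeas (pairMap e ψ ψ') :=
  (h.comp_measurable (measurable_fst.comp he)).prodMk
    (h'.comp_measurable (measurable_snd.comp he))

theorem IsProdLaw.real_pattern {T T' : Type*} [Finite T] [Finite T'] {e : C → A × B}
    {R : ProbabilityMeasure (G → C)}
    {P : ProbabilityMeasure (G → A)} {Q : ProbabilityMeasure (G → B)} (h : IsProdLaw e R P Q)
    (he : Measurable e) {ψ : A → T} {ψ' : B → T'} (hψ : FinMeas ψ) (hψ' : FinMeas ψ')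
    {F : Finset G} (p : F → T × T') :
    (R : Measure (G → C)).real {z | readWindow (pairMap e ψ ψ') F z = p} =
      (P : Measure (G → A)).real {z | readWindow ψ F z = fun g => (p g).1} *
      (Q : Measure (G → B)).real {z | readWindow ψ' F z = fun g => (p g).2} := by
  refine Eq.trans ?_ (h.real_eq he (hψ.readWindow F {q | q = fun g => (p g).1})
    (hψ'.readWindow F {q | q = fun g => (p g).2}))
  congr 1
  ext z
  simp only [mem_ofPred_eq, readWindow, pairMap, funext_iff, Prod.ext_iff]
  exact forall_and

variable {T T' : Type*} [Finite T] [Finite T']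

/-- The centred indicator of the occurrence of a pattern. -/
noncomputable def centred {V : Type*} (P : ProbabilityMeasure (G → A)) (ψ : A → T) (F : Finset G)
    (σ : G → Equiv.Perm V) (p : F → T) (x : V → T) (v : V) : ℝ :=
  ind {v | window σ F x v = p} v - (P : Measure (G → A)).real {z | readWindow ψ F z = p}

omit [Finite T] in
theorem abs_centred_le_one {V : Type*} (P : ProbabilityMeasure (G → A)) (ψ : A → T)
    (F : Finset G) (σ : G → Equiv.Perm V) (p : F → T) (x : V → T) (v : V) :
    |centred P ψ F σ p x v| ≤ 1 :=
  abs_ind_sub_le_one _ (real_nonneg_le_one P _).1 (real_nonneg_le_one P _).2 v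

/-- In a model of the product process, patterns in the two coordinates are uncorrelated. -/
theorem IsModel.abs_vip_le {V : Type*} [Fintype V] [Nonempty V] {e : C → A × B}
    {R : ProbabilityMeasure (G → C)}
    {P : ProbabilityMeasure (G → A)} {Q : ProbabilityMeasure (G → B)} (h : IsProdLaw e R P Q)
    (he : Measurable e) {ψ : A → T} {ψ' : B → T'} (hψ : FinMeas ψ) (hψ' : FinMeas ψ')
    {F : Finset G} {η : ℝ} {σ : G → Equiv.Perm V} {x : V → T} {y : V → T'}
    (hm : IsModel R (pairMap e ψ ψ') F η σ (fun v => (x v, y v))) (p : F → T) (q : F → T') :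
    |vip (centred P ψ F σ p x) (centred Q ψ' F σ q y)| ≤ 3 * η := by
  have e1 := hm {w | w = fun g => (p g, q g)}
  have e2 := hm {w | (fun g => (w g).1) = p}
  have e3 := hm {w | (fun g => (w g).2) = q}
  have r1 := h.real_pattern he hψ hψ' (fun g => (p g, q g))
  have r2 : (R : Measure (G → C)).real
      {z | readWindow (pairMap e ψ ψ') F z ∈ {w | (fun g => (w g).1) = p}} =
      (P : Measure (G → A)).real {z | readWindow ψ F z = p} := by
    have := h.real_eq he (hψ.readWindow F {q | q = p}) MeasurableSet.univ
    rw [probReal_univ, mul_one] at this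
    refine Eq.trans ?_ this
    congr 1
    ext z
    simp only [readWindow, pairMap, mem_ofPred_eq, mem_preimage, mem_univ, and_true]
    rfl
  have r3 : (R : Measure (G → C)).real
      {z | readWindow (pairMap e ψ ψ') F z ∈ {w | (fun g => (w g).2) = q}} =
      (Q : Measure (G → B)).real {z | readWindow ψ' F z = q} := by
    have := h.real_eq he MeasurableSet.univ (hψ'.readWindow F {q' | q' = q})
    rw [probReal_univ, one_mul] at this
    refine Eq.trans ?_ this
    congr 1
    ext z
    simp only [readWindow, pairMap, mem_ofPred_eq, mem_preimage, mem_univ, true_and]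
    rfl
  have f1 : {v | window σ F (fun v => (x v, y v)) v ∈ {w | w = fun g => (p g, q g)}} =
      {v | window σ F x v = p} ∩ {v | window σ F y v = q} := by
    ext v
    simp only [mem_ofPred_eq, mem_inter_iff, window, funext_iff, Prod.ext_iff]
    exact forall_and
  rw [f1, show {z | readWindow (pairMap e ψ ψ') F z ∈ {w | w = fun g => (p g, q g)}} =
    {z | readWindow (pairMap e ψ ψ') F z = fun g => (p g, q g)} from rfl, r1] at e1
  rw [r2] at e2
  rw [r3] at e3
  change |freq {v | window σ F x v = p} - _| < η at e2
  change |freq {v | window σ F y v = q} - _| < η at e3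
  have := vip_sub_const_sub_const {v | window σ F x v = p} {v | window σ F y v = q}
    ((P : Measure (G → A)).real {z | readWindow ψ F z = p})
    ((Q : Measure (G → B)).real {z | readWindow ψ' F z = q})
  unfold centred
  rw [this]
  obtain ⟨c0, c1⟩ := real_nonneg_le_one P {z | readWindow ψ F z = p}
  obtain ⟨d0, d1⟩ := real_nonneg_le_one Q {z | readWindow ψ' F z = q}
  set c := (P : Measure (G → A)).real {z | readWindow ψ F z = p}
  set d := (Q : Measure (G → B)).real {z | readWindow ψ' F z = q}
  set s := freq {v | window σ F x v = p}
  set t := freq {v | window σ F y v = q}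
  set r := freq ({v | window σ F x v = p} ∩ {v | window σ F y v = q})
  have hc : |c * (t - d)| ≤ η := by
    rw [abs_mul, abs_of_nonneg c0]
    nlinarith [abs_nonneg (t - d)]
  have hd : |d * (s - c)| ≤ η := by
    rw [abs_mul, abs_of_nonneg d0]
    nlinarith [abs_nonneg (s - c)]
  have e1' : |r - c * d| < η := e1
  -- The covariance splits into the deviation of the joint frequency and those of the two marginals,
  -- each at most `η`.
  have : r - c * t - d * s + c * d = (r - c * d) - c * (t - d) - d * (s - c) := by ring
  rw [this]
  have h1 := abs_sub (r - c * d - c * (t - d)) (d * (s - c))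
  have h2 := abs_sub (r - c * d) (c * (t - d))
  linarith

/-- If `x` is a pattern-uncorrelated with the patterns of a model `y`, then the pair is a model
of the product process. -/
theorem isModel_pair_of_vip {V : Type*} [Fintype V] [Nonempty V] {e : C → A × B}
    {R : ProbabilityMeasure (G → C)}
    {P : ProbabilityMeasure (G → A)} {Q : ProbabilityMeasure (G → B)} (h : IsProdLaw e R P Q)
    (he : Measurable e) {ψ : A → T} {ψ' : B → T'} (hψ : FinMeas ψ) (hψ' : FinMeas ψ')
    {F : Finset G} {η τ : ℝ} {σ : G → Equiv.Perm V} {x : V → T} {y : V → T'}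
    (hy : IsModel Q ψ' F τ σ y)
    (hx : ∀ p q, |vip (centred P ψ F σ p x) (ind {v | window σ F y v = q})| ≤ τ)
    (hτ : Nat.card (F → T × T') * (2 * τ) < η) :
    IsModel R (pairMap e ψ ψ') F η σ (fun v => (x v, y v)) := by
  refine isModel_of_patterns (FinMeas.pairMap he hψ hψ') (τ := 2 * τ) (fun p => ?_) hτ
  rw [h.real_pattern he hψ hψ']
  have f1 : {v | window σ F (fun v => (x v, y v)) v = p} =
      {v | window σ F x v = fun g => (p g).1} ∩ {v | window σ F y v = fun g => (p g).2} := by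
    ext v
    simp only [mem_ofPred_eq, mem_inter_iff, window, funext_iff, Prod.ext_iff]
    exact forall_and
  have h1 := hx (fun g => (p g).1) (fun g => (p g).2)
  have h2 : |freq {v | window σ F y v = fun g => (p g).2} - _| < τ := hy {q | q = fun g => (p g).2}
  unfold centred at h1
  rw [vip_sub_const_ind] at h1
  rw [f1]
  obtain ⟨c0, c1⟩ := real_nonneg_le_one P {z | readWindow ψ F z = fun g => (p g).1}
  set c := (P : Measure (G → A)).real {z | readWindow ψ F z = fun g => (p g).1}
  set d := (Q : Measure (G → B)).real {z | readWindow ψ' F z = fun g => (p g).2}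
  set t := freq {v | window σ F y v = fun g => (p g).2}
  set r := freq ({v | window σ F x v = fun g => (p g).1} ∩ {v | window σ F y v = fun g => (p g).2})
  have h2' : |t - d| < τ := h2
  have hc : |c * (t - d)| ≤ τ := by
    rw [abs_mul, abs_of_nonneg c0]
    nlinarith [abs_nonneg (t - d)]
  -- One `τ` for the correlation, one for the frequency of the pattern in `y`.
  have : r - c * d = (r - c * t) + c * (t - d) := by ring
  rw [this]
  have := abs_add_le (r - c * t) (c * (t - d))
  linarith

end Joint

/-! ### Typical samples against a fixed model -/

section JointMeasure

variable {G : Type*} {A B C : Type*} [MeasurableSpace A] [MeasurableSpace B] [MeasurableSpace C]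
  {T T' : Type*} [Finite T] [Finite T']

/-- The average correlation of a pattern in two independent samples of `m`, when these typically
form a model of the square. -/
theorem sum_abs_vip_le {V : Type*} [Fintype V] [Nonempty V] [DecidableEq V] [Fintype T]
    {P : ProbabilityMeasure (G → A)} {lab : A → T} (hlab : FinMeas lab) {F : Finset G}
    {σ : G → Equiv.Perm V} {m : ProbabilityMeasure (V → A)} {ξ : ℝ} (hξ : 0 ≤ ξ)
    (hm : (squareLaw m : Measure (V → A × A)).real {u | ¬ IsModel (squareLaw P)
      (pairMap id lab lab) F ξ σ (fun v => (lab (u v).1, lab (u v).2))} ≤ ξ) (p : F → T) :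
    ∑ x : V → T, ∑ x' : V → T, (m : Measure (V → A)).real ((fun x v => lab (x v)) ⁻¹' {x}) *
      (m : Measure (V → A)).real ((fun x v => lab (x v)) ⁻¹' {x'}) *
      |vip (centred P lab F σ p x) (centred P lab F σ p x')| ≤ 5 * ξ := by
  classical
  have hL : FinMeas (fun (x : V → A) v => lab (x v)) :=
    FinMeas.pi (ψ := fun v (x : V → A) => lab (x v)) fun v =>
      hlab.comp_measurable (measurable_pi_apply v)
  set c : (V → A × A) → (V → T) × (V → T) :=
    fun u => (fun v => lab (u v).1, fun v => lab (u v).2) with hc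
  have hcm : FinMeas c :=
    (FinMeas.pi (ψ := fun v (u : V → A × A) => lab (u v).1) fun v =>
      hlab.comp_measurable (measurable_fst.comp (measurable_pi_apply v))).prodMk
    (FinMeas.pi (ψ := fun v (u : V → A × A) => lab (u v).2) fun v =>
      hlab.comp_measurable (measurable_snd.comp (measurable_pi_apply v)))
  set f : (V → T) × (V → T) → ℝ :=
    fun q => |vip (centred P lab F σ p q.1) (centred P lab F σ p q.2)| with hf
  have hf1 : ∀ q, |f q| ≤ 1 := fun q => by
    rw [hf, abs_abs]
    exact abs_vip_le_one (abs_centred_le_one P lab F σ p _) (abs_centred_le_one P lab F σ p _)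
  -- Pairs that form a model contribute at most `3 * ξ`. On the exceptional set the correlation is
  -- at most one, which costs another `2 * ξ`.
  have h1 := abs_integral_sub_le (μ := (squareLaw m : Measure (V → A × A)))
    (integrable_finMeas hcm hf1) (integrable_const (0 : ℝ)) (ε := 3 * ξ) (by positivity)
    (fun u => hf1 _) (fun _ => by simp) hm (by
      intro u hu
      simp only [mem_ofPred_eq, not_not] at hu
      rw [sub_zero, hf, abs_abs]
      exact hu.abs_vip_le (isProdLaw_squareLaw P) measurable_id hlab hlab p p)
  rw [integral_finMeas _ hcm, integral_zero, sub_zero, Fintype.sum_prod_type] at h1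
  refine le_trans (le_of_eq ?_) ((le_abs_self _).trans (h1.trans (by linarith)))
  refine Finset.sum_congr rfl fun x _ => Finset.sum_congr rfl fun x' _ => ?_
  rw [← (isProdLaw_squareLaw m).real_eq measurable_id (hL {x}) (hL {x'})]
  congr 2
  ext u
  simp [c, Prod.ext_iff]

/-- If two independent samples of `m` typically form a model of the square of `P`, then for every
model `y` of `Q`, most samples of `m` form a joint model with `y`. -/
theorem exists_joint_tolerance {e : C → A × B} {R : ProbabilityMeasure (G → C)}
    {P : ProbabilityMeasure (G → A)} {Q : ProbabilityMeasure (G → B)} (h : IsProdLaw e R P Q)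
    (he : Measurable e) {lab : A → T} {lab' : B → T'} (hlab : FinMeas lab) (hlab' : FinMeas lab')
    (F : Finset G) {η ε : ℝ} (hη : 0 < η) (hε : 0 < ε) :
    ∃ ξ : ℝ, 0 < ξ ∧ ∀ (V : Type) [Fintype V] [Nonempty V] (σ : G → Equiv.Perm V)
      (m : ProbabilityMeasure (V → A)),
      (squareLaw m : Measure (V → A × A)).real {u | ¬ IsModel (squareLaw P)
        (pairMap id lab lab) F ξ σ (fun v => (lab (u v).1, lab (u v).2))} ≤ ξ →
      ∀ y : V → T', IsModel Q lab' F ξ σ y →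
        (m : Measure (V → A)).real {x | ¬ IsModel R (pairMap e lab lab') F η σ
          (fun v => (lab (x v), y v))} ≤ ε := by
  classical
  have := Fintype.ofFinite T
  have := Fintype.ofFinite T'
  set N : ℝ := ((Nat.card (F → T × T') : ℕ) : ℝ)
  set τ : ℝ := η / (4 * (N + 1)) with hτ
  have hN : 0 ≤ N := Nat.cast_nonneg _
  have hτ0 : 0 < τ := by positivity
  set M : ℝ := ((Fintype.card ((F → T) × (F → T')) : ℕ) : ℝ)
  have hM : 0 ≤ M := Nat.cast_nonneg _
  -- For `ξ ≤ s ^ 2` the square of the second moment is at most `5 * s ^ 2 ≤ (3 * s) ^ 2`.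
  -- Chebyshev's inequality at level `τ` and a union bound over the `M` pairs of patterns then give
  -- `ε`.
  set s : ℝ := ε * τ ^ 2 / (3 * (M + 1)) with hs
  have hs0 : 0 < s := by positivity
  refine ⟨min τ (s ^ 2), by positivity, fun V _ _ σ m hm y hy => ?_⟩
  have hL : FinMeas (fun (x : V → A) v => lab (x v)) :=
    FinMeas.pi (ψ := fun v (x : V → A) => lab (x v)) fun v =>
      hlab.comp_measurable (measurable_pi_apply v)
  have hξs : min τ (s ^ 2) ≤ s ^ 2 := min_le_right _ _
  have hpq : ∀ (p : F → T) (q : F → T'), (m : Measure (V → A)).real {x | τ ^ 2 ≤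
      vip (centred P lab F σ p fun v => lab (x v)) (ind {v | window σ F y v = q}) ^ 2} ≤
      3 * s / τ ^ 2 := by
    intro p q
    have h1 := sum_vip_sq_le (c := fun x : V → T => (m : Measure (V → A)).real
      ((fun x v => lab (x v)) ⁻¹' {x})) (fun _ => measureReal_nonneg)
      (abs_centred_le_one P lab F σ p) (abs_ind_le_one {v | window σ F y v = q})
    have h2 := h1.trans (sum_abs_vip_le hlab (by positivity) hm p)
    have h3 : ∑ x : V → T, (m : Measure (V → A)).real ((fun x v => lab (x v)) ⁻¹' {x}) *
        vip (centred P lab F σ p x) (ind {v | window σ F y v = q}) ^ 2 ≤ 3 * s :=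
      abs_le_of_sq_le_sq' (by nlinarith) (by positivity) |>.2
    have h4 := integral_finMeas (m : Measure (V → A)) hL
      (fun x => vip (centred P lab F σ p x) (ind {v | window σ F y v = q}) ^ 2)
    have h5 := mul_meas_ge_le_integral_of_nonneg (μ := (m : Measure (V → A)))
      (f := fun x => vip (centred P lab F σ p fun v => lab (x v))
        (ind {v | window σ F y v = q}) ^ 2) (ae_of_all _ fun x => sq_nonneg _)
      (integrable_finMeas hL (C := 1) (f := fun x => vip (centred P lab F σ p x)
        (ind {v | window σ F y v = q}) ^ 2) (fun x => by
          rw [abs_pow]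
          exact pow_le_one₀ (abs_nonneg _) (abs_vip_le_one (abs_centred_le_one P lab F σ p _)
            (abs_ind_le_one _)))) (τ ^ 2)
    rw [le_div_iff₀ (by positivity), mul_comm]
    refine h5.trans ((le_of_eq h4).trans ?_)
    exact h3
  calc (m : Measure (V → A)).real {x | ¬ IsModel R (pairMap e lab lab') F η σ
          (fun v => (lab (x v), y v))}
      ≤ (m : Measure (V → A)).real (⋃ i : (F → T) × (F → T'), {x | τ ^ 2 ≤
        vip (centred P lab F σ i.1 fun v => lab (x v)) (ind {v | window σ F y v = i.2}) ^ 2}) := by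
        refine measureReal_mono fun x hx => ?_
        by_contra hcon
        simp only [mem_iUnion, mem_ofPred_eq, not_exists, not_le] at hcon
        refine hx (isModel_pair_of_vip h he hlab hlab' (hy.mono subset_rfl (min_le_left _ _))
          (fun p q => ?_) ?_)
        · exact (abs_lt_of_sq_lt_sq (hcon (p, q)) hτ0.le).le
        · change N * (2 * τ) < η
          rw [hτ]
          rw [show N * (2 * (η / (4 * (N + 1)))) = η * (N / (2 * (N + 1))) by field_simp; ring]
          refine mul_lt_of_lt_one_right hη ?_
          rw [div_lt_one (by positivity)]
          linarith
    _ ≤ ∑ i : (F → T) × (F → T'), (m : Measure (V → A)).real {x | τ ^ 2 ≤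
        vip (centred P lab F σ i.1 fun v => lab (x v)) (ind {v | window σ F y v = i.2}) ^ 2} :=
        measureReal_iUnion_fintype_le _
    _ ≤ ∑ _i : (F → T) × (F → T'), 3 * s / τ ^ 2 := Finset.sum_le_sum fun i _ => hpq _ _
    _ = M * (3 * s / τ ^ 2) := by simp [M]
    _ ≤ ε := by
        rw [hs]
        rw [show M * (3 * (ε * τ ^ 2 / (3 * (M + 1))) / τ ^ 2) = ε * (M / (M + 1)) by
          field_simp]
        refine mul_le_of_le_one_right hε.le ?_
        rw [div_le_one (by positivity)]
        linarith

end JointMeasure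

/-! ### Diameter bounds and marginals of product laws -/

section Product

theorem exists_dist_bound (A : Type*) [MetricSpace A] [CompactSpace A] :
    ∃ D : ℝ, 0 < D ∧ ∀ a a' : A, dist a a' ≤ D :=
  ⟨Metric.diam (univ : Set A) + 1, by have := Metric.diam_nonneg (s := (univ : Set A)); linarith,
    fun a a' => (Metric.dist_le_diam_of_mem isCompact_univ.isBounded (mem_univ a)
      (mem_univ a')).trans (by linarith)⟩

variable {G : Type v} {A B C : Type*} [MeasurableSpace A] [MeasurableSpace B]
  [MeasurableSpace C]

theorem ae_squareLaw {P : ProbabilityMeasure (G → A)} {p : (G → A) → Prop}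
    (h : ∀ᵐ z ∂(P : Measure (G → A)), p z) :
    ∀ᵐ u ∂(squareLaw P : Measure (G → A × A)), p (fun g => (u g).1) ∧ p (fun g => (u g).2) := by
  have hs : (squareLaw P : Measure (G → A × A)) =
      ((P : Measure (G → A)).prod (P : Measure (G → A))).map zipFun := rfl
  have m1 : Measurable (fun (u : G → A × A) g => (u g).1) :=
    measurable_pi_iff.2 fun g => measurable_fst.comp (measurable_pi_apply g)
  have m2 : Measurable (fun (u : G → A × A) g => (u g).2) :=
    measurable_pi_iff.2 fun g => measurable_snd.comp (measurable_pi_apply g)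
  have q1 : Measure.QuasiMeasurePreserving (fun (u : G → A × A) g => (u g).1)
      (squareLaw P : Measure (G → A × A)) P := by
    refine ⟨m1, ?_⟩
    rw [hs, Measure.map_map m1 measurable_zipFun]
    change Measure.map Prod.fst _ ≪ _
    rw [Measure.map_fst_prod, measure_univ, one_smul]
  have q2 : Measure.QuasiMeasurePreserving (fun (u : G → A × A) g => (u g).2)
      (squareLaw P : Measure (G → A × A)) P := by
    refine ⟨m2, ?_⟩
    rw [hs, Measure.map_map m2 measurable_zipFun]
    change Measure.map Prod.snd _ ≪ _
    rw [Measure.map_snd_prod, measure_univ, one_smul]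
  exact (q1.ae h).and (q2.ae h)

theorem real_marginal [Group G] (P : ProbabilityMeasure (G → A)) {E : Set A}
    (hE : MeasurableSet E) :
    (marginal P : Measure A).real E = (P : Measure (G → A)).real {z | z 1 ∈ E} :=
  map_measureReal_apply (measurable_pi_apply (1 : G)) hE

theorem IsProdLaw.marginal_real [Group G] {e : C → A × B} {R : ProbabilityMeasure (G → C)}
    {P : ProbabilityMeasure (G → A)} {Q : ProbabilityMeasure (G → B)} (h : IsProdLaw e R P Q)
    (he : Measurable e) {E : Set A} (hE : MeasurableSet E) {E' : Set B} (hE' : MeasurableSet E') :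
    (marginal R : Measure C).real {c | (e c).1 ∈ E} = (marginal P : Measure A).real E ∧
    (marginal R : Measure C).real {c | (e c).2 ∈ E'} = (marginal Q : Measure B).real E' := by
  have h1 := h.real_eq he (E := {z | z 1 ∈ E}) (measurable_pi_apply (1 : G) hE) MeasurableSet.univ
  have h2 := h.real_eq he MeasurableSet.univ (E' := {z | z 1 ∈ E'})
    (measurable_pi_apply (1 : G) hE')
  rw [probReal_univ, mul_one] at h1
  rw [probReal_univ, one_mul] at h2
  refine ⟨(real_marginal R ((measurable_fst.comp he) hE)).trans ?_,
    (real_marginal R ((measurable_snd.comp he) hE')).trans ?_⟩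
  · rw [real_marginal P hE, ← h1]
    congr 1
    ext z
    simp
  · rw [real_marginal Q hE', ← h2]
    congr 1
    ext z
    simp

end Product

/-! ### The product inequality -/

section ProductTransfer

variable {G : Type v} [Group G] [Countable G]
  {A B C : Type*} [MetricSpace A] [CompactSpace A] [MeasurableSpace A] [BorelSpace A]
  [MetricSpace B] [CompactSpace B] [MeasurableSpace B] [BorelSpace B]
  [MetricSpace C] [CompactSpace C] [MeasurableSpace C] [BorelSpace C]

/-- The combinatorial core of the product inequality. For each of `M₂` separated models `y`, the
joint models with `y` carry almost all of `m` and so contain `M₁` separated points `x`. The pairs,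
realized in `C`, stay separated at a scale `δ` that is fixed before `O` and `ε`. -/
theorem exists_prod_models {e : C ≃ᵐ A × B} {R : ProbabilityMeasure (G → C)}
    {P : ProbabilityMeasure (G → A)} {Q : ProbabilityMeasure (G → B)} (h : IsProdLaw e R P Q)
    (hP : ShiftInv P) (hQ : ShiftInv Q) (hR : ShiftInv R) {δA δB : ℝ} (hδA : 0 < δA)
    (hδB : 0 < δB) :
    ∃ δ : ℝ, 0 < δ ∧ ∀ O ∈ 𝓝 R, ∀ ε : ℝ, 0 < ε → ∃ OB ∈ 𝓝 Q, ∃ OA ∈ 𝓝 (squareLaw P),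
      ∃ ξ : ℝ, 0 < ξ ∧ ∀ (V : Type) [Fintype V] [Nonempty V] (σ : G → Equiv.Perm V)
        (m : ProbabilityMeasure (V → A)),
        1 - ξ < (squareLaw m : Measure (V → A × A)).real (goodModels OA σ) →
        ∀ M₁ M₂ : ℕ, (M₁ : ℕ∞) ≤ measureCoverNumber hammingAvg ε δA m →
          (M₂ : ℕ∞) ≤ coverNumber hammingAvg δB (goodModels OB σ) →
          ((M₂ * M₁ : ℕ) : ℕ∞) ≤ coverNumber hammingAvg (δ / 2) (goodModels O σ) := by
  classical
  obtain ⟨DA, hDA, hdA⟩ := exists_dist_bound A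
  obtain ⟨DB, hDB, hdB⟩ := exists_dist_bound B
  set δ₀ : ℝ := min (δA / (8 * DA)) (δB / (8 * DB)) with hδ₀
  have hδ₀p : 0 < δ₀ := by positivity
  have hδ₀A : DA * δ₀ ≤ δA / 8 := by
    calc DA * δ₀ ≤ DA * (δA / (8 * DA)) := by gcongr; exact min_le_left _ _
      _ = δA / 8 := by field_simp
  have hδ₀B : DB * δ₀ ≤ δB / 8 := by
    calc DB * δ₀ ≤ DB * (δB / (8 * DB)) := by gcongr; exact min_le_right _ _
      _ = δB / 8 := by field_simp
  obtain ⟨NA, φA, hφA, hfA⟩ := exists_fine_partition A (δ := δA / 6) (by positivity)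
  obtain ⟨NB, φB, hφB, hfB⟩ := exists_fine_partition B (δ := δB / 6) (by positivity)
  obtain ⟨δ, hδ, hreal⟩ := exists_realization hR (FinMeas.pairMap e.measurable hφA hφB) hδ₀p
  refine ⟨δ, hδ, fun O hO ε hε => ?_⟩
  obtain ⟨T, hT, ψ, π, F, η, ρ, hψ, hπ, hη, hmod⟩ := hreal O hO
  have hneC : Nonempty C := (marginal R).nonempty
  have hneT : Nonempty T := hneC.map ψ
  set F' : Finset G := insert 1 F with hF'
  set ε₁ : ℝ := min (η / 2) (δ₀ / 2) / (3 * (F'.card + 1)) with hε₁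
  have hε₁p : 0 < ε₁ := by positivity
  have hFε : F'.card * (3 * ε₁) ≤ min (η / 2) (δ₀ / 2) := by
    rw [hε₁, show (F'.card : ℝ) * (3 * (min (η / 2) (δ₀ / 2) / (3 * (F'.card + 1)))) =
      min (η / 2) (δ₀ / 2) * (F'.card / (F'.card + 1)) by field_simp]
    refine mul_le_of_le_one_right (by positivity) ?_
    rw [div_le_one (by positivity)]
    linarith
  have h3ε : 3 * ε₁ ≤ δ₀ / 2 := by
    refine le_trans ?_ (hFε.trans (min_le_right _ _))
    have : (1 : ℝ) ≤ F'.card := by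
      exact_mod_cast Finset.card_pos.2 ⟨1, Finset.mem_insert_self 1 F⟩
    nlinarith
  -- `ψ` need not factor through finite observables of the coordinates, but up to a small error it
  -- does. The cells of `φA` and `φB` are carried in the labels in order to recover distances.
  obtain ⟨T₁, T₂, hT₁, hT₂, ψ₁, ψ₂, θ, hψ₁, hψ₂, hθ⟩ :=
    exists_prod_approx e (marginal R : Measure C) hψ hε₁p
  have hα : FinMeas (fun a => (ψ₁ a, φA a)) := hψ₁.prodMk hφA
  have hβ : FinMeas (fun b => (ψ₂ b, φB b)) := hψ₂.prodMk hφB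
  obtain ⟨labA, hlA, hlA', hlA'', hlAm⟩ := exists_labels P hα hε₁p (ρ := δA / 6) (by positivity)
  obtain ⟨labB, hlB, hlB', hlB'', hlBm⟩ := exists_labels Q hβ hε₁p (ρ := δB / 6) (by positivity)
  set η' : ℝ := min (η / 2) (δ₀ / 2) with hη'
  have hη'p : 0 < η' := by positivity
  obtain ⟨ξ, hξ, hjoint⟩ := exists_joint_tolerance h e.measurable hlA hlB F' hη'p
    (ε := ε / 2) (by positivity)
  obtain ⟨OB, hOB, hmodB⟩ := exists_nhds_isModel Q hlB F' (fun g _ => hQ.ae_eval g hlB'') hξ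
  obtain ⟨OA, hOA, hmodA⟩ := exists_nhds_isModel (squareLaw P)
    (FinMeas.pairMap (e := id) measurable_id hlA hlA) F' (fun g _ => by
      filter_upwards [ae_squareLaw (hP.ae_eval g hlA'')] with u hu
      filter_upwards [continuous_fst.continuousAt.eventually hu.1,
        continuous_snd.continuousAt.eventually hu.2] with a ha ha'
      exact Prod.ext ha ha') hξ
  refine ⟨OB, hOB, OA, hOA, ξ, hξ, fun V _ _ σ m hm M₁ M₂ hM₁ hM₂ => ?_⟩
  -- Missing labels are decoded arbitrarily. The set `bad` below collects the pairs of labels whose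
  -- decoding does not return the cells of `φA` and `φB`; joint models visit it rarely.
  set dec : Option (T₁ × Fin NA) × Option (T₂ × Fin NB) → T := fun o =>
    match o with
    | (some p, some q) => θ (p.1, q.1)
    | _ => Classical.arbitrary T with hdec
  set bad : Set (Option (T₁ × Fin NA) × Option (T₂ × Fin NB)) := {o | ¬ ∃ p q,
    o.1 = some p ∧ o.2 = some q ∧ π (dec o) = (p.2, q.2)} with hbad
  set L := pairMap e labA labB with hL
  have hLm : FinMeas L := FinMeas.pairMap e.measurable hlA hlB
  -- the labels are almost always right
  have hexc : (marginal R : Measure C).real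
      ({c | labA (e c).1 ≠ some (ψ₁ (e c).1, φA (e c).1)} ∪
      ({c | labB (e c).2 ≠ some (ψ₂ (e c).2, φB (e c).2)} ∪
      {c | θ (ψ₁ (e c).1, ψ₂ (e c).2) ≠ ψ c})) ≤ 3 * ε₁ := by
    obtain ⟨k1, k2⟩ := h.marginal_real e.measurable
      (E := {a | labA a ≠ some (ψ₁ a, φA a)}) (hlA.measurableSet_ne (hα.comp_left some))
      (E' := {b | labB b ≠ some (ψ₂ b, φB b)}) (hlB.measurableSet_ne (hβ.comp_left some))
    refine (measureReal_union_le _ _).trans ?_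
    refine (add_le_add_right (measureReal_union_le _ _) _).trans ?_
    have e1 := k1.le.trans hlAm
    have e2 := k2.le.trans hlBm
    simp only [mem_ofPred_eq] at e1 e2
    linarith
  have hdecψ : (marginal R : Measure C).real {c | (dec ∘ L) c ≠ ψ c} ≤ 3 * ε₁ := by
    refine (measureReal_mono fun c hc => ?_).trans hexc
    by_contra hcon
    simp only [mem_union, mem_ofPred_eq, not_or, ne_eq, not_not] at hcon
    obtain ⟨c1, c2, c3⟩ := hcon
    refine hc ?_
    rw [← c3]
    simp only [Function.comp, L, pairMap, c1, c2, dec]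
  have hbadR : (R : Measure (G → C)).real {z | L (z 1) ∈ bad} ≤ 3 * ε₁ := by
    rw [show {z : G → C | L (z 1) ∈ bad} = {z | z 1 ∈ L ⁻¹' bad} from rfl,
      hR.real_eval 1 (hLm bad)]
    refine (measureReal_mono fun c hc => ?_).trans hexc
    by_contra hcon
    simp only [mem_union, mem_ofPred_eq, not_or, ne_eq, not_not] at hcon
    obtain ⟨c1, c2, c3⟩ := hcon
    refine hc ⟨_, _, c1, c2, ?_⟩
    have : dec (L c) = ψ c := by
      rw [← c3]
      simp only [L, pairMap, c1, c2, dec]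
    rw [this, hπ c]
    rfl
  -- consequences for joint models
  have hjm : ∀ (x : V → A) (y : V → B),
      IsModel R L F' η' σ (fun v => (labA (x v), labB (y v))) →
      IsModel R ψ F η σ (fun v => dec (labA (x v), labB (y v))) ∧
      freq {v | (labA (x v), labB (y v)) ∈ bad} ≤ δ₀ := by
    intro x y hxy
    constructor
    · have h1 := (hxy.map dec).of_marginal hR (hLm.comp_left dec) hψ (ε := min (η / 2) (δ₀ / 2))
        ((mul_le_mul_of_nonneg_left hdecψ (by positivity)).trans hFε)
      refine h1.mono (Finset.subset_insert 1 F) ?_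
      have := min_le_left (η / 2) (δ₀ / 2)
      linarith
    · have h1 := (abs_lt.1 (hxy.freq_symbol (Finset.mem_insert_self 1 F) bad)).2
      have := min_le_right (η / 2) (δ₀ / 2)
      linarith
  have hclose : ∀ (x x' : V → A) (y y' : V → B),
      IsModel R L F' η' σ (fun v => (labA (x v), labB (y v))) →
      IsModel R L F' η' σ (fun v => (labA (x' v), labB (y' v))) →
      hammingAvg (ρ ∘ fun v => dec (labA (x v), labB (y v)))
        (ρ ∘ fun v => dec (labA (x' v), labB (y' v))) < δ →
      hammingAvg x x' < δA ∧ hammingAvg y y' < δB := by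
    intro x x' y y' hxy hxy' hd
    obtain ⟨j1, j2⟩ := hjm x y hxy
    obtain ⟨j1', j2'⟩ := hjm x' y' hxy'
    have h1 := (hmod V σ).2 _ _ j1 j1' hd
    have hA := hlA'.hammingAvg_le (π := Prod.snd) (fun a a' haa => hfA a a' haa)
      (by positivity) hdA x x'
    have hB := hlB'.hammingAvg_le (π := Prod.snd) (fun a a' haa => hfB a a' haa)
      (by positivity) hdB y y'
    set W : Set V := ({v | (labA (x v), labB (y v)) ∈ bad} ∪
      {v | (labA (x' v), labB (y' v)) ∈ bad}) ∪
      {v | π (dec (labA (x v), labB (y v))) ≠ π (dec (labA (x' v), labB (y' v)))}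
    have hW : freq W ≤ 3 * δ₀ := by
      refine (freq_union_le _ _).trans ?_
      have := freq_union_le {v | (labA (x v), labB (y v)) ∈ bad}
        {v | (labA (x' v), labB (y' v)) ∈ bad}
      linarith
    have hgood : ∀ v, v ∉ W → ∃ p q p' q', labA (x v) = some p ∧ labB (y v) = some q ∧
        labA (x' v) = some p' ∧ labB (y' v) = some q' ∧ p.2 = p'.2 ∧ q.2 = q'.2 := by
      intro v hv
      simp only [W, mem_union, mem_ofPred_eq, not_or, bad, not_not, ne_eq] at hv
      obtain ⟨⟨⟨p, q, k1, k2, k3⟩, p', q', k1', k2', k3'⟩, k4⟩ := hv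
      rw [k3, k3', Prod.ext_iff] at k4
      exact ⟨p, q, p', q', k1, k2, k1', k2', k4.1, k4.2⟩
    have hWA : freq {v | labA (x v) = none ∨ labA (x' v) = none ∨
        (labA (x v)).map Prod.snd ≠ (labA (x' v)).map Prod.snd} ≤ freq W := by
      refine freq_mono fun v hv => ?_
      by_contra hcon
      obtain ⟨p, q, p', q', k1, k2, k1', k2', k3, k4⟩ := hgood v hcon
      simp [k1, k1', k3] at hv
    have hWB : freq {v | labB (y v) = none ∨ labB (y' v) = none ∨
        (labB (y v)).map Prod.snd ≠ (labB (y' v)).map Prod.snd} ≤ freq W := by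
      refine freq_mono fun v hv => ?_
      by_contra hcon
      obtain ⟨p, q, p', q', k1, k2, k1', k2', k3, k4⟩ := hgood v hcon
      simp [k2, k2', k4] at hv
    have hA' := mul_le_mul_of_nonneg_left (hWA.trans hW) hDA.le
    have hB' := mul_le_mul_of_nonneg_left (hWB.trans hW) hDB.le
    constructor <;> linarith
  -- most samples form a joint model
  have hsq : (squareLaw m : Measure (V → A × A)).real {u | ¬ IsModel (squareLaw P)
      (pairMap id labA labA) F' ξ σ (fun v => (labA (u v).1, labA (u v).2))} ≤ ξ := by
    have hmeas : MeasurableSet {u : V → A × A | IsModel (squareLaw P)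
        (pairMap id labA labA) F' ξ σ (fun v => (labA (u v).1, labA (u v).2))} :=
      FinMeas.pi (ψ := fun v (u : V → A × A) => (labA (u v).1, labA (u v).2)) (fun v =>
        (FinMeas.pairMap (e := id) measurable_id hlA hlA).comp_measurable (measurable_pi_apply v))
        {y | IsModel (squareLaw P) (pairMap id labA labA) F' ξ σ y}
    have h1 := probReal_compl_eq_one_sub (μ := (squareLaw m : Measure (V → A × A))) hmeas
    have h2 : (squareLaw m : Measure (V → A × A)).real (goodModels OA σ) ≤
      (squareLaw m : Measure (V → A × A)).real {u : V → A × A | IsModel (squareLaw P)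
        (pairMap id labA labA) F' ξ σ (fun v => (labA (u v).1, labA (u v).2))} :=
      measureReal_mono fun u hu => hmodA V σ u hu
    change (squareLaw m : Measure (V → A × A)).real {u : V → A × A | IsModel (squareLaw P)
        (pairMap id labA labA) F' ξ σ (fun v => (labA (u v).1, labA (u v).2))}ᶜ ≤ ξ
    linarith
  obtain ⟨sY, hsYc, hsYm, hsYs⟩ := exists_separated_of_le_coverNumber hammingAvg_self
    hammingAvg_comm hδB hM₂
  have hX : ∀ y : V → B, ∃ s : Finset (V → A), y ∈ sY → s.card = M₁ ∧
      (∀ x ∈ s, IsModel R L F' η' σ (fun v => (labA (x v), labB (y v)))) ∧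
      ∀ x ∈ s, ∀ x' ∈ s, x ≠ x' → δA ≤ hammingAvg x x' := by
    intro y
    by_cases hy : y ∈ sY
    swap
    · exact ⟨∅, fun h => absurd h hy⟩
    -- The joint models with `y` have measure at least `1 - ε / 2`, so every set that covers them
    -- competes in `measureCoverNumber hammingAvg ε δA m`.
    have h1 := hjoint V σ m hsq (fun v => labB (y v)) (hmodB V σ y (hsYm y hy))
    obtain ⟨s, hs1, hs2, hs3⟩ := exists_separated (d := hammingAvg) hammingAvg_self
      hammingAvg_comm hδA (M := M₁)
      (Z := {x : V → A | IsModel R L F' η' σ (fun v => (labA (x v), labB (y v)))}) (by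
        intro E _ hE
        refine hM₁.trans (sInf_le ⟨E, ?_, rfl⟩)
        have h2 : (1 : ℝ) ≤ (m : Measure (V → A)).real
            {x | IsModel R L F' η' σ (fun v => (labA (x v), labB (y v)))} +
            (m : Measure (V → A)).real
            {x | ¬ IsModel R L F' η' σ (fun v => (labA (x v), labB (y v)))} := by
          rw [← probReal_univ (μ := (m : Measure (V → A)))]
          refine (measureReal_mono ?_).trans (measureReal_union_le _ _)
          intro x _
          exact em _
        have h3 := measureReal_mono (μ := (m : Measure (V → A)))
          (s₁ := {x | IsModel R L F' η' σ (fun v => (labA (x v), labB (y v)))})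
          (s₂ := {z | ∃ y ∈ E, hammingAvg z y < δA}) hE
        linarith)
    exact ⟨s, fun _ => ⟨hs1, hs2, hs3⟩⟩
  choose sX hsX using hX
  have hcard : (sY.sigma sX).card = M₂ * M₁ := by
    rw [Finset.card_sigma, Finset.sum_congr rfl fun y hy => (hsX y hy).1]
    simp [hsYc]
  rw [← hcard]
  refine le_coverNumber_of_separated hammingAvg_comm hammingAvg_triangle (sY.sigma sX)
    (fun p v => ρ (dec (labA (p.2 v), labB (p.1 v)))) ?_ ?_
  · rintro ⟨y, x⟩ hp
    obtain ⟨hy, hx⟩ := Finset.mem_sigma.1 hp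
    exact (hmod V σ).1 _ (hjm x y ((hsX y hy).2.1 x hx)).1
  · rintro ⟨y, x⟩ hp ⟨y', x'⟩ hp' hne
    obtain ⟨hy, hx⟩ := Finset.mem_sigma.1 hp
    obtain ⟨hy', hx'⟩ := Finset.mem_sigma.1 hp'
    by_contra! hlt
    -- Close images force both `x, x'` and `y, y'` to be close. This contradicts the separation of
    -- `sY` if `y ≠ y'`, and that of `sX y` otherwise.
    obtain ⟨c1, c2⟩ := hclose x x' y y' ((hsX y hy).2.1 x hx) ((hsX y' hy').2.1 x' hx') hlt
    by_cases hyy : y = y'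
    · subst hyy
      have hxx : x ≠ x' := fun h => hne (by rw [h])
      exact absurd ((hsX y hy).2.2 x hx x' hx' hxx) (not_le.2 c1)
    · exact absurd (hsYs y hy y' hy' hyy) (not_le.2 c2)

/-- The sofic entropy of a product is bounded from below by the sum of the doubly-quenched
entropy of one factor and the lower sofic entropy of the other. -/
theorem SoficApproximation.processDQEntropy_add_le (S : SoficApproximation G)
    {e : C ≃ᵐ A × B} {R : ProbabilityMeasure (G → C)}
    {P : ProbabilityMeasure (G → A)} {Q : ProbabilityMeasure (G → B)} (h : IsProdLaw e R P Q)
    (hP : ShiftInv P) (hQ : ShiftInv Q) (hR : ShiftInv R) :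
    S.processDQEntropy P + S.processLowerEntropy Q ≤ S.processEntropy R := by
  refine EReal.add_le_of_forall_lt fun a ha b hb => ?_
  induction a using EReal.rec with
  | bot => simp
  | top => exact absurd ha (by simp)
  | coe a =>
  induction b using EReal.rec with
  | bot => simp
  | top => exact absurd hb (by simp)
  | coe b =>
  unfold SoficApproximation.processDQEntropy at ha
  unfold SoficApproximation.processLowerEntropy at hb
  simp only [lt_iSup_iff] at ha hb
  obtain ⟨n, hn, m, hm, ε, hε, δA, hδA, ha⟩ := ha
  obtain ⟨δB, hδB, hb⟩ := hb
  obtain ⟨δ, hδ, key⟩ := exists_prod_models h hP hQ hR hδA hδB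
  unfold SoficApproximation.processEntropy
  refine le_iSup₂_of_le (δ / 2) (by positivity) (le_iInf₂ fun O hO => ?_)
  obtain ⟨OB, hOB, OA, hOA, ξ, hξ, key⟩ := key O hO ε hε
  -- The measures on models of `P` live on a subsequence and are large only frequently. The bound
  -- for `Q` must hold eventually in order to meet them, which is why the lower entropy of `Q`
  -- enters.
  have h1 : ∃ᶠ i in atTop, (a : EReal) < logRate (measureCoverNumber hammingAvg ε δA (m i))
      (Fintype.card (S.V (n i))) := frequently_lt_of_lt_limsup (by isBoundedDefault) ha
  have h2 : ∀ᶠ i in atTop, (b : EReal) < logRate (coverNumber hammingAvg δB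
      (goodModels OB (S.σ i))) (Fintype.card (S.V i)) :=
    eventually_lt_of_lt_liminf (hb.trans_le (iInf₂_le OB hOB)) (by isBoundedDefault)
  have h3 : ∀ᶠ i in atTop, 1 - ξ < (squareLaw (m i) : Measure (S.V (n i) → A × A)).real
      (goodModels OA (S.σ (n i))) := by
    have := (ENNReal.tendsto_toReal ENNReal.one_ne_top).comp (hm.2 OA hOA)
    exact (tendsto_order.1 this).1 _ (by simpa using hξ)
  have h4 : ∃ᶠ i in atTop, ((a : EReal) + b) ≤ logRate (coverNumber hammingAvg (δ / 2)
      (goodModels O (S.σ (n i)))) (Fintype.card (S.V (n i))) := by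
    refine ((h1.and_eventually (hn.tendsto_atTop.eventually h2)).and_eventually h3).mono ?_
    rintro i ⟨⟨i1, i2⟩, i3⟩
    obtain ⟨M₁, hM₁, e1⟩ := exists_nat_of_lt_logRate Fintype.card_pos i1
    obtain ⟨M₂, hM₂, e2⟩ := exists_nat_of_lt_logRate Fintype.card_pos i2
    have := le_logRate (a := a + b) Fintype.card_pos (key _ _ (m i) i3 M₁ M₂ hM₁ hM₂) (by
      rw [add_mul, Real.exp_add, Nat.cast_mul, mul_comm]
      gcongr)
    exact_mod_cast this
  refine le_limsup_of_frequently_le ?_ (by isBoundedDefault)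
  exact hn.tendsto_atTop.frequently h4

end ProductTransfer

/-! ### Comparison of covering numbers along a map -/

section CoverMap

variable {Y Y' : Type*} {d : Y → Y → ℝ} {d' : Y' → Y' → ℝ}

/-- Separated points have separated images; trading covers for separated sets costs the factor two
in the scale. -/
theorem coverNumber_le_of_map (hself : ∀ y, d y y = 0) (hsymm : ∀ y z, d y z = d z y)
    (hsymm' : ∀ y z, d' y z = d' z y) (htri' : ∀ x y z, d' x z ≤ d' x y + d' y z) {δ δ' : ℝ}
    (hδ : 0 < δ) {Z : Set Y} {Z' : Set Y'} (f : Y → Y') (hf : ∀ z ∈ Z, f z ∈ Z')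
    (hd : ∀ z ∈ Z, ∀ z' ∈ Z, d' (f z) (f z') < δ' → d z z' < δ) :
    coverNumber d δ Z ≤ coverNumber d' (δ' / 2) Z' := by
  refine ENat.forall_natCast_le_iff_le.1 fun M hM => ?_
  obtain ⟨s, rfl, hsZ, hsep⟩ := exists_separated_of_le_coverNumber hself hsymm hδ hM
  exact le_coverNumber_of_separated hsymm' htri' s f (fun z hz => hf z (hsZ z hz))
    fun z hz z' hz' hne => by
      by_contra! hlt
      exact absurd (hsep z hz z' hz' hne) (not_le.2 (hd z (hsZ z hz) z' (hsZ z' hz') hlt))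

end CoverMap

/-! ### Sofic entropy under isomorphism -/

section Isomorphism

variable {G : Type v} {A B : Type*} [MeasurableSpace A] [MeasurableSpace B]

theorem IsModel.of_map {V T : Type*} [Fintype V] [Finite T] {e : A → B} (he : Measurable e)
    {P : ProbabilityMeasure (G → A)} {Q : ProbabilityMeasure (G → B)}
    (h : (P : Measure (G → A)).map (fun z g => e (z g)) = Q) {ψ : B → T} (hψ : FinMeas ψ)
    {F : Finset G} {η : ℝ} {σ : G → Equiv.Perm V} {y : V → T}
    (hy : IsModel P (ψ ∘ e) F η σ y) : IsModel Q ψ F η σ y := by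
  intro S
  have h1 := map_measureReal_apply (μ := (P : Measure (G → A))) (f := fun z g => e (z g))
    (measurable_pi_iff.2 fun g => he.comp (measurable_pi_apply g)) (hψ.readWindow F S)
  rw [h] at h1
  change |_ - (Q : Measure (G → B)).real (readWindow ψ F ⁻¹' S)| < η
  rw [h1]
  exact hy S

theorem IsModel.getD {V T : Type*} [Fintype V] {P : ProbabilityMeasure (G → A)} {ψ : A → T}
    {F : Finset G} {η : ℝ} {σ : G → Equiv.Perm V} {y : V → Option T}
    (h : IsModel P (some ∘ ψ) F η σ y) (t : T) : IsModel P ψ F η σ (fun v => (y v).getD t) :=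
  h.map fun o => o.getD t

theorem IsModel.freq_none {V T : Type*} [Fintype V] {P : ProbabilityMeasure (G → A)} {ψ : A → T}
    {F : Finset G} {η : ℝ} {σ : G → Equiv.Perm V} {y : V → Option T}
    (h : IsModel P (some ∘ ψ) F η σ y) {g : G} (hg : g ∈ F) : freq {v | y v = none} < η := by
  have h1 := (abs_lt.1 (h.freq_symbol hg {none})).2
  have h2 : {z : G → A | (some ∘ ψ) (z g) ∈ ({none} : Set (Option T))} = ∅ := by
    ext z; simp
  rw [h2, measureReal_empty, sub_zero] at h1
  exact h1

variable [Group G] [Countable G]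
  [MetricSpace A] [CompactSpace A] [BorelSpace A] [MetricSpace B] [CompactSpace B] [BorelSpace B]

/-- Sofic entropy does not decrease under isomorphisms, whatever the compact metrics. -/
theorem SoficApproximation.processEntropy_le_of_equiv (S : SoficApproximation G) (e : A ≃ᵐ B)
    {P : ProbabilityMeasure (G → A)} {Q : ProbabilityMeasure (G → B)} (hP : ShiftInv P)
    (hQ : ShiftInv Q) (h : (P : Measure (G → A)).map (fun z g => e (z g)) = Q) :
    S.processEntropy P ≤ S.processEntropy Q := by
  classical
  refine iSup₂_le fun δ hδ => ?_
  obtain ⟨D, hD, hdist⟩ := exists_dist_bound A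
  obtain ⟨N, φ, hφ, hfine⟩ := exists_fine_partition A (δ := δ / 12) (by positivity)
  set δ₀ : ℝ := δ / (12 * D) with hδ₀
  have hDδ : D * δ₀ = δ / 12 := by rw [hδ₀]; field_simp
  have hδ₀p : 0 < δ₀ := by positivity
  obtain ⟨δ', hδ', hreal⟩ := exists_realization hQ (hφ.comp_measurable e.symm.measurable) hδ₀p
  refine le_iSup₂_of_le (δ' / 2) (by positivity) (le_iInf₂ fun O' hO' => ?_)
  obtain ⟨T, hT, ψ, π, F, η, ρ, hψ, hπ, hη, hmod⟩ := hreal O' hO'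
  have hneB : Nonempty B := (marginal Q).nonempty
  have t₀ : T := ψ (Classical.arbitrary B)
  -- A good model of `P` is sent to one of `Q` by reading `ψ ∘ e` off its labels and applying `ρ`.
  -- The window contains `1` so that the frequency of missing labels is controlled.
  obtain ⟨lab, hlab, hlab', O, hO, hmodO⟩ := exists_nhds_labels hP
    (hψ.comp_measurable e.measurable) (insert 1 F) (η := min η δ₀) (ρ := δ / 12) (by positivity)
    (by positivity)
  refine (iInf₂_le O hO).trans (limsup_le_limsup (Eventually.of_forall fun n => ?_))
  refine logRate_mono ?_ _
  refine coverNumber_le_of_map hammingAvg_self hammingAvg_comm hammingAvg_comm hammingAvg_triangle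
    hδ (fun x v => ρ ((lab (x v)).getD t₀)) (fun x hx => ?_) (fun x hx x' hx' hd => ?_)
  · refine (hmod _ _).1 _ ?_
    exact (((hmodO _ _ x hx).getD t₀).mono (Finset.subset_insert 1 F)
      (min_le_left _ _)).of_map e.measurable h hψ
  · have m1 := hmodO _ _ x hx
    have m2 := hmodO _ _ x' hx'
    have f1 := (hmod _ _).2 _ _
      (((m1.getD t₀).mono (Finset.subset_insert 1 F) (min_le_left _ _)).of_map e.measurable h hψ)
      (((m2.getD t₀).mono (Finset.subset_insert 1 F) (min_le_left _ _)).of_map e.measurable h hψ)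
      hd
    have f2 := (m1.freq_none (Finset.mem_insert_self 1 F)).trans_le (min_le_right _ _)
    have f3 := (m2.freq_none (Finset.mem_insert_self 1 F)).trans_le (min_le_right _ _)
    have h1 := hlab'.hammingAvg_le (π := π) (fun a a' haa => hfine a a' (by
      have e1 := hπ (e a)
      have e2 := hπ (e a')
      simp only [Function.comp, MeasurableEquiv.symm_apply_apply] at haa e1 e2
      rw [← e1, ← e2, haa])) (by positivity) hdist x x'
    have h2 : freq {v | lab (x v) = none ∨ lab (x' v) = none ∨
        (lab (x v)).map π ≠ (lab (x' v)).map π} ≤ 3 * δ₀ := by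
      have h3 : {v | lab (x v) = none ∨ lab (x' v) = none ∨
          (lab (x v)).map π ≠ (lab (x' v)).map π} ⊆
          ({v | lab (x v) = none} ∪ {v | lab (x' v) = none}) ∪
          {v | π ((lab (x v)).getD t₀) ≠ π ((lab (x' v)).getD t₀)} := by
        intro v hv
        by_contra hcon
        simp only [mem_union, mem_ofPred_eq, not_or, ne_eq, not_not] at hcon hv
        obtain ⟨⟨c1, c2⟩, c3⟩ := hcon
        obtain ⟨t, ht⟩ := Option.ne_none_iff_exists'.1 c1
        obtain ⟨t', ht'⟩ := Option.ne_none_iff_exists'.1 c2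
        simp only [ht, ht', Option.getD_some] at c3
        simp [ht, ht', c3] at hv
      refine (freq_le_add h3).trans ?_
      have := freq_union_le {v | lab (x v) = none} {v | lab (x' v) = none}
      change freq {v | (lab ∘ x) v = none} < _ at f2
      change freq {v | (lab ∘ x') v = none} < _ at f3
      simp only [Function.comp] at f1 f2 f3
      linarith
    -- The distance is at most `3 * (δ / 12) + 3 * (δ / 12)`.
    have h3 := mul_le_mul_of_nonneg_left h2 hD.le
    linarith

end Isomorphism

/-! ### Entropy and the number of words that model a generator -/

section Counting

variable {G : Type v} [Group G] [Countable G] {A : Type*} [MeasurableSpace A]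
  [MetricSpace A] [CompactSpace A] [BorelSpace A]

/-- If every finite-valued observable is approximated by windows of `φ`, then the sofic entropy is
bounded by the growth rate of the number of finite models of `φ`. -/
theorem SoficApproximation.processEntropy_le_models (S : SoficApproximation G)
    {P : ProbabilityMeasure (G → A)} (hP : ShiftInv P) {K : Type*} [Finite K] {φ : A → K}
    (hφ : FinMeas φ)
    (happ : ∀ (N : ℕ) (ψ : A → Fin N), FinMeas ψ → ∀ ε : ℝ, 0 < ε →
      ∃ (D : Finset G) (θ : (D → K) → Fin N),
        (P : Measure (G → A)).real {z | θ (readWindow φ D z) ≠ ψ (z 1)} ≤ ε)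
    (F : Finset G) {η : ℝ} (hη : 0 < η) :
    S.processEntropy P ≤ limsup (fun n => logRate
      (({y : S.V n → K | IsModel P φ F η (S.σ n) y}.ncard : ℕ) : ℕ∞)
      (Fintype.card (S.V n))) atTop := by
  classical
  refine iSup₂_le fun δ hδ => ?_
  obtain ⟨d, hd, hdist⟩ := exists_dist_bound A
  obtain ⟨N, ψ, hψ, hfine⟩ := exists_fine_partition A (δ := δ / 12) (by positivity)
  set δ₀ : ℝ := δ / (12 * d) with hδ₀
  have hDδ : d * δ₀ = δ / 12 := by rw [hδ₀]; field_simp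
  have hδ₀p : 0 < δ₀ := by positivity
  obtain ⟨D, θ, hθ⟩ := happ N ψ hψ δ₀ hδ₀p
  have hneA : Nonempty A := (marginal P).nonempty
  have k₀ : K := φ (Classical.arbitrary A)
  set F' : Finset G := insert 1 (F ∪ D) with hF'
  have h1F : (1 : G) ∈ F' := Finset.mem_insert_self _ _
  have hDF : ∀ g : D, (g : G) ∈ F' := fun g =>
    Finset.mem_insert_of_mem (Finset.mem_union_right _ g.2)
  obtain ⟨lab, hlab, hlab', O, hO, hmodO⟩ := exists_nhds_labels hP
    (hψ.prodMk hφ) F' (η := min η δ₀) (ρ := δ / 12) (by positivity) (by positivity)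
  refine (iInf₂_le O hO).trans (limsup_le_limsup (Eventually.of_forall fun n => ?_))
  refine logRate_mono ?_ _
  set rd : Option (Fin N × K) → K := fun o => (o.map Prod.snd).getD k₀ with hrd
  -- Good models with the same `φ`-word are close, because windows of that word determine the cell
  -- of `ψ` at most vertices.
  refine coverNumber_le_card (fun x v => rd (lab (x v)))
    (R := {y : S.V n → K | IsModel P φ F η (S.σ n) y}) (fun x hx => ?_) (fun x hx x' hx' heq => ?_)
  · exact ((hmodO _ _ x hx).map rd).mono
      (Finset.subset_union_left.trans (Finset.subset_insert _ _)) (min_le_left _ _)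
  · set bad : Set (F' → Option (Fin N × K)) := {w | ¬ ∃ p, w ⟨1, h1F⟩ = some p ∧
      θ (fun g : D => rd (w ⟨g, hDF g⟩)) = p.1} with hbad
    have hbadP : (P : Measure (G → A)).real
        {z | readWindow (some ∘ fun a => (ψ a, φ a)) F' z ∈ bad} ≤ δ₀ := by
      refine (measureReal_mono fun z hz => ?_).trans hθ
      by_contra hcon
      refine hz ⟨(ψ (z 1), φ (z 1)), rfl, ?_⟩
      simp only [mem_ofPred_eq, ne_eq, not_not] at hcon
      exact hcon
    have hfr : ∀ x ∈ goodModels O (S.σ n), freq {v | window (S.σ n) F' (lab ∘ x) v ∈ bad} ≤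
        2 * δ₀ := by
      intro x hx
      have := (abs_lt.1 (hmodO _ _ x hx bad)).2
      have := min_le_right η δ₀
      linarith
    have h1 := hlab'.hammingAvg_le (π := Prod.fst) (fun a a' haa => hfine a a' haa)
      (by positivity) hdist x x'
    -- The window at `v` carries the label of `σ 1 v`, hence the change of variable.
    rw [← freq_perm (S.σ n 1)] at h1
    have h2 : freq {v | S.σ n 1 v ∈ {v | lab (x v) = none ∨ lab (x' v) = none ∨
        (lab (x v)).map Prod.fst ≠ (lab (x' v)).map Prod.fst}} ≤ 4 * δ₀ := by
      refine (freq_le_add (s := {v | window (S.σ n) F' (lab ∘ x) v ∈ bad})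
        (t := {v | window (S.σ n) F' (lab ∘ x') v ∈ bad}) fun v hv => ?_).trans (by
          linarith [hfr x hx, hfr x' hx'])
      by_contra hcon
      simp only [mem_union, mem_ofPred_eq, not_or, bad, not_not] at hcon hv
      obtain ⟨⟨p, c1, c2⟩, p', c1', c2'⟩ := hcon
      have c3 : (fun g : D => rd (window (S.σ n) F' (lab ∘ x) v ⟨g, hDF g⟩)) =
          fun g : D => rd (window (S.σ n) F' (lab ∘ x') v ⟨g, hDF g⟩) :=
        funext fun g => congrFun heq (S.σ n g v)
      rw [c3, c2'] at c2
      simp only [window, Function.comp] at c1 c1'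
      simp [c1, c1', c2] at hv
    have h3 := mul_le_mul_of_nonneg_left h2 hd.le
    linarith

end Counting

/-! ### The one-point process -/

section Trivial

variable {G : Type v} [Group G] [Countable G] {A : Type*} [MeasurableSpace A]
  [MetricSpace A] [CompactSpace A] [BorelSpace A]

omit [MeasurableSpace A] [CompactSpace A] [BorelSpace A] in
theorem coverNumber_eq_one [Subsingleton A] [Nonempty A]
    {V : Type*} [Fintype V] {δ : ℝ} (hδ : 0 < δ) :
    coverNumber (Y := V → A) hammingAvg δ univ = 1 := by
  refine le_antisymm ?_ (le_sInf ?_)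
  · refine sInf_le ⟨univ, subset_rfl, fun z _ => ⟨z, mem_univ _, by
      rw [hammingAvg_self]; exact hδ⟩, ?_⟩
    refine (Set.encard_eq_one.2 ⟨fun _ => Classical.arbitrary A, ?_⟩).symm
    exact Set.eq_singleton_iff_unique_mem.2 ⟨mem_univ _, fun _ _ => Subsingleton.elim _ _⟩
  · rintro _ ⟨F, -, hF, rfl⟩
    obtain ⟨y, hy, -⟩ := hF (fun _ => Classical.arbitrary A) (mem_univ _)
    exact Set.one_le_encard_iff_nonempty.2 ⟨y, hy⟩

/-- A one-point process has zero entropy. -/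
theorem SoficApproximation.processEntropy_eq_zero (S : SoficApproximation G) [Subsingleton A]
    (P : ProbabilityMeasure (G → A)) :
    S.processEntropy P = 0 ∧ S.processLowerEntropy P = 0 := by
  have hne : Nonempty A := (marginal P).nonempty
  have hsub : ∀ Q : ProbabilityMeasure (G → A), Q = P := by
    intro Q
    refine Subtype.ext (Measure.ext fun s _ => ?_)
    rcases Set.eq_empty_or_nonempty s with rfl | h
    · simp
    · have : s = univ := Set.eq_univ_of_forall fun z => by
        obtain ⟨z', hz'⟩ := h
        rwa [Subsingleton.elim z z']
      rw [this]
      exact (measure_univ (μ := (Q : Measure (G → A)))).trans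
        (measure_univ (μ := (P : Measure (G → A)))).symm
  have hgood : ∀ O ∈ 𝓝 P, ∀ n, goodModels O (S.σ n) = univ := by
    intro O hO n
    refine Set.eq_univ_of_forall fun x => ?_
    change empiricalDist (S.σ n) x ∈ O
    rw [hsub (empiricalDist (S.σ n) x)]
    exact mem_of_mem_nhds hO
  have hrate : ∀ δ : ℝ, 0 < δ → ∀ O ∈ 𝓝 P,
      (fun n => logRate (coverNumber hammingAvg δ (goodModels O (S.σ n)))
        (Fintype.card (S.V n))) = fun _ => (0 : EReal) := by
    intro δ hδ O hO
    funext n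
    rw [hgood O hO, coverNumber_eq_one hδ, logRate_one]
  unfold SoficApproximation.processEntropy SoficApproximation.processLowerEntropy
  constructor
  · refine le_antisymm (iSup₂_le fun δ hδ => (iInf₂_le univ univ_mem).trans ?_)
      (le_iSup₂_of_le 1 one_pos (le_iInf₂ fun O hO => ?_))
    · rw [hrate δ hδ _ univ_mem, limsup_const]
    · rw [hrate 1 one_pos O hO, limsup_const]
  · refine le_antisymm (iSup₂_le fun δ hδ => (iInf₂_le univ univ_mem).trans ?_)
      (le_iSup₂_of_le 1 one_pos (le_iInf₂ fun O hO => ?_))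
    · rw [hrate δ hδ _ univ_mem, liminf_const]
    · rw [hrate 1 one_pos O hO, liminf_const]

end Trivial

/-! ### Conditioning on initial segments of finite tuples -/

section Tuples

open Classical in
/-- The tuples in `Θ` that agree with `x` on the first `j` coordinates. -/
noncomputable def agreeing {k : ℕ} {M : Type*} (Θ : Finset (Fin k → M)) (j : ℕ)
    (x : Fin k → M) : Finset (Fin k → M) :=
  Θ.filter fun x' => ∀ i : Fin k, (i : ℕ) < j → x' i = x i

/-- The average over the tuples that agree with `x` on the first `j` coordinates. -/
noncomputable def condAvg {k : ℕ} {M E : Type*} [AddCommGroup E] [Module ℝ E]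
    (Θ : Finset (Fin k → M)) (j : ℕ) (f : (Fin k → M) → E) (x : Fin k → M) : E :=
  ((agreeing Θ j x).card : ℝ)⁻¹ • ∑ x' ∈ agreeing Θ j x, f x'

variable {k : ℕ} {M : Type*} {Θ : Finset (Fin k → M)} {j : ℕ}

theorem mem_agreeing {x x' : Fin k → M} :
    x' ∈ agreeing Θ j x ↔ x' ∈ Θ ∧ ∀ i : Fin k, (i : ℕ) < j → x' i = x i := by
  simp [agreeing]

theorem agreeing_self {x : Fin k → M} (hx : x ∈ Θ) : x ∈ agreeing Θ j x :=
  mem_agreeing.2 ⟨hx, fun _ _ => rfl⟩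

theorem agreeing_congr {x x' : Fin k → M} (h : x' ∈ agreeing Θ j x) :
    agreeing Θ j x' = agreeing Θ j x := by
  have h1 := (mem_agreeing.1 h).2
  ext z
  simp only [mem_agreeing]
  exact and_congr_right fun _ => forall₂_congr fun i hi => by rw [h1 i hi]

theorem agreeing_symm {x x' : Fin k → M} (hx : x ∈ Θ) (h : x' ∈ agreeing Θ j x) :
    x ∈ agreeing Θ j x' := by
  rw [agreeing_congr h]; exact agreeing_self hx

theorem agreeing_card_pos {x : Fin k → M} (hx : x ∈ Θ) : 0 < (agreeing Θ j x).card :=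
  Finset.card_pos.2 ⟨x, agreeing_self hx⟩

section Module

variable {E : Type*} [AddCommGroup E] [Module ℝ E]

theorem condAvg_congr (f : (Fin k → M) → E) {x x' : Fin k → M} (h : x' ∈ agreeing Θ j x) :
    condAvg Θ j f x' = condAvg Θ j f x := by
  unfold condAvg
  rw [agreeing_congr h]

theorem condAvg_of_const {f : (Fin k → M) → E} {x : Fin k → M} (hx : x ∈ Θ)
    (h : ∀ x' ∈ agreeing Θ j x, f x' = f x) : condAvg Θ j f x = f x := by
  unfold condAvg
  rw [Finset.sum_congr rfl h, Finset.sum_const, ← Nat.cast_smul_eq_nsmul ℝ, smul_smul,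
    inv_mul_cancel₀, one_smul]
  exact_mod_cast (agreeing_card_pos hx).ne'

/-- Agreement on the first `j` coordinates is an equivalence relation on `Θ`, and averaging over its
classes preserves the total. -/
theorem sum_condAvg (f : (Fin k → M) → E) : ∑ x ∈ Θ, condAvg Θ j f x = ∑ x ∈ Θ, f x := by
  classical
  unfold condAvg
  simp only [Finset.smul_sum]
  rw [Finset.sum_comm' (t' := Θ) (s' := fun x' => agreeing Θ j x')]
  · refine Finset.sum_congr rfl fun x' hx' => ?_
    rw [Finset.sum_congr rfl (g := fun _ => ((agreeing Θ j x').card : ℝ)⁻¹ • f x') fun x hx => by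
      rw [agreeing_congr hx]]
    rw [Finset.sum_const, ← Nat.cast_smul_eq_nsmul ℝ, smul_smul, mul_inv_cancel₀, one_smul]
    exact_mod_cast (agreeing_card_pos hx').ne'
  · intro x x'
    constructor
    · rintro ⟨hx, hx'⟩
      exact ⟨agreeing_symm hx hx', (mem_agreeing.1 hx').1⟩
    · rintro ⟨hx, hx'⟩
      exact ⟨(mem_agreeing.1 hx).1, agreeing_symm hx' hx⟩

/-- In a symmetric set, later coordinates have the same conditional averages. -/
theorem condAvg_swap (hsymm : ∀ x ∈ Θ, ∀ π : Equiv.Perm (Fin k), x ∘ π ∈ Θ) (N : M → E)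
    {a b : Fin k} (ha : j ≤ a) (hb : j ≤ b) (x : Fin k → M) :
    condAvg Θ j (fun x => N (x a)) x = condAvg Θ j (fun x => N (x b)) x := by
  classical
  unfold condAvg
  congr 1
  have key : ∀ x' ∈ agreeing Θ j x, x' ∘ Equiv.swap a b ∈ agreeing Θ j x := by
    intro x' hx'
    obtain ⟨h1, h2⟩ := mem_agreeing.1 hx'
    refine mem_agreeing.2 ⟨hsymm _ h1 _, fun i hi => ?_⟩
    rw [Function.comp, Equiv.swap_apply_of_ne_of_ne]
    · exact h2 i hi
    · rintro rfl; omega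
    · rintro rfl; omega
  refine Finset.sum_bij' (fun x' _ => x' ∘ Equiv.swap a b) (fun x' _ => x' ∘ Equiv.swap a b)
    key key ?_ ?_ ?_
  · intro x' _; ext i; simp
  · intro x' _; ext i; simp
  · intro x' _; simp

end Module

variable {E : Type*} [NormedAddCommGroup E] [InnerProductSpace ℝ E]

/-- Conditional averages are self-adjoint. -/
theorem sum_inner_condAvg (f g : (Fin k → M) → E) :
    ∑ x ∈ Θ, inner ℝ (f x) (condAvg Θ j g x) = ∑ x ∈ Θ, inner ℝ (condAvg Θ j f x) (g x) := by
  -- A conditional average is constant on classes, so the other factor may be averaged as well.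
  have h1 : ∀ f g : (Fin k → M) → E, ∑ x ∈ Θ, inner ℝ (condAvg Θ j f x) (g x) =
      ∑ x ∈ Θ, inner ℝ (condAvg Θ j f x) (condAvg Θ j g x) := by
    intro f g
    rw [← sum_condAvg (j := j) (fun x => inner ℝ (condAvg Θ j f x) (g x))]
    refine Finset.sum_congr rfl fun x _ => ?_
    unfold condAvg
    dsimp only
    rw [inner_smul_right, inner_sum, smul_eq_mul]
    congr 1
    refine Finset.sum_congr rfl fun x' hx' => ?_
    rw [agreeing_congr hx']
  rw [h1]
  simp only [fun x => real_inner_comm (condAvg Θ j g x) (f x)]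
  rw [h1]
  exact Finset.sum_congr rfl fun x _ => real_inner_comm _ _

/-- The energy of the conditional averages of the last coordinate. -/
theorem sum_norm_condAvg_le {n : ℕ} {Θ : Finset (Fin (n + 1) → M)}
    (hsymm : ∀ x ∈ Θ, ∀ π : Equiv.Perm (Fin (n + 1)), x ∘ π ∈ Θ) {N : M → E} {R ζ t : ℝ}
    (hR : ∀ a, ‖N a‖ ^ 2 ≤ R) (ht : 0 < t)
    (hζ : ∀ x ∈ Θ, ∀ i i', i ≠ i' → inner ℝ (N (x i)) (N (x i')) ≤ ζ) :
    ∑ j : Fin (n + 1), ∑ x ∈ Θ, ‖condAvg Θ j (fun x => N (x j)) x‖ ^ 2 ≤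
      Θ.card * (n * (ζ + t * R) + R / (4 * t) + R) := by
  set g : (Fin (n + 1) → M) → E := fun x => N (x (Fin.last n)) with hg
  -- By symmetry all coordinates from `j` on have the same conditional average as the last one. So
  -- the averages of `g` form a martingale in `j`, with energies `S j`.
  set S : ℕ → ℝ := fun j => ∑ x ∈ Θ, ‖condAvg Θ j g x‖ ^ 2 with hS
  have hSg : ∀ j, S j = ∑ x ∈ Θ, inner ℝ (condAvg Θ j g x) (g x) := by
    intro j
    have h1 := sum_inner_condAvg (Θ := Θ) (j := j) (condAvg Θ j g) g
    rw [hS]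
    simp only [← real_inner_self_eq_norm_sq]
    rw [h1]
    refine Finset.sum_congr rfl fun x hx => ?_
    rw [condAvg_of_const hx fun x' hx' => condAvg_congr g hx']
  have hswap : ∀ j : Fin (n + 1), ∀ x, condAvg Θ j (fun x => N (x j)) x = condAvg Θ j g x :=
    fun j x => condAvg_swap hsymm N le_rfl (by simpa using Nat.lt_succ_iff.1 j.2) x
  have hcross : ∀ j, ∑ x ∈ Θ, inner ℝ (condAvg Θ j g x) (condAvg Θ (j + 1) g x) = S j := by
    intro j
    rw [sum_inner_condAvg, hSg]
    refine Finset.sum_congr rfl fun x hx => ?_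
    rw [condAvg_of_const hx fun x' hx' => ?_]
    refine condAvg_congr g (mem_agreeing.2 ⟨(mem_agreeing.1 hx').1, fun i hi => ?_⟩)
    exact (mem_agreeing.1 hx').2 i (by omega)
  -- Martingale increments are orthogonal to the past, so their squared norms are the increases of
  -- the energy and will telescope.
  have hdiff : ∀ j, ∑ x ∈ Θ, ‖condAvg Θ (j + 1) g x - condAvg Θ j g x‖ ^ 2 = S (j + 1) - S j := by
    intro j
    simp only [norm_sub_sq_real, Finset.sum_add_distrib, Finset.sum_sub_distrib, ← Finset.mul_sum]
    simp only [fun x => real_inner_comm (condAvg Θ j g x) (condAvg Θ (j + 1) g x)]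
    rw [hcross]
    change S (j + 1) - 2 * S j + S j = _
    ring
  -- Against `N (x j)`, the average of `g` given the first `j` coordinates contributes `S j` in
  -- total. Given one more coordinate `x j` is known, and the contribution is at most `ζ` per tuple.
  -- The difference is an increment, split by `a * b ≤ t * a ^ 2 + b ^ 2 / (4 * t)`.
  have hstep : ∀ j < n, S j ≤ Θ.card * (ζ + t * R) + (S (j + 1) - S j) / (4 * t) := by
    intro j hj
    set jf : Fin (n + 1) := ⟨j, by omega⟩ with hjf
    have h1 : ∑ x ∈ Θ, inner ℝ (N (x jf)) (condAvg Θ j g x) = S j := by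
      rw [sum_inner_condAvg, hSg]
      exact Finset.sum_congr rfl fun x _ => by rw [← hswap jf x]
    have h2 : ∑ x ∈ Θ, inner ℝ (N (x jf)) (condAvg Θ (j + 1) g x) ≤ Θ.card * ζ := by
      rw [sum_inner_condAvg]
      rw [← nsmul_eq_mul]
      refine Finset.sum_le_card_nsmul _ _ _ fun x hx => ?_
      rw [condAvg_of_const hx fun x' hx' => by
        rw [(mem_agreeing.1 hx').2 jf (by simp [hjf])]]
      refine hζ x hx _ _ fun h => ?_
      have := congrArg Fin.val h
      simp [hjf] at this
      omega
    have h3 : -∑ x ∈ Θ, inner ℝ (N (x jf)) (condAvg Θ (j + 1) g x - condAvg Θ j g x) ≤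
        Θ.card * (t * R) + (S (j + 1) - S j) / (4 * t) := by
      rw [← hdiff, Finset.sum_div, ← Finset.sum_neg_distrib, ← nsmul_eq_mul,
        ← Finset.sum_const, ← Finset.sum_add_distrib]
      refine Finset.sum_le_sum fun x _ => ?_
      set D := condAvg Θ (j + 1) g x - condAvg Θ j g x
      have i1 : -inner ℝ (N (x jf)) D ≤ ‖N (x jf)‖ * ‖D‖ :=
        (neg_le_abs _).trans (abs_real_inner_le_norm _ _)
      have i2 : ‖N (x jf)‖ * ‖D‖ ≤ t * ‖N (x jf)‖ ^ 2 + ‖D‖ ^ 2 / (4 * t) := by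
        have : t * ‖N (x jf)‖ ^ 2 + ‖D‖ ^ 2 / (4 * t) - ‖N (x jf)‖ * ‖D‖ =
            (2 * t * ‖N (x jf)‖ - ‖D‖) ^ 2 / (4 * t) := by
          field_simp; ring
        have h0 : 0 ≤ (2 * t * ‖N (x jf)‖ - ‖D‖) ^ 2 / (4 * t) := by positivity
        linarith
      have i3 := mul_le_mul_of_nonneg_left (hR (x jf)) ht.le
      linarith
    have h4 : ∑ x ∈ Θ, inner ℝ (N (x jf)) (condAvg Θ (j + 1) g x - condAvg Θ j g x) =
        ∑ x ∈ Θ, inner ℝ (N (x jf)) (condAvg Θ (j + 1) g x) - S j := by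
      rw [← h1, ← Finset.sum_sub_distrib]
      exact Finset.sum_congr rfl fun x _ => inner_sub_right _ _ _
    linarith
  have hlast : ∀ j, S j ≤ Θ.card * R := by
    intro j
    have h0 : ∑ x ∈ Θ, ‖g x - condAvg Θ j g x‖ ^ 2 = ∑ x ∈ Θ, ‖g x‖ ^ 2 - S j := by
      simp only [norm_sub_sq_real, Finset.sum_add_distrib, Finset.sum_sub_distrib,
        ← Finset.mul_sum]
      simp only [fun x => real_inner_comm (condAvg Θ j g x) (g x)]
      rw [← hSg]
      change _ - 2 * S j + S j = _
      ring
    have h1 : ∑ x ∈ Θ, ‖g x‖ ^ 2 ≤ Θ.card * R := by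
      rw [← nsmul_eq_mul]
      exact Finset.sum_le_card_nsmul _ _ _ fun x _ => hR _
    have h2 : 0 ≤ ∑ x ∈ Θ, ‖g x - condAvg Θ j g x‖ ^ 2 :=
      Finset.sum_nonneg fun x _ => by positivity
    linarith
  have hsum : ∑ j ∈ Finset.range n, S j ≤
      n * (Θ.card * (ζ + t * R)) + (S n - S 0) / (4 * t) := by
    calc ∑ j ∈ Finset.range n, S j
        ≤ ∑ j ∈ Finset.range n, (Θ.card * (ζ + t * R) + (S (j + 1) - S j) / (4 * t)) :=
          Finset.sum_le_sum fun j hj => hstep j (Finset.mem_range.1 hj)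
      _ = _ := by
        rw [Finset.sum_add_distrib, ← Finset.sum_div, Finset.sum_range_sub]
        simp
  have hS0 : 0 ≤ S 0 := Finset.sum_nonneg fun x _ => by positivity
  have hfin : ∑ j : Fin (n + 1), ∑ x ∈ Θ, ‖condAvg Θ j (fun x => N (x j)) x‖ ^ 2 =
      ∑ j ∈ Finset.range (n + 1), S j := by
    rw [← Fin.sum_univ_eq_sum_range]
    exact Finset.sum_congr rfl fun j _ => Finset.sum_congr rfl fun x _ => by rw [hswap]
  rw [hfin, Finset.sum_range_succ]
  have h5 : (S n - S 0) / (4 * t) ≤ Θ.card * R / (4 * t) := by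
    gcongr
    linarith [hlast n]
  calc _ ≤ n * (Θ.card * (ζ + t * R)) + Θ.card * R / (4 * t) + Θ.card * R := by
        linarith [hlast n]
    _ = _ := by ring

/-- The law of the coordinate `j` of a random tuple which agrees with `x` before `j`. -/
noncomputable def condLaw [DecidableEq M] (Θ : Finset (Fin k → M)) (j : Fin k) (x : Fin k → M)
    (a : M) : ℝ :=
  (((agreeing Θ j x).filter fun x' => x' j = a).card : ℝ) / (agreeing Θ j x).card

theorem condLaw_nonneg [DecidableEq M] (j : Fin k) (x : Fin k → M) (a : M) :
    0 ≤ condLaw Θ j x a := by unfold condLaw; positivity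

theorem sum_condLaw_smul [DecidableEq M] [Fintype M] {E : Type*} [AddCommGroup E] [Module ℝ E]
    (j : Fin k) (x : Fin k → M) (N : M → E) :
    ∑ a, condLaw Θ j x a • N a = condAvg Θ j (fun x => N (x j)) x := by
  unfold condLaw condAvg
  rw [← Finset.sum_fiberwise (agreeing Θ j x) (fun x' => x' j), Finset.smul_sum]
  refine Finset.sum_congr rfl fun a _ => ?_
  rw [Finset.sum_congr rfl (g := fun _ => N a) fun x' hx' => by rw [(Finset.mem_filter.1 hx').2],
    Finset.sum_const, ← Nat.cast_smul_eq_nsmul ℝ, smul_smul, div_eq_inv_mul]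

theorem sum_condLaw [DecidableEq M] [Fintype M] (j : Fin k) {x : Fin k → M} (hx : x ∈ Θ) :
    ∑ a, condLaw Θ j x a = 1 := by
  have := sum_condLaw_smul (Θ := Θ) j x (fun _ => (1 : ℝ))
  simp only [smul_eq_mul, mul_one] at this
  rw [this, condAvg_of_const hx fun _ _ => rfl]

/-- Fixing the coordinate `j` as well leads to the next smaller class. The logarithms of these
ratios telescope in the chain rule. -/
theorem condLaw_self [DecidableEq M] (j : Fin k) (x : Fin k → M) :
    condLaw Θ j x (x j) = ((agreeing Θ (j + 1) x).card : ℝ) / (agreeing Θ j x).card := by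
  unfold condLaw
  congr 3
  ext z
  simp only [Finset.mem_filter, mem_agreeing, and_assoc]
  refine and_congr_right fun _ => ?_
  constructor
  · rintro ⟨h1, h2⟩ i hi
    rcases Nat.lt_succ_iff_lt_or_eq.1 hi with h | h
    · exact h1 i h
    · rw [Fin.ext h]; exact h2
  · intro h
    exact ⟨fun i hi => h i (by omega), h j (by omega)⟩

theorem condLaw_congr [DecidableEq M] {j : Fin k} {x x' : Fin k → M}
    (h : x' ∈ agreeing Θ j x) (a : M) : condLaw Θ j x' a = condLaw Θ j x a := by
  unfold condLaw
  rw [agreeing_congr h]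

/-- The chain rule for the entropy of a uniformly random tuple. -/
theorem sum_entropy_condLaw [DecidableEq M] [Fintype M] (Θ : Finset (Fin k → M)) :
    ∑ j : Fin k, ∑ x ∈ Θ, ∑ a, Real.negMulLog (condLaw Θ j x a) =
      Θ.card * Real.log Θ.card := by
  have h1 : ∀ j : Fin k, ∑ x ∈ Θ, ∑ a, Real.negMulLog (condLaw Θ j x a) =
      ∑ x ∈ Θ, (Real.log (agreeing Θ j x).card - Real.log (agreeing Θ (j + 1) x).card) := by
    intro j
    rw [← sum_condAvg (j := (j : ℕ)) (fun x => Real.log (agreeing Θ j x).card -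
      Real.log (agreeing Θ (j + 1) x).card)]
    refine Finset.sum_congr rfl fun x hx => ?_
    -- The entropy of a conditional law is the conditional average of minus the logarithm of the
    -- probability of the actual coordinate.
    have h2 := sum_condLaw_smul (Θ := Θ) j x (fun a => -Real.log (condLaw Θ j x a))
    have h3 : ∑ a, Real.negMulLog (condLaw Θ j x a) =
        ∑ a, condLaw Θ j x a • -Real.log (condLaw Θ j x a) :=
      Finset.sum_congr rfl fun a _ => by simp [Real.negMulLog]
    rw [h3, h2]
    unfold condAvg
    congr 1
    refine Finset.sum_congr rfl fun x' hx' => ?_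
    have hx'Θ := (mem_agreeing.1 hx').1
    dsimp only
    rw [← condLaw_congr hx', condLaw_self, Real.log_div, neg_sub]
    · exact_mod_cast (agreeing_card_pos hx'Θ).ne'
    · exact_mod_cast (agreeing_card_pos hx'Θ).ne'
  rw [Finset.sum_congr rfl fun j _ => h1 j, Finset.sum_comm]
  have h4 : ∀ x ∈ Θ, ∑ j : Fin k, (Real.log (agreeing Θ j x).card -
      Real.log (agreeing Θ (j + 1) x).card) = Real.log Θ.card := by
    intro x hx
    rw [Fin.sum_univ_eq_sum_range (fun j => Real.log (agreeing Θ j x).card -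
      Real.log (agreeing Θ (j + 1) x).card), Finset.sum_range_sub']
    have e1 : agreeing Θ 0 x = Θ := by ext z; simp [mem_agreeing]
    have e2 : agreeing Θ k x = {x} := by
      ext z
      simp only [mem_agreeing, Finset.mem_singleton]
      constructor
      · rintro ⟨-, h⟩; exact funext fun i => h i i.2
      · rintro rfl; exact ⟨hx, fun _ _ => rfl⟩
    rw [e1, e2]
    simp
  rw [Finset.sum_congr rfl h4]
  simp

/-- Among the conditional laws of the coordinates of a random element of a large symmetric set of
tuples with nearly orthogonal coordinates there is one which has large entropy and whose
barycentre is small. -/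
theorem exists_condLaw {n : ℕ} [Fintype M] {Θ : Finset (Fin (n + 1) → M)} (hne : Θ.Nonempty)
    (hsymm : ∀ x ∈ Θ, ∀ π : Equiv.Perm (Fin (n + 1)), x ∘ π ∈ Θ) {N : M → E} {R ζ t l : ℝ}
    (hR : ∀ a, ‖N a‖ ^ 2 ≤ R) (ht : 0 < t) (hl : 0 ≤ l)
    (hζ : ∀ x ∈ Θ, ∀ i i', i ≠ i' → inner ℝ (N (x i)) (N (x i')) ≤ ζ) :
    ∃ w : M → ℝ, (∀ a, 0 ≤ w a) ∧ ∑ a, w a = 1 ∧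
      (Real.log Θ.card - l * (n * (ζ + t * R) + R / (4 * t) + R)) / (n + 1) ≤
        ∑ a, Real.negMulLog (w a) - l * ‖∑ a, w a • N a‖ ^ 2 := by
  classical
  -- The multiplier `l` puts entropy and energy into one quantity. If every conditional law fell
  -- short, summing over all `j` and `x` would contradict the chain rule together with the energy
  -- bound.
  by_contra! hcon
  set c := (Real.log Θ.card - l * (n * (ζ + t * R) + R / (4 * t) + R)) / (n + 1) with hc
  have h1 : ∑ j : Fin (n + 1), ∑ x ∈ Θ, (∑ a, Real.negMulLog (condLaw Θ j x a) -
      l * ‖condAvg Θ j (fun x => N (x j)) x‖ ^ 2) < ∑ _j : Fin (n + 1), ∑ _x ∈ Θ, c := by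
    refine Finset.sum_lt_sum_of_nonempty Finset.univ_nonempty fun j _ =>
      Finset.sum_lt_sum_of_nonempty hne fun x hx => ?_
    have := hcon (condLaw Θ j x) (condLaw_nonneg j x) (sum_condLaw j hx)
    rwa [sum_condLaw_smul] at this
  simp only [Finset.sum_sub_distrib, ← Finset.mul_sum] at h1
  rw [sum_entropy_condLaw] at h1
  have h2 := mul_le_mul_of_nonneg_left (sum_norm_condAvg_le hsymm hR ht hζ) hl
  simp only [Finset.sum_const, Finset.card_univ, Fintype.card_fin, nsmul_eq_mul] at h1
  have h3 : ((n + 1 : ℕ) : ℝ) * (Θ.card * c) =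
      Θ.card * (Real.log Θ.card - l * (n * (ζ + t * R) + R / (4 * t) + R)) := by
    rw [hc]; push_cast; field_simp
  rw [h3] at h1
  linarith

end Tuples

/-! ### Entropy of finite weights -/

section Entropy

variable {M : Type*} [Fintype M]

/-- Gibbs' inequality. -/
theorem sum_negMulLog_le {w q : M → ℝ} (hw : ∀ a, 0 ≤ w a) (hw1 : ∑ a, w a = 1)
    (hq : ∀ a, 0 < q a) (hq1 : ∑ a, q a ≤ 1) :
    ∑ a, Real.negMulLog (w a) ≤ ∑ a, w a * -Real.log (q a) := by
  have h : ∀ a, Real.negMulLog (w a) ≤ w a * -Real.log (q a) + (q a - w a) := by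
    intro a
    rcases (hw a).eq_or_lt with h0 | h0
    · rw [← h0]; simpa using (hq a).le
    · have h1 := Real.log_le_sub_one_of_pos (div_pos (hq a) h0)
      rw [Real.log_div (hq a).ne' h0.ne'] at h1
      have h2 := mul_le_mul_of_nonneg_left h1 h0.le
      have h3 : w a * (q a / w a - 1) = q a - w a := by field_simp
      rw [h3] at h2
      simp only [Real.negMulLog]
      linarith
  have := Finset.sum_le_sum fun a (_ : a ∈ Finset.univ) => h a
  rw [Finset.sum_add_distrib, Finset.sum_sub_distrib] at this
  linarith

theorem sum_negMulLog_le_log_card [Nonempty M] {w : M → ℝ} (hw : ∀ a, 0 ≤ w a)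
    (hw1 : ∑ a, w a = 1) : ∑ a, Real.negMulLog (w a) ≤ Real.log (Fintype.card M) := by
  refine (sum_negMulLog_le hw hw1 (q := fun _ => (Fintype.card M : ℝ)⁻¹)
    (fun _ => by positivity) ?_).trans ?_
  · simp
  · rw [← Finset.sum_mul, hw1, Real.log_inv]
    simp

/-- Weights mostly supported on a small set have small entropy. -/
theorem sum_negMulLog_le_of_mem {w : M → ℝ} (hw : ∀ a, 0 ≤ w a) (hw1 : ∑ a, w a = 1)
    {E : Finset M} (hE : E.Nonempty) {ε τ : ℝ} (hτ0 : 0 < τ) (hτ1 : τ < 1)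
    (h : 1 - ε ≤ ∑ a ∈ E, w a) :
    ∑ a, Real.negMulLog (w a) ≤
      Real.log E.card - Real.log (1 - τ) + ε * (Real.log (Fintype.card M) - Real.log τ) := by
  classical
  have hM : Nonempty M := ⟨hE.choose⟩
  have hEc : (0 : ℝ) < E.card := by exact_mod_cast hE.card_pos
  have hMc : (0 : ℝ) < Fintype.card M := by positivity
  have hM1 : (1 : ℝ) ≤ Fintype.card M := by exact_mod_cast Fintype.card_pos (α := M)
  have hE1 : (1 : ℝ) ≤ E.card := by exact_mod_cast hE.card_pos
  have h1τ : 0 < 1 - τ := by linarith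
  -- Gibbs' inequality is applied against mass `1 - τ` spread over `E` plus mass `τ` spread over
  -- everything; the second part keeps all weights positive.
  set q : M → ℝ := fun a => (if a ∈ E then (1 - τ) / E.card else 0) + τ / Fintype.card M with hq
  have hif : ∀ a, 0 ≤ if a ∈ E then (1 - τ) / (E.card : ℝ) else 0 := fun a => by
    split_ifs
    · positivity
    · exact le_rfl
  have hqpos : ∀ a, 0 < q a := fun a => add_pos_of_nonneg_of_pos (hif a) (by positivity)
  have hqsum : ∑ a, q a ≤ 1 := by
    rw [hq, Finset.sum_add_distrib, Finset.sum_ite_mem, Finset.univ_inter]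
    simp only [Finset.sum_const, nsmul_eq_mul, Finset.card_univ]
    rw [mul_div_cancel₀ _ hEc.ne', mul_div_cancel₀ _ hMc.ne']
    linarith
  refine (sum_negMulLog_le hw hw1 hqpos hqsum).trans ?_
  have hb : ∀ a, w a * -Real.log (q a) ≤ w a * (Real.log E.card - Real.log (1 - τ)) +
      (if a ∈ E then 0 else w a) * (Real.log (Fintype.card M) - Real.log τ) := by
    intro a
    have hl1 : 0 ≤ Real.log E.card := Real.log_nonneg hE1
    have hl2 : Real.log (1 - τ) ≤ 0 := Real.log_nonpos h1τ.le (by linarith)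
    by_cases ha : a ∈ E
    · simp only [ha, if_true, zero_mul, add_zero]
      refine mul_le_mul_of_nonneg_left ?_ (hw a)
      have : Real.log ((1 - τ) / E.card) ≤ Real.log (q a) := by
        refine Real.log_le_log (by positivity) ?_
        simp only [hq, ha, if_true]
        have : 0 < τ / Fintype.card M := by positivity
        linarith
      rw [Real.log_div h1τ.ne' hEc.ne'] at this
      linarith
    · simp only [ha, if_false]
      rw [← mul_add]
      refine mul_le_mul_of_nonneg_left ?_ (hw a)
      have : Real.log (τ / Fintype.card M) ≤ Real.log (q a) := by
        refine Real.log_le_log (by positivity) ?_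
        simp [hq, ha]
      rw [Real.log_div hτ0.ne' hMc.ne'] at this
      linarith
  refine (Finset.sum_le_sum fun a _ => hb a).trans ?_
  rw [Finset.sum_add_distrib, ← Finset.sum_mul, ← Finset.sum_mul, hw1, one_mul]
  have h2 : ∑ a, (if a ∈ E then 0 else w a) ≤ ε := by
    have h3 : ∑ a, (if a ∈ E then 0 else w a) = ∑ a, w a - ∑ a ∈ E, w a := by
      rw [← Finset.sum_ite_mem_eq E w, ← Finset.sum_sub_distrib]
      exact Finset.sum_congr rfl fun a _ => by split_ifs <;> simp
    linarith
  have h4 : 0 ≤ Real.log (Fintype.card M) - Real.log τ := by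
    have := Real.log_nonneg hM1
    have := Real.log_nonpos hτ0.le hτ1.le
    linarith
  gcongr

end Entropy

/-! ### Hamming balls -/

section Ball

/-- Hamming balls of small radius contain few words. -/
theorem exists_ball_bound (T : Type*) [Fintype T] {a : ℝ} (ha : 0 < a) :
    ∃ δ : ℝ, 0 < δ ∧ ∀ (V : Type) [Fintype V] [Nonempty V] (y : V → T) (s : Finset (V → T)),
      (∀ x ∈ s, freq {v | y v ≠ x v} ≤ δ) → (s.card : ℝ) ≤ Real.exp (a * Fintype.card V) := by
  classical
  set r : ℝ := ((Fintype.card T : ℕ) : ℝ)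
  have hr : 0 ≤ r := Nat.cast_nonneg _
  -- Each disagreement with `y` is charged a factor `exp (-t)`, with `t` so large that all words
  -- together weigh at most `exp (a / 2 * |V|)`. Every word of the ball weighs at least `exp (-(a /
  -- 2) * |V|)`.
  set t : ℝ := Real.log (2 * r / a + 2) with ht
  have ht0 : 0 < t := Real.log_pos (by have : 0 ≤ 2 * r / a := by positivity
                                       linarith)
  have hrt : r * Real.exp (-t) ≤ a / 2 := by
    rw [ht, Real.exp_neg, Real.exp_log (by positivity), ← div_eq_mul_inv,
      div_le_iff₀ (by positivity)]
    have : a / 2 * (2 * r / a + 2) = r + a := by field_simp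
    linarith
  refine ⟨a / (2 * t), by positivity, fun V _ _ y s hs => ?_⟩
  have hV : (0 : ℝ) < Fintype.card V := by positivity
  set b : V → T → ℝ := fun v x => if y v = x then 1 else Real.exp (-t) with hb
  have h1 : ∑ x : V → T, ∏ v, b v (x v) = ∏ v, ∑ x, b v x := by
    rw [Finset.prod_univ_sum, Fintype.piFinset_univ]
  have h2 : ∏ v, ∑ x, b v x ≤ Real.exp (a / 2) ^ Fintype.card V := by
    rw [← Finset.card_univ, ← Finset.prod_const]
    refine Finset.prod_le_prod (fun v _ => Finset.sum_nonneg fun x _ => ?_) fun v _ => ?_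
    · simp only [hb]; split_ifs <;> positivity
    · have : ∑ x, b v x ≤ 1 + r * Real.exp (-t) := by
        calc ∑ x, b v x ≤ ∑ x, ((if y v = x then 1 else 0) + Real.exp (-t)) := by
              refine Finset.sum_le_sum fun x _ => ?_
              simp only [hb]
              split_ifs
              · have := Real.exp_pos (-t); linarith
              · simp
          _ = _ := by rw [Finset.sum_add_distrib]; simp [r]
      have h3 := Real.add_one_le_exp (a / 2)
      linarith
  have h3 : ∀ x ∈ s, Real.exp (-(a / 2) * Fintype.card V) ≤ ∏ v, b v (x v) := by
    intro x hx
    have h4 : ∏ v, b v (x v) = Real.exp (-t * (freq {v | y v ≠ x v} * Fintype.card V)) := by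
      rw [freq_eq_sum, div_mul_cancel₀ _ hV.ne', Finset.mul_sum, Real.exp_sum]
      refine Finset.prod_congr rfl fun v _ => ?_
      by_cases h : y v = x v <;> simp [hb, h]
    rw [h4]
    refine Real.exp_le_exp.2 ?_
    have h5 := mul_le_mul_of_nonneg_right (hs x hx) hV.le
    have h6 := mul_le_mul_of_nonneg_left h5 ht0.le
    have h7 : t * (a / (2 * t) * Fintype.card V) = a / 2 * Fintype.card V := by field_simp
    linarith
  have h4 : (s.card : ℝ) * Real.exp (-(a / 2) * Fintype.card V) ≤
      Real.exp (a / 2) ^ Fintype.card V := by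
    rw [← nsmul_eq_mul]
    refine (Finset.card_nsmul_le_sum _ _ _ h3).trans ?_
    refine (Finset.sum_le_univ_sum_of_nonneg fun x => Finset.prod_nonneg fun v _ => ?_).trans
      (h1.le.trans h2)
    simp only [hb]; split_ifs <;> positivity
  rw [← Real.exp_nat_mul, ← le_div_iff₀ (Real.exp_pos _), ← Real.exp_sub] at h4
  refine h4.trans (le_of_eq ?_)
  congr 1
  ring

/-- Weights of large entropy cannot be concentrated on few small Hamming balls. -/
theorem exists_packing_bound (T : Type*) [Fintype T] {c c' : ℝ} (hc : c' < c) :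
    ∃ ε δ : ℝ, 0 < ε ∧ 0 < δ ∧ ∀ (V : Type) [Fintype V] [Nonempty V] [DecidableEq V]
      (w : (V → T) → ℝ),
      (∀ a, 0 ≤ w a) → ∑ a, w a = 1 → c * Fintype.card V ≤ ∑ a, Real.negMulLog (w a) →
      ∀ (E : Finset (V → T)) {ι : Type w} [Fintype ι] (f : (V → T) → ι), 1 - ε ≤ ∑ a ∈ E, w a →
        (∀ x ∈ E, ∀ x' ∈ E, f x = f x' → freq {v | x v ≠ x' v} ≤ δ) →
        Real.exp (c' * Fintype.card V) ≤ Fintype.card ι := by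
  classical
  -- A third of the gap each for `log (1 - τ)`, for the mass outside `E` and for the size of a
  -- Hamming ball.
  set a : ℝ := (c - c') / 3 with ha
  have ha0 : 0 < a := by rw [ha]; linarith
  obtain ⟨δ, hδ, hball⟩ := exists_ball_bound T ha0
  set τ : ℝ := 1 - Real.exp (-a) with hτ
  have hτ1 : τ < 1 := by rw [hτ]; have := Real.exp_pos (-a); linarith
  have hτ0 : 0 < τ := by rw [hτ]; have := Real.exp_lt_exp.2 (show -a < 0 by linarith); rw [Real.exp_zero] at this; linarith
  set L : ℝ := |Real.log (Fintype.card T)| + |Real.log τ| + 1 with hL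
  have hL0 : 0 < L := by positivity
  refine ⟨min (1 / 2) (a / L), δ, by positivity, hδ,
    fun V _ _ _ w hw hw1 hH E ι _ f hE hf => ?_⟩
  set ε := min (1 / 2) (a / L)
  have hε : 0 ≤ ε := by positivity
  have hV1 : (1 : ℝ) ≤ Fintype.card V := by exact_mod_cast Fintype.card_pos (α := V)
  have hEne : E.Nonempty := by
    rw [Finset.nonempty_iff_ne_empty]
    rintro rfl
    have : ε ≤ 1 / 2 := min_le_left _ _
    simp only [Finset.sum_empty] at hE
    linarith
  have h1 := sum_negMulLog_le_of_mem hw hw1 hEne hτ0 hτ1 hE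
  have h2 : Real.log (1 - τ) = -a := by rw [hτ, sub_sub_cancel, Real.log_exp]
  have h3 : Real.log (Fintype.card (V → T)) = Fintype.card V * Real.log (Fintype.card T) := by
    rw [Fintype.card_fun, Nat.cast_pow, Real.log_pow]
  have h4 : ε * (Real.log (Fintype.card (V → T)) - Real.log τ) ≤ a * Fintype.card V := by
    have h5 : Real.log (Fintype.card (V → T)) - Real.log τ ≤ L * Fintype.card V := by
      rw [h3, hL]
      have e1 := le_abs_self (Real.log (Fintype.card T))
      have e2 := neg_abs_le (Real.log τ)
      have e3 := abs_nonneg (Real.log τ)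
      nlinarith
    calc _ ≤ ε * (L * Fintype.card V) := by gcongr
      _ ≤ a / L * (L * Fintype.card V) := by gcongr; exact min_le_right _ _
      _ = _ := by field_simp
  have h6 : (c - 2 * a) * Fintype.card V ≤ Real.log E.card := by
    rw [h2] at h1
    nlinarith
  have h7 : Real.exp ((c - 2 * a) * Fintype.card V) ≤ E.card := by
    rwa [Real.le_log_iff_exp_le (by exact_mod_cast hEne.card_pos)] at h6
  have h8 : (E.card : ℝ) ≤ Fintype.card ι * Real.exp (a * Fintype.card V) := by
    rw [Finset.card_eq_sum_card_fiberwise (f := f) (t := Finset.univ) (fun x _ => by simp)]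
    push_cast
    rw [← Finset.card_univ, ← nsmul_eq_mul]
    refine Finset.sum_le_card_nsmul _ _ _ fun i _ => ?_
    rcases (E.filter fun x => f x = i).eq_empty_or_nonempty with h0 | ⟨y, hy⟩
    · rw [h0]; simpa using (Real.exp_pos _).le
    · refine hball V y _ fun x hx => ?_
      rw [Finset.mem_filter] at hx hy
      exact hf y hy.1 x hx.1 (by rw [hx.2, hy.2])
  have h9 := h7.trans h8
  rw [← div_le_iff₀ (Real.exp_pos _), ← Real.exp_sub] at h9
  refine le_trans (le_of_eq ?_) h9
  congr 1
  rw [ha]; ring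

end Ball

/-! ### The energy of a law on models -/

section Energy

variable {G : Type*} {A T : Type*} [MeasurableSpace A] [Fintype T]

/-- The total squared correlation of the patterns of two words. -/
noncomputable def patternEnergy {V : Type*} [Fintype V] (P : ProbabilityMeasure (G → A))
    (φ : A → T) (F : Finset G) (σ : G → Equiv.Perm V) (x x' : V → T) : ℝ := by
  classical
  exact ∑ p : F → T, ∑ q : F → T, vip (centred P φ F σ p x) (centred P φ F σ q x') ^ 2

/-- The correlation matrix of a word, as a vector. -/
noncomputable def patternFeature {V : Type*} [Fintype V] (P : ProbabilityMeasure (G → A))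
    (φ : A → T) (F : Finset G) (σ : G → Equiv.Perm V) (x : V → T) : EuclideanSpace ℝ (V × V) := by
  classical
  exact WithLp.toLp 2 fun i => (∑ p : F → T, centred P φ F σ p x i.1 * centred P φ F σ p x i.2) /
    Fintype.card V

variable {V : Type*} [Fintype V] {P : ProbabilityMeasure (G → A)}
    {φ : A → T} {F : Finset G} {σ : G → Equiv.Perm V}

/-- Frees the sums from the decidability instance fixed in the definition. -/
theorem patternEnergy_eq [DecidableEq F] (x x' : V → T) : patternEnergy P φ F σ x x' =
    ∑ p : F → T, ∑ q : F → T, vip (centred P φ F σ p x) (centred P φ F σ q x') ^ 2 := by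
  unfold patternEnergy
  congr!

/-- The feature is the sum of `f ⊗ f` over the centred indicators `f`, and the inner product of `f ⊗
f` with `g ⊗ g` is the square of that of `f` with `g`. So a sum of squared correlations becomes one
inner product, and the energy of a law is the squared norm of its barycentre. -/
theorem inner_patternFeature (x x' : V → T) :
    inner ℝ (patternFeature P φ F σ x) (patternFeature P φ F σ x') =
      patternEnergy P φ F σ x x' := by
  classical
  rw [patternEnergy_eq]
  unfold patternFeature vip
  simp only [PiLp.inner_apply, RCLike.inner_apply, conj_trivial, Fintype.sum_prod_type]
  simp only [div_mul_div_comm, div_pow, ← Finset.sum_div, sq (Fintype.card V : ℝ)]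
  congr 1
  simp only [sq, Finset.sum_mul_sum]
  have h : ∀ a b : V, ∑ i : F → T, ∑ j : F → T, (centred P φ F σ i x' a * centred P φ F σ i x' b) *
      (centred P φ F σ j x a * centred P φ F σ j x b) = ∑ j : F → T, ∑ i : F → T,
      (centred P φ F σ j x a * centred P φ F σ i x' a) *
      (centred P φ F σ j x b * centred P φ F σ i x' b) := by
    intro a b
    rw [Finset.sum_comm]
    exact Finset.sum_congr rfl fun j _ => Finset.sum_congr rfl fun i _ => by ring
  calc _ = ∑ a, ∑ b, ∑ j : F → T, ∑ i : F → T,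
      (centred P φ F σ j x a * centred P φ F σ i x' a) *
      (centred P φ F σ j x b * centred P φ F σ i x' b) :=
        Finset.sum_congr rfl fun a _ => Finset.sum_congr rfl fun b _ => by
          rw [← h]
    _ = ∑ j : F → T, ∑ i : F → T, ∑ a, ∑ b,
      (centred P φ F σ j x a * centred P φ F σ i x' a) *
      (centred P φ F σ j x b * centred P φ F σ i x' b) := by
        simp only [Finset.sum_comm (s := (Finset.univ : Finset V))
          (t := (Finset.univ : Finset (F → T)))]

theorem patternEnergy_nonneg (x x' : V → T) : 0 ≤ patternEnergy P φ F σ x x' := by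
  classical
  rw [patternEnergy_eq]
  exact Finset.sum_nonneg fun _ _ => Finset.sum_nonneg fun _ _ => sq_nonneg _

theorem patternEnergy_le (x x' : V → T) {a : ℝ}
    (h : ∀ p q, |vip (centred P φ F σ p x) (centred P φ F σ q x')| ≤ a) :
    patternEnergy P φ F σ x x' ≤ (Nat.card (F → T) : ℝ) ^ 2 * a ^ 2 := by
  classical
  rw [patternEnergy_eq]
  calc _ ≤ ∑ _p : F → T, ∑ _q : F → T, a ^ 2 :=
        Finset.sum_le_sum fun p _ => Finset.sum_le_sum fun q _ =>
          sq_le_sq' (by linarith [(abs_le.1 (h p q)).1]) (abs_le.1 (h p q)).2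
    _ = _ := by simp only [Finset.sum_const, Finset.card_univ, nsmul_eq_mul,
                  Nat.card_eq_fintype_card]; ring

theorem vip_sq_le_patternEnergy (x x' : V → T) (p q : F → T) :
    vip (centred P φ F σ p x) (centred P φ F σ q x') ^ 2 ≤ patternEnergy P φ F σ x x' := by
  classical
  rw [patternEnergy_eq]
  refine le_trans ?_ (Finset.single_le_sum (fun p _ => Finset.sum_nonneg fun q _ => sq_nonneg _)
    (Finset.mem_univ p))
  exact Finset.single_le_sum (f := fun q => vip (centred P φ F σ p x) (centred P φ F σ q x') ^ 2)
    (fun q _ => sq_nonneg _) (Finset.mem_univ q)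

theorem norm_sum_patternFeature_sq {Ω : Type*} [Fintype Ω] (w : Ω → ℝ) (x : Ω → V → T) :
    ‖∑ a, w a • patternFeature P φ F σ (x a)‖ ^ 2 =
      ∑ a, ∑ b, w a * w b * patternEnergy P φ F σ (x a) (x b) := by
  rw [← real_inner_self_eq_norm_sq, sum_inner]
  refine Finset.sum_congr rfl fun a _ => ?_
  rw [inner_sum]
  refine Finset.sum_congr rfl fun b _ => ?_
  rw [real_inner_smul_left, real_inner_smul_right, inner_patternFeature]
  ring

end Energy

/-! ### From many tuples of models to a law on models -/

section ModelLaw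

variable {G : Type*} {A T : Type*} [MeasurableSpace A] [Fintype T]

/-- Tuples of words any two of which form a model of the square of `P`. -/
def pairwiseModels {V : Type*} [Fintype V] (P : ProbabilityMeasure (G → A)) (φ : A → T)
    (F : Finset G) (η : ℝ) (σ : G → Equiv.Perm V) (k : ℕ) : Set (Fin k → V → T) :=
  {y | ∀ i j, i ≠ j →
    IsModel (squareLaw P) (pairMap id φ φ) F η σ (fun v => (y i v, y j v))}

/-- If there are many tuples of pairwise independent models, then there are weights on words with
large entropy and small energy. -/
theorem exists_weights (P : ProbabilityMeasure (G → A)) {φ : A → T} (hφ : FinMeas φ)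
    (F : Finset G) {c c' ξ : ℝ} (hc : c < c') (hξ : 0 < ξ) :
    ∃ (n : ℕ) (η : ℝ), 0 < η ∧ ∀ (V : Type) [Fintype V] [Nonempty V] [DecidableEq V]
      (σ : G → Equiv.Perm V),
      Real.exp ((n + 1) * c' * Fintype.card V) ≤ (pairwiseModels P φ F η σ (n + 1)).ncard →
      ∃ w : (V → T) → ℝ, (∀ a, 0 ≤ w a) ∧ ∑ a, w a = 1 ∧
        c * Fintype.card V ≤ ∑ a, Real.negMulLog (w a) ∧
        ∑ a, ∑ b, w a * w b * patternEnergy P φ F σ a b ≤ ξ := by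
  classical
  set K : ℝ := (Nat.card (F → T) : ℝ) ^ 2
  have hK : 0 ≤ K := by positivity
  -- `L * ξ` exceeds `log |T| - c`, the largest possible surplus of entropy per vertex, so the
  -- penalized inequality excludes energies above `ξ`.
  set L : ℝ := (|Real.log (Fintype.card T)| + |c| + 1) / ξ with hL
  have hL0 : 0 ≤ L := by positivity
  -- The gap is `3 * d`. Small `η` and `t` together cost `d` per coordinate, and `n` is large enough
  -- for the terms that do not grow with `n` to cost at most another `d`.
  set d : ℝ := (c' - c) / 3 with hd
  have hd0 : 0 < d := by rw [hd]; linarith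
  set t : ℝ := d / (2 * (L * K + 1)) with ht
  have ht0 : 0 < t := by positivity
  obtain ⟨η, hη, hη'⟩ : ∃ η : ℝ, 0 < η ∧ L * (K * (3 * η) ^ 2) ≤ d / 2 := by
    refine ⟨min 1 (d / (18 * (L * K + 1))), by positivity, ?_⟩
    set η := min 1 (d / (18 * (L * K + 1)))
    have h1 : η ≤ 1 := min_le_left _ _
    have h2 : η ≤ d / (18 * (L * K + 1)) := min_le_right _ _
    have h0 : 0 < η := by positivity
    rw [le_div_iff₀ (by positivity)] at h2
    have h3 : η ^ 2 ≤ η := by nlinarith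
    have h4 : 0 ≤ L * K := by positivity
    nlinarith
  have htK : L * (t * K) ≤ d / 2 := by
    have h4 : 0 ≤ L * K := by positivity
    have : t * (2 * (L * K + 1)) = d := by rw [ht]; field_simp
    nlinarith
  obtain ⟨n, hn⟩ := exists_nat_gt (L * (K / (4 * t) + K) / d)
  rw [div_lt_iff₀ hd0] at hn
  refine ⟨n, η, hη, fun V _ _ _ σ hΘ => ?_⟩
  have hV1 : (1 : ℝ) ≤ Fintype.card V := by exact_mod_cast Fintype.card_pos (α := V)
  set Θ : Finset (Fin (n + 1) → V → T) := (pairwiseModels P φ F η σ (n + 1)).toFinset with hΘd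
  have hΘmem : ∀ y, y ∈ Θ ↔ y ∈ pairwiseModels P φ F η σ (n + 1) := fun y => mem_toFinset
  rw [Set.ncard_eq_toFinset_card'] at hΘ
  change _ ≤ (Θ.card : ℝ) at hΘ
  have hΘ0 : (0 : ℝ) < Θ.card := (Real.exp_pos _).trans_le hΘ
  have hne : Θ.Nonempty := Finset.card_pos.1 (by exact_mod_cast hΘ0)
  have hR : ∀ x : V → T, ‖patternFeature P φ F σ x‖ ^ 2 ≤ K := by
    intro x
    rw [← real_inner_self_eq_norm_sq, inner_patternFeature]
    refine (patternEnergy_le x x (a := 1) fun p q => abs_vip_le_one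
      (abs_centred_le_one P φ F σ p _) (abs_centred_le_one P φ F σ q _)).trans ?_
    simp [K]
  have hsymm : ∀ y ∈ Θ, ∀ π : Equiv.Perm (Fin (n + 1)), y ∘ π ∈ Θ := by
    intro y hy π
    rw [hΘmem] at hy ⊢
    exact fun i j hij => hy (π i) (π j) fun h => hij (π.injective h)
  have hζ : ∀ y ∈ Θ, ∀ i j, i ≠ j →
      inner ℝ (patternFeature P φ F σ (y i)) (patternFeature P φ F σ (y j)) ≤
        K * (3 * η) ^ 2 := by
    intro y hy i j hij
    rw [hΘmem] at hy
    rw [inner_patternFeature]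
    exact patternEnergy_le _ _ fun p q =>
      (hy i j hij).abs_vip_le (isProdLaw_squareLaw P) measurable_id hφ hφ p q
  obtain ⟨w, hw, hw1, h⟩ := exists_condLaw (E := EuclideanSpace ℝ (V × V)) hne
    (N := patternFeature P φ F σ) (R := K) (ζ := K * (3 * η) ^ 2) (t := t)
    (l := L * Fintype.card V) hsymm hR ht0 (by positivity) hζ
  refine ⟨w, hw, hw1, ?_⟩
  rw [norm_sum_patternFeature_sq] at h
  set En := ∑ a, ∑ b, w a * w b * patternEnergy P φ F σ a b
  set H := ∑ a, Real.negMulLog (w a)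
  have hEn : 0 ≤ En := Finset.sum_nonneg fun a _ => Finset.sum_nonneg fun b _ =>
    mul_nonneg (mul_nonneg (hw a) (hw b)) (patternEnergy_nonneg a b)
  have hHle : H ≤ Fintype.card V * Real.log (Fintype.card T) := by
    have hM : Nonempty (V → T) := ⟨hne.choose 0⟩
    have := sum_negMulLog_le_log_card hw hw1
    rwa [Fintype.card_fun, Nat.cast_pow, Real.log_pow] at this
  have hlog : (n + 1) * c' * Fintype.card V ≤ Real.log Θ.card := by
    rwa [Real.le_log_iff_exp_le hΘ0]
  have hmain : c * Fintype.card V ≤ H - L * Fintype.card V * En := by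
    refine le_trans ?_ h
    rw [le_div_iff₀ (by positivity)]
    have h1 : L * (n * (K * (3 * η) ^ 2 + t * K) + K / (4 * t) + K) ≤ (n + 1) * (2 * d) := by
      have : (n : ℝ) * (L * (K * (3 * η) ^ 2) + L * (t * K)) ≤ n * d := by
        gcongr
        linarith
      nlinarith
    have h2 := mul_le_mul_of_nonneg_right h1 (by positivity : (0 : ℝ) ≤ Fintype.card V)
    have h3 : c' = c + 3 * d := by rw [hd]; ring
    have h4 : (n + 1) * c' * (Fintype.card V : ℝ) = (n + 1) * c * Fintype.card V +
        (n + 1) * (3 * d) * Fintype.card V := by rw [h3]; ring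
    have h5 : 0 ≤ (n + 1) * d * (Fintype.card V : ℝ) := by positivity
    nlinarith
  refine ⟨?_, ?_⟩
  · have : 0 ≤ L * Fintype.card V * En := by positivity
    linarith
  · by_contra! hcon
    have h1 : L * ξ = |Real.log (Fintype.card T)| + |c| + 1 := by rw [hL]; field_simp
    have h0 : 0 < L := by positivity
    have h2 : L * ξ < L * En := mul_lt_mul_of_pos_left hcon h0
    have h3 : L * En ≤ Real.log (Fintype.card T) - c := by
      have : (c + L * En) * Fintype.card V ≤ Real.log (Fintype.card T) * Fintype.card V := by
        nlinarith
      have := le_of_mul_le_mul_right this (by linarith)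
      linarith
    have := le_abs_self (Real.log (Fintype.card T))
    have := neg_abs_le c
    linarith

end ModelLaw

/-! ### Laws of small energy -/

section LowEnergy

theorem exists_law_of_weights {Ω : Type*} [Fintype Ω] [MeasurableSpace Ω]
    [MeasurableSingletonClass Ω] {w : Ω → ℝ} (hw : ∀ a, 0 ≤ w a) (hw1 : ∑ a, w a = 1) :
    ∃ m : ProbabilityMeasure Ω, ∀ a, (m : Measure Ω).real {a} = w a := by
  have h : ∑ a, ENNReal.ofReal (w a) = 1 := by
    rw [← ENNReal.ofReal_sum_of_nonneg fun a _ => hw a, hw1, ENNReal.ofReal_one]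
  refine ⟨⟨(PMF.ofFintype _ h).toMeasure, inferInstance⟩, fun a => ?_⟩
  change ((PMF.ofFintype _ h).toMeasure {a}).toReal = _
  rw [PMF.toMeasure_apply_singleton _ _ (measurableSet_singleton a), PMF.ofFintype_apply,
    ENNReal.toReal_ofReal (hw a)]

theorem integral_prod_fintype {Ω : Type*} [Fintype Ω] [MeasurableSpace Ω]
    [MeasurableSingletonClass Ω] (m : ProbabilityMeasure Ω) (f : Ω × Ω → ℝ) :
    ∫ u, f u ∂((m : Measure Ω).prod (m : Measure Ω)) =
      ∑ a, ∑ b, (m : Measure Ω).real {a} * (m : Measure Ω).real {b} * f (a, b) := by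
  rw [integral_fintype Integrable.of_finite, Fintype.sum_prod_type]
  refine Finset.sum_congr rfl fun a _ => Finset.sum_congr rfl fun b _ => ?_
  rw [← measureReal_prod_prod, singleton_prod_singleton, smul_eq_mul]

theorem real_le_div_of_integral_le {Ω : Type*} [Finite Ω] [MeasurableSpace Ω]
    [MeasurableSingletonClass Ω] {μ : Measure Ω} [IsProbabilityMeasure μ] {f : Ω → ℝ}
    (hf : ∀ a, 0 ≤ f a) {s τ : ℝ} (hτ : 0 < τ) (h : ∫ a, f a ∂μ ≤ s) :
    μ.real {a | τ ≤ f a} ≤ s / τ := by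
  rw [le_div_iff₀ hτ, mul_comm]
  exact (mul_meas_ge_le_integral_of_nonneg (ae_of_all _ hf) Integrable.of_finite τ).trans h

variable {G : Type*} {A T : Type*} [MeasurableSpace A] [Fintype T] [MeasurableSpace T]
  [MeasurableSingletonClass T]

/-- Two independent samples from a law of small energy typically form a model of the square of
`P`, and the local laws are typically close to `P`. -/
theorem exists_energy_bound (P : ProbabilityMeasure (G → A)) {φ : A → T} (hφ : FinMeas φ)
    (F : Finset G) {η : ℝ} (hη : 0 < η) :
    ∃ ξ : ℝ, 0 < ξ ∧ ∀ (V : Type) [Fintype V] [Nonempty V] [DecidableEq V]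
      (σ : G → Equiv.Perm V)
      (m : ProbabilityMeasure (V → T)),
      ∑ a, ∑ b, (m : Measure (V → T)).real {a} * (m : Measure (V → T)).real {b} *
        patternEnergy P φ F σ a b ≤ ξ →
      ((m : Measure (V → T)).prod (m : Measure (V → T))).real
        {u | ¬ IsModel (squareLaw P) (pairMap id φ φ) F η σ (fun v => (u.1 v, u.2 v))} ≤ η ∧
      (m : Measure (V → T)).real {x | ¬ IsModel P φ F η σ x} ≤ η ∧
      freq {v | ∃ p : F → T, η ≤ |(m : Measure (V → T)).real {x | window σ F x v = p} -
        (P : Measure (G → A)).real {z | readWindow φ F z = p}|} ≤ η := by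
  classical
  set N : ℝ := ((Nat.card (F → T) : ℕ) : ℝ) with hN
  set N₂ : ℝ := ((Nat.card (F → T × T) : ℕ) : ℝ) with hN₂
  have hN0 : 0 ≤ N := Nat.cast_nonneg _
  have hN₂0 : 0 ≤ N₂ := Nat.cast_nonneg _
  set τ' : ℝ := min η (η / (2 * (N₂ + 1))) / 2 with hτ'
  have hτ'0 : 0 < τ' := by positivity
  have hτ'η : τ' < η := by
    have : min η (η / (2 * (N₂ + 1))) ≤ η := min_le_left _ _
    rw [hτ']; linarith
  have hτ'N : N₂ * (2 * τ') < η := by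
    have h1 : 2 * τ' ≤ η / (2 * (N₂ + 1)) := by
      have : min η (η / (2 * (N₂ + 1))) ≤ η / (2 * (N₂ + 1)) := min_le_right _ _
      rw [hτ']; linarith
    rw [le_div_iff₀ (by positivity)] at h1
    nlinarith
  set τ : ℝ := τ' / (N + 2) with hτ
  have hτ0 : 0 < τ := by positivity
  have hττ' : (N + 2) * τ = τ' := by rw [hτ]; field_simp
  -- If the energy is at most `r ^ 4`, then mean absolute correlations of two samples are at most `r
  -- ^ 2`, and mean squared correlations with a fixed function at most `r`.
  set r : ℝ := min 1 (min (η * τ ^ 2 / (N ^ 2 + 2 * N + 1)) (η * η ^ 2 / (N + 1))) with hr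
  have hr0 : 0 < r := by positivity
  have hr1 : r ≤ 1 := min_le_left _ _
  have hr2 : (N ^ 2 + 2 * N) * (r / τ ^ 2) ≤ η := by
    have h1 : r ≤ η * τ ^ 2 / (N ^ 2 + 2 * N + 1) := (min_le_right _ _).trans (min_le_left _ _)
    rw [le_div_iff₀ (by positivity)] at h1
    rw [mul_div_assoc', div_le_iff₀ (by positivity)]
    nlinarith
  have hr3 : N * (r / η ^ 2) ≤ η := by
    have h1 : r ≤ η * η ^ 2 / (N + 1) := (min_le_right _ _).trans (min_le_right _ _)
    rw [le_div_iff₀ (by positivity)] at h1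
    rw [mul_div_assoc', div_le_iff₀ (by positivity)]
    nlinarith
  refine ⟨r ^ 4, by positivity, fun V _ _ _ σ m hm => ?_⟩
  set μ := (m : Measure (V → T)) with hμ
  set C : (F → T) → (V → T) → V → ℝ := fun p x => centred P φ F σ p x with hC
  have hC1 : ∀ p x v, |C p x v| ≤ 1 := fun p x => abs_centred_le_one P φ F σ p x
  have hpq : ∀ p q, ∑ a, ∑ b, μ.real {a} * μ.real {b} * vip (C p a) (C q b) ^ 2 ≤ r ^ 4 := by
    intro p q
    refine le_trans (Finset.sum_le_sum fun a _ => Finset.sum_le_sum fun b _ => ?_) hm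
    gcongr
    exact vip_sq_le_patternEnergy a b p q
  have hone : ∑ a, μ.real {a} = 1 := by
    simp
  have hJ : ∀ p, ∑ a, ∑ b, μ.real {a} * μ.real {b} * |vip (C p a) (C p b)| ≤ r ^ 2 := by
    intro p
    have h1 : ∀ z : ℝ, |z| ≤ r ^ 2 / 2 + z ^ 2 / (2 * r ^ 2) := by
      intro z
      have : r ^ 2 / 2 + z ^ 2 / (2 * r ^ 2) - |z| = (|z| - r ^ 2) ^ 2 / (2 * r ^ 2) := by
        rw [← sq_abs z]; field_simp; ring
      have h0 : 0 ≤ (|z| - r ^ 2) ^ 2 / (2 * r ^ 2) := by positivity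
      linarith
    calc _ ≤ ∑ a, ∑ b, (μ.real {a} * μ.real {b} * (r ^ 2 / 2) +
          μ.real {a} * μ.real {b} * vip (C p a) (C p b) ^ 2 / (2 * r ^ 2)) := by
          refine Finset.sum_le_sum fun a _ => Finset.sum_le_sum fun b _ => ?_
          rw [mul_div_assoc, ← mul_add]
          gcongr
          exact h1 _
      _ = r ^ 2 / 2 + (∑ a, ∑ b, μ.real {a} * μ.real {b} * vip (C p a) (C p b) ^ 2) /
          (2 * r ^ 2) := by
          simp only [Finset.sum_add_distrib, ← Finset.sum_div, ← Finset.sum_mul, ← Finset.mul_sum,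
            hone, mul_one, one_mul]
      _ ≤ r ^ 2 / 2 + r ^ 4 / (2 * r ^ 2) := by gcongr; exact hpq p p
      _ = r ^ 2 := by field_simp; ring
  -- The correlation with the constant function is the deviation of the frequency of `p`; its
  -- smallness makes single samples models of `P`.
  have h1v : ∀ p x, vip (C p x) (ind univ) = freq {v | window σ F x v = p} -
      (P : Measure (G → A)).real {z | readWindow φ F z = p} := by
    intro p x
    have := vip_sub_const_ind {v | window σ F x v = p} univ
      ((P : Measure (G → A)).real {z | readWindow φ F z = p})
    rw [inter_univ, freq_univ, mul_one] at this
    exact this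
  have hB1 : ∀ p, μ.real {x | τ ^ 2 ≤ vip (C p x) (ind univ) ^ 2} ≤ r / τ ^ 2 := by
    intro p
    refine real_le_div_of_integral_le (fun x => sq_nonneg _) (by positivity) ?_
    rw [integral_fintype Integrable.of_finite]
    simp only [smul_eq_mul]
    have := (sum_vip_sq_le (fun a => measureReal_nonneg) (hC1 p) (abs_ind_le_one univ)).trans (hJ p)
    exact (abs_le_of_sq_le_sq' this hr0.le).2
  have hB2 : ∀ p q, (μ.prod μ).real {u | τ ^ 2 ≤ vip (C p u.1) (C q u.2) ^ 2} ≤ r / τ ^ 2 := by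
    intro p q
    refine real_le_div_of_integral_le (fun x => sq_nonneg _) (by positivity) ?_
    rw [integral_prod_fintype]
    refine (hpq p q).trans ?_
    calc r ^ 4 = r * r ^ 3 := by ring
      _ ≤ r * 1 := by gcongr; exact pow_le_one₀ hr0.le hr1
      _ = r := mul_one r
  have hmodel : ∀ x, (∀ p, vip (C p x) (ind univ) ^ 2 < τ ^ 2) → IsModel P φ F τ' σ x := by
    intro x hx
    refine isModel_of_patterns hφ (τ := τ) (fun p => ?_) (by linarith)
    rw [← h1v]
    exact (abs_lt_of_sq_lt_sq (hx p) hτ0.le).le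
  have hUn : μ.real (⋃ p, {x | τ ^ 2 ≤ vip (C p x) (ind univ) ^ 2}) ≤ N * (r / τ ^ 2) := by
    refine (measureReal_iUnion_fintype_le _).trans ((Finset.sum_le_sum fun p _ => hB1 p).trans ?_)
    simp [hN]
  have hNr : 0 ≤ N ^ 2 * (r / τ ^ 2) := by positivity
  refine ⟨?_, ?_, ?_⟩
  · have hsub : {u : (V → T) × (V → T) | ¬ IsModel (squareLaw P) (pairMap id φ φ) F η σ
        (fun v => (u.1 v, u.2 v))} ⊆
        (⋃ p : (F → T) × (F → T), {u | τ ^ 2 ≤ vip (C p.1 u.1) (C p.2 u.2) ^ 2}) ∪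
        ((⋃ p, {x | τ ^ 2 ≤ vip (C p x) (ind univ) ^ 2}) ×ˢ univ ∪
        univ ×ˢ (⋃ p, {x | τ ^ 2 ≤ vip (C p x) (ind univ) ^ 2})) := by
      intro u hu
      by_contra hcon
      simp only [mem_union, mem_iUnion, mem_ofPred_eq, mem_prod, mem_univ, true_and, and_true,
        not_or,
        not_exists, not_le] at hcon
      obtain ⟨h1, h3, h2⟩ := hcon
      refine hu (isModel_pair_of_vip (isProdLaw_squareLaw P) measurable_id hφ hφ
        (hmodel u.2 h2) (fun p q => ?_) hτ'N)
      set b := (P : Measure (G → A)).real {z | readWindow φ F z = q} with hb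
      obtain ⟨b0, b1⟩ := real_nonneg_le_one P {z | readWindow φ F z = q}
      -- The indicator of the pattern `q` is its centred version plus the constant `b`.
      have e1 : vip (C p u.1) (ind {v | window σ F u.2 v = q}) =
          vip (C p u.1) (C q u.2) + b * vip (C p u.1) (ind univ) := by
        unfold vip
        rw [mul_div_assoc', ← add_div, Finset.mul_sum, ← Finset.sum_add_distrib]
        congr 1
        refine Finset.sum_congr rfl fun v _ => ?_
        simp only [hC, centred, ind, hb, indicator_univ, Pi.one_apply]
        ring
      have e2 := abs_lt_of_sq_lt_sq (h1 (p, q)) hτ0.le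
      have e3 := abs_lt_of_sq_lt_sq (h3 p) hτ0.le
      change |vip (C p u.1) (ind {v | window σ F u.2 v = q})| ≤ τ'
      have e4 := abs_add_le (vip (C p u.1) (C q u.2)) (b * vip (C p u.1) (ind univ))
      rw [abs_mul b, abs_of_nonneg b0] at e4
      have e5 := mul_le_mul_of_nonneg_right b1 (abs_nonneg (vip (C p u.1) (ind univ)))
      have e6 : 0 ≤ N * τ := by positivity
      rw [e1]
      dsimp only at e2
      linarith
    refine (measureReal_mono hsub).trans ((measureReal_union_le _ _).trans
      ((add_le_add_right (measureReal_union_le _ _) _).trans ?_))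
    rw [measureReal_prod_prod, measureReal_prod_prod, probReal_univ, one_mul, mul_one]
    have h3 : (μ.prod μ).real (⋃ p : (F → T) × (F → T),
        {u | τ ^ 2 ≤ vip (C p.1 u.1) (C p.2 u.2) ^ 2}) ≤ N ^ 2 * (r / τ ^ 2) := by
      refine (measureReal_iUnion_fintype_le _).trans
        ((Finset.sum_le_sum fun p _ => hB2 p.1 p.2).trans (le_of_eq ?_))
      simp [hN, sq]
    linarith
  · refine (measureReal_mono fun x hx => ?_).trans (hUn.trans (by linarith [measureReal_nonneg.trans hUn]))
    by_contra hcon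
    simp only [mem_iUnion, mem_ofPred_eq, not_exists, not_le] at hcon
    exact hx ((hmodel x hcon).mono subset_rfl hτ'η.le)
  -- The error of the local law at `v` is the value at `v` of the mean of the centred indicators.
  -- The squared norm of this mean is the mean correlation of two independent samples.
  · have hU : ∀ p v, μ.real {x | window σ F x v = p} -
        (P : Measure (G → A)).real {z | readWindow φ F z = p} = ∑ a, μ.real {a} * C p a v := by
      intro p v
      have h1 := real_preimage_eq_sum μ (a := id) measurable_id.finMeas
        (Finset.univ.filter fun x => window σ F x v = p)
      simp only [preimage_id, Finset.coe_filter, Finset.mem_univ, true_and] at h1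
      rw [h1]
      simp only [hC, centred, mul_sub, Finset.sum_sub_distrib, ← Finset.sum_mul, hone, one_mul]
      congr 1
      rw [Finset.sum_filter]
      refine Finset.sum_congr rfl fun a _ => ?_
      by_cases h : window σ F a v = p <;> simp [ind, h]
    have hsub : {v | ∃ p : F → T, η ≤ |μ.real {x | window σ F x v = p} -
        (P : Measure (G → A)).real {z | readWindow φ F z = p}|} ⊆
        ⋃ p ∈ (Finset.univ : Finset (F → T)), {v | η ≤ |∑ a, μ.real {a} * C p a v|} := by
      rintro v ⟨p, hp⟩
      rw [hU] at hp
      exact mem_biUnion (Finset.mem_coe.2 (Finset.mem_univ p)) hp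
    have hfr : ∀ p, freq {v | η ≤ |∑ a, μ.real {a} * C p a v|} ≤ r / η ^ 2 := by
      intro p
      rw [le_div_iff₀ (by positivity), mul_comm]
      refine (mul_freq_le_sum_div (f := fun v => (∑ a, μ.real {a} * C p a v) *
        (∑ a, μ.real {a} * C p a v)) (fun v => mul_self_nonneg _) fun v hv => ?_).trans ?_
      · rw [← sq, ← sq_abs (∑ a, μ.real {a} * C p a v)]
        exact pow_le_pow_left₀ hη.le hv 2
      · change vip (fun v => ∑ a, μ.real {a} * C p a v) (fun v => ∑ a, μ.real {a} * C p a v) ≤ r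
        rw [vip_sum_left]
        have : ∀ a, μ.real {a} * vip (C p a) (fun v => ∑ b, μ.real {b} * C p b v) ≤
            ∑ b, μ.real {a} * μ.real {b} * |vip (C p a) (C p b)| := by
          intro a
          rw [vip_sum_right, Finset.mul_sum]
          refine Finset.sum_le_sum fun b _ => ?_
          rw [mul_assoc]
          gcongr
          exact le_abs_self _
        refine (Finset.sum_le_sum fun a _ => this a).trans ((hJ p).trans ?_)
        nlinarith
    refine (freq_mono hsub).trans ((freq_biUnion_le _ _).trans
      ((Finset.sum_le_sum fun p _ => hfr p).trans ?_))
    simpa [hN] using hr3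

/-- If there are many tuples of pairwise independent models, then there is a law on models with
large entropy whose samples are typically pairwise independent. -/
theorem exists_model_law (P : ProbabilityMeasure (G → A)) {φ : A → T} (hφ : FinMeas φ)
    (F : Finset G) {c c' η : ℝ} (hc : c < c') (hη : 0 < η) :
    ∃ (n : ℕ) (η' : ℝ), 0 < η' ∧ ∀ (V : Type) [Fintype V] [Nonempty V] [DecidableEq V]
      (σ : G → Equiv.Perm V),
      Real.exp ((n + 1) * c' * Fintype.card V) ≤ (pairwiseModels P φ F η' σ (n + 1)).ncard →
      ∃ m : ProbabilityMeasure (V → T),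
        c * Fintype.card V ≤ ∑ a, Real.negMulLog ((m : Measure (V → T)).real {a}) ∧
        ((m : Measure (V → T)).prod (m : Measure (V → T))).real
          {u | ¬ IsModel (squareLaw P) (pairMap id φ φ) F η σ (fun v => (u.1 v, u.2 v))} ≤ η ∧
        (m : Measure (V → T)).real {x | ¬ IsModel P φ F η σ x} ≤ η ∧
        freq {v | ∃ p : F → T, η ≤ |(m : Measure (V → T)).real {x | window σ F x v = p} -
          (P : Measure (G → A)).real {z | readWindow φ F z = p}|} ≤ η := by
  obtain ⟨ξ, hξ, h⟩ := exists_energy_bound P hφ F hη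
  obtain ⟨n, η', hη', h'⟩ := exists_weights P hφ F hc hξ
  refine ⟨n, η', hη', fun V _ _ _ σ hΘ => ?_⟩
  obtain ⟨w, hw, hw1, hH, hE⟩ := h' V σ hΘ
  obtain ⟨m, hm⟩ := exists_law_of_weights hw hw1
  simp only [← hm] at hH hE
  exact ⟨m, hH, h V σ m hE⟩

end LowEnergy

/-! ### Codes -/

section Code

variable {G : Type v} [Group G] {A : Type*} [MetricSpace A] [CompactSpace A] [MeasurableSpace A]
  [BorelSpace A] {T : Type} [Finite T]

/-- Every finite-valued observable is approximated by functions of windows of `φ`. -/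
def Generates (P : ProbabilityMeasure (G → A)) (φ : A → T) : Prop :=
  ∀ (N : ℕ) (ψ : A → Fin N), FinMeas ψ → ∀ ε : ℝ, 0 < ε → ∃ (D : Finset G) (θ : (D → T) → Fin N),
    (P : Measure (G → A)).real {z | θ (readWindow φ D z) ≠ ψ (z 1)} ≤ ε

/-- The set of points of `G → A` which are not well recovered by the code `q` in the window `E`. -/
def codeError (φ : A → T) (D E : Finset G) (q : (D → T) → A) (κ : ℝ) : Set (G → A) :=
  {z | ∃ g ∈ E, κ ≤ dist (q fun h => φ (z (h * g))) (z g)}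

/-- A code for the coordinate `1` suffices: shift-invariance moves its error to each `g ∈ E`, and a
union bound finishes. -/
theorem exists_code {P : ProbabilityMeasure (G → A)} (hP : ShiftInv P) {φ : A → T}
    (hφ : FinMeas φ) (hgen : Generates P φ) (E : Finset G) {κ : ℝ} (hκ : 0 < κ) :
    ∃ (D : Finset G) (q : (D → T) → A),
      (P : Measure (G → A)).real (codeError φ D E q κ) < κ := by
  have hne : Nonempty A := (marginal P).nonempty
  obtain ⟨N, p, hp, hpd⟩ := exists_fine_partition A hκ
  obtain ⟨D, θ, hθ⟩ := hgen N p hp (κ / (E.card + 1)) (by positivity)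
  refine ⟨D, fun w => Function.invFun p (θ w), ?_⟩
  set B : Set (G → A) := {z | θ (readWindow φ D z) ≠ p (z 1)} with hB
  have hBm : MeasurableSet B := ((hφ.readWindow D).prodMk
    (hp.comp_measurable (measurable_pi_apply (1 : G)))) {u | θ u.1 ≠ u.2}
  have hsub : codeError φ D E (fun w => Function.invFun p (θ w)) κ ⊆
      ⋃ g ∈ E, {z | (fun g' => z (g' * g)) ∈ B} := by
    rintro z ⟨g, hg, hz⟩
    refine mem_biUnion (Finset.mem_coe.2 hg) fun hcon => ?_
    simp only [one_mul] at hcon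
    refine absurd hz (not_le.2 (hpd _ _ ?_))
    rw [← hcon]
    exact Function.invFun_eq ⟨z g, hcon.symm⟩
  calc _ ≤ ∑ g ∈ E, (P : Measure (G → A)).real {z | (fun g' => z (g' * g)) ∈ B} :=
        (measureReal_mono hsub (measure_ne_top _ _)).trans (measureReal_biUnion_finset_le _ _)
    _ ≤ ∑ _g ∈ E, κ / (E.card + 1) := Finset.sum_le_sum fun g _ => by
        rw [hP.real_eq g hBm]; exact hθ
    _ = κ * (E.card / (E.card + 1)) := by
        rw [Finset.sum_const, nsmul_eq_mul]; ring
    _ < κ := by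
        refine mul_lt_of_lt_one_right hκ ?_
        rw [div_lt_one (by positivity)]
        linarith

/-- The word obtained from `y` by applying the code `q` at each vertex. -/
def applyCode {V : Type*} {D : Finset G} (q : (D → T) → A) (σ : G → Equiv.Perm V) (y : V → T)
    (v : V) : A := q (window σ D y v)

open Classical in
/-- The reconstruction of a pair of points from their patterns in the window `F`. -/
noncomputable def decodePair {D F : Finset G} [Nonempty A] (q : (D → T) → A) (w : F → T × T)
    (g : G) : A × A :=
  if h : ∀ h : D, (h : G) * g ∈ F then
    (q fun i => (w ⟨i * g, h i⟩).1, q fun i => (w ⟨i * g, h i⟩).2)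
  else Classical.arbitrary _

omit [Group G] in
-- A union bound over the two coordinates; `s` may be non-measurable, so its measurable hull is
-- used.
theorem squareLaw_real_le {B : Type*} [MeasurableSpace B] (P : ProbabilityMeasure (G → B))
    (s : Set (G → B)) :
    (squareLaw P : Measure (G → B × B)).real
      {z : G → B × B | (fun g => (z g).1) ∈ s ∨ (fun g => (z g).2) ∈ s} ≤
      2 * (P : Measure (G → B)).real s := by
  set s' := toMeasurable (P : Measure (G → B)) s
  have hs' : MeasurableSet s' := measurableSet_toMeasurable _ _
  have hss : s ⊆ s' := subset_toMeasurable _ _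
  have h1 := (isProdLaw_squareLaw P).real_eq measurable_id hs' MeasurableSet.univ
  have h2 := (isProdLaw_squareLaw P).real_eq measurable_id MeasurableSet.univ hs'
  have h3 : (P : Measure (G → B)).real s' = (P : Measure (G → B)).real s := by
    simp [s', Measure.real]
  rw [probReal_univ, mul_one, h3] at h1
  rw [probReal_univ, one_mul, h3] at h2
  calc _ ≤ (squareLaw P : Measure (G → B × B)).real
          ({z : G → B × B | (fun g => (id (z g)).1) ∈ s' ∧ (fun g => (id (z g)).2) ∈ univ} ∪
            {z : G → B × B | (fun g => (id (z g)).1) ∈ univ ∧ (fun g => (id (z g)).2) ∈ s'}) := by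
        refine measureReal_mono ?_
        rintro z (hz | hz)
        · exact Or.inl ⟨hss hz, trivial⟩
        · exact Or.inr ⟨trivial, hss hz⟩
    _ ≤ _ := (measureReal_union_le _ _).trans (by rw [h1, h2]; linarith)

variable [Nonempty A]

omit [CompactSpace A] [BorelSpace A] in
-- The finite observable is the pattern of the pair in `F`, from which the code rebuilds the pair
-- outside `codeError`. What is left to each application is the closeness of pattern laws and the
-- rarity of mismatches.
theorem shadows_of_code {P : ProbabilityMeasure (G → A)} {φ : A → T} (hφ : FinMeas φ)
    {D E F : Finset G} (hF : ∀ h ∈ D, ∀ g ∈ E, h * g ∈ F) {q : (D → T) → A} {κ : ℝ}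
    (hq : (P : Measure (G → A)).real (codeError φ D E q κ) < κ) (hκ : 0 < κ)
    {Ω : Type} [MeasurableSpace Ω] (ν : ProbabilityMeasure Ω) {a : Ω → F → T × T}
    {b : Ω → G → A × A} (ha : FinMeas a) (hb : Measurable b) {Q : ProbabilityMeasure (G → A × A)}
    (hQ : (Q : Measure (G → A × A)) = (ν : Measure Ω).map b)
    (hmis : (ν : Measure Ω).real {ω | ∃ g ∈ E, b ω g ≠ decodePair q (a ω) g} < 2 * κ)
    (hclose : ∀ S, |(ν : Measure Ω).real (a ⁻¹' S) - (squareLaw P : Measure (G → A × A)).real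
      (readWindow (pairMap id φ φ) F ⁻¹' S)| < 2 * κ) :
    Shadows.{v, 0} (squareLaw P) E (2 * κ) Q := by
  refine ⟨F → T × T, inferInstance, decodePair q, readWindow (pairMap id φ φ) F, Ω, inferInstance,
    ν, a, b, (FinMeas.pairMap measurable_id hφ hφ).readWindow F, ha, hb, hQ, ?_, hmis, hclose⟩
  refine lt_of_le_of_lt (measureReal_mono ?_) (lt_of_le_of_lt (squareLaw_real_le P
    (codeError φ D E q κ)) (by linarith))
  rintro z ⟨g, hg, hz⟩
  have hcond : ∀ h : D, (h : G) * g ∈ F := fun h => hF h h.2 g hg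
  rw [decodePair, dif_pos hcond, Prod.dist_eq] at hz
  rcases le_max_iff.1 (le_trans (by linarith : κ ≤ 2 * κ) hz) with h | h
  · exact Or.inl ⟨g, hg, h⟩
  · exact Or.inr ⟨g, hg, h⟩

omit [MetricSpace A] [CompactSpace A] [MeasurableSpace A] [BorelSpace A] [Finite T] in
-- Where `σ` is multiplicative on `D` and `E`, the window of `σ g v` through `D` is part of the
-- window of `v` through `F`.
theorem decodePair_window {V : Type*} {D E F : Finset G} (hF : ∀ h ∈ D, ∀ g ∈ E, h * g ∈ F)
    (q : (D → T) → A) {σ : G → Equiv.Perm V} {v : V}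
    (hv : ∀ h ∈ D, ∀ g ∈ E, σ h (σ g v) = σ (h * g) v) (y y' : V → T) {g : G} (hg : g ∈ E) :
    decodePair q (window σ F (fun v => (y v, y' v)) v) g =
      (applyCode q σ y (σ g v), applyCode q σ y' (σ g v)) := by
  have hcond : ∀ h : D, (h : G) * g ∈ F := fun h => hF h h.2 g hg
  rw [decodePair, dif_pos hcond]
  simp only [applyCode, window]
  congr 2 <;> funext h
  · exact congrArg y (hv h h.2 g hg).symm
  · exact congrArg y' (hv h h.2 g hg).symm

end Code

/-! ### Images of laws on words under codes -/

section PushCode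

variable {G : Type v} [Group G] {A : Type*} [MetricSpace A] [CompactSpace A] [MeasurableSpace A]
  [BorelSpace A] {T : Type} [Finite T] [MeasurableSpace T] [MeasurableSingletonClass T]
  {V : Type} [Fintype V] {D E F : Finset G}

omit [Group G] [MetricSpace A] [CompactSpace A] [BorelSpace A] in
theorem measurable_applyCode (q : (D → T) → A) (σ : G → Equiv.Perm V) :
    Measurable (applyCode q σ : (V → T) → V → A) :=
  measurable_of_countable _

/-- The image of a law on finite words under a code. -/
noncomputable def pushCode (q : (D → T) → A) (σ : G → Equiv.Perm V)
    (m : ProbabilityMeasure (V → T)) : ProbabilityMeasure (V → A) :=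
  m.map (measurable_applyCode q σ).aemeasurable

omit [Group G] [MetricSpace A] [CompactSpace A] [BorelSpace A] in
theorem squareLaw_pushCode (q : (D → T) → A) (σ : G → Equiv.Perm V)
    (m : ProbabilityMeasure (V → T)) :
    (squareLaw (pushCode q σ m) : Measure (V → A × A)) =
      ((m : Measure (V → T)).prod (m : Measure (V → T))).map
        (fun u => zipFun (applyCode q σ u.1, applyCode q σ u.2)) := by
  change (((m : Measure (V → T)).map (applyCode q σ)).prod
    ((m : Measure (V → T)).map (applyCode q σ))).map zipFun = _
  rw [Measure.map_prod_map _ _ (measurable_applyCode q σ) (measurable_applyCode q σ),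
    Measure.map_map measurable_zipFun
      ((measurable_applyCode q σ).prodMap (measurable_applyCode q σ))]
  rfl

variable [Nonempty A]

omit [CompactSpace A] [BorelSpace A] in
-- The local half of doubly-quenched convergence. At one vertex the two samples are independent, so
-- an error `η` in the law of each pattern becomes at most `2 * η` for pairs of patterns.
theorem shadows_local {P : ProbabilityMeasure (G → A)} {φ : A → T} (hφ : FinMeas φ)
    (hF : ∀ h ∈ D, ∀ g ∈ E, h * g ∈ F) {q : (D → T) → A} {κ η : ℝ}
    (hq : (P : Measure (G → A)).real (codeError φ D E q κ) < κ) (hκ : 0 < κ)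
    (hη : Nat.card (F → T × T) * (2 * η) < 2 * κ) {σ : G → Equiv.Perm V}
    (m : ProbabilityMeasure (V → T)) {v : V}
    (hv : ∀ h ∈ D, ∀ g ∈ E, σ h (σ g v) = σ (h * g) v)
    (hloc : ∀ p : F → T, |(m : Measure (V → T)).real {x | window σ F x v = p} -
      (P : Measure (G → A)).real {z | readWindow φ F z = p}| < η) :
    Shadows.{v, 0} (squareLaw P) E (2 * κ) ((squareLaw (pushCode q σ m)).map
      (measurable_pullbackName σ v).aemeasurable) := by
  classical
  have := Fintype.ofFinite T
  have hdec : Measurable fun u : (V → T) × (V → T) =>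
      (zipFun (applyCode q σ u.1, applyCode q σ u.2) : V → A × A) := measurable_of_countable _
  have hwin : FinMeas fun u : (V → T) × (V → T) => window σ F (fun v => (u.1 v, u.2 v)) v :=
    fun S => (Set.toFinite _).measurableSet
  refine shadows_of_code hφ hF hq hκ (m.prod m)
    (a := fun u => window σ F (fun v => (u.1 v, u.2 v)) v)
    (b := fun u => pullbackName σ v (zipFun (applyCode q σ u.1, applyCode q σ u.2)))
    hwin ((measurable_pullbackName σ v).comp hdec) ?_ ?_ ?_
  · change (squareLaw (pushCode q σ m) : Measure (V → A × A)).map _ = _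
    rw [squareLaw_pushCode, Measure.map_map (measurable_pullbackName σ v) hdec]
    rfl
  · have : {u : (V → T) × (V → T) | ∃ g ∈ E,
        pullbackName σ v (zipFun (applyCode q σ u.1, applyCode q σ u.2)) g ≠
        decodePair q (window σ F (fun v => (u.1 v, u.2 v)) v) g} = ∅ := by
      refine Set.eq_empty_iff_forall_notMem.2 ?_
      rintro u ⟨g, hg, hu⟩
      exact hu (decodePair_window hF q hv u.1 u.2 hg).symm
    rw [this, measureReal_empty]
    positivity
  · intro S
    have h1 := real_preimage_eq_sum ((m.prod m : ProbabilityMeasure ((V → T) × (V → T))) :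
      Measure ((V → T) × (V → T))) hwin S.toFinset
    have h2 := real_preimage_eq_sum (squareLaw P : Measure (G → A × A))
      ((FinMeas.pairMap measurable_id hφ hφ).readWindow F) S.toFinset
    rw [coe_toFinset] at h1 h2
    rw [h1, h2, ← Finset.sum_sub_distrib]
    have h3 : ∀ w : F → T × T, |((m.prod m : ProbabilityMeasure ((V → T) × (V → T))) :
        Measure ((V → T) × (V → T))).real
        ((fun u => window σ F (fun v => (u.1 v, u.2 v)) v) ⁻¹' {w}) -
        (squareLaw P : Measure (G → A × A)).real (readWindow (pairMap id φ φ) F ⁻¹' {w})| ≤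
        2 * η := by
      intro w
      have e1 : ((m.prod m : ProbabilityMeasure ((V → T) × (V → T))) :
          Measure ((V → T) × (V → T))).real
          ((fun u => window σ F (fun v => (u.1 v, u.2 v)) v) ⁻¹' {w}) =
          (m : Measure (V → T)).real {x | window σ F x v = fun g => (w g).1} *
          (m : Measure (V → T)).real {x | window σ F x v = fun g => (w g).2} := by
        rw [← measureReal_prod_prod]
        change ((m : Measure (V → T)).prod (m : Measure (V → T))).real _ = _
        congr 1
        ext u
        simp only [mem_preimage, mem_singleton_iff, mem_prod, mem_ofPred_eq, window, funext_iff,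
          Prod.ext_iff]
        exact forall_and
      have e2 := (isProdLaw_squareLaw P).real_pattern measurable_id hφ hφ w
      change (squareLaw P : Measure (G → A × A)).real (readWindow (pairMap id φ φ) F ⁻¹' {w}) = _
        at e2
      rw [e1, e2]
      have h4 := (hloc fun g => (w g).1).le
      have h5 := (hloc fun g => (w g).2).le
      obtain ⟨a0, a1⟩ := real_nonneg_le_one m {x | window σ F x v = fun g => (w g).1}
      obtain ⟨b0, b1⟩ := real_nonneg_le_one P {z | readWindow φ F z = fun g => (w g).2}
      set a := (m : Measure (V → T)).real {x | window σ F x v = fun g => (w g).1}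
      set a' := (m : Measure (V → T)).real {x | window σ F x v = fun g => (w g).2}
      set b := (P : Measure (G → A)).real {z | readWindow φ F z = fun g => (w g).2}
      set b' := (P : Measure (G → A)).real {z | readWindow φ F z = fun g => (w g).1}
      rw [show a * a' - b' * b = a * (a' - b) + (a - b') * b by ring]
      refine (abs_add_le _ _).trans ?_
      rw [abs_mul, abs_mul, abs_of_nonneg a0, abs_of_nonneg b0]
      nlinarith [abs_nonneg (a' - b), abs_nonneg (a - b')]
    refine lt_of_le_of_lt (Finset.abs_sum_le_sum_abs _ _) (lt_of_le_of_lt ?_ hη)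
    have hη0 : 0 ≤ 2 * η := (abs_nonneg _).trans (h3 (Classical.choice
      (Nonempty.map (fun z => readWindow (pairMap id φ φ) F z) (squareLaw P).nonempty)))
    calc _ ≤ ∑ _w ∈ S.toFinset, 2 * η := Finset.sum_le_sum fun w _ => h3 w
      _ ≤ ∑ _w : F → T × T, 2 * η := Finset.sum_le_univ_sum_of_nonneg fun _ => hη0
      _ = _ := by simp [Nat.card_eq_fintype_card]

omit [CompactSpace A] [BorelSpace A] [MeasurableSpace T] [MeasurableSingletonClass T] in
-- The concentration half of doubly-quenched convergence: the sample space is now the vertex set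
-- with its uniform measure, and mismatches occur only where multiplicativity fails.
theorem shadows_empirical [Nonempty V] {P : ProbabilityMeasure (G → A)} {φ : A → T}
    (hφ : FinMeas φ) (hF : ∀ h ∈ D, ∀ g ∈ E, h * g ∈ F) {q : (D → T) → A} {κ η : ℝ}
    (hq : (P : Measure (G → A)).real (codeError φ D E q κ) < κ) (hκ : 0 < κ)
    (hη : η ≤ 2 * κ) {σ : G → Equiv.Perm V}
    (hσ : freq {v | ¬ ∀ h ∈ D, ∀ g ∈ E, σ h (σ g v) = σ (h * g) v} < 2 * κ) {y y' : V → T}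
    (hy : IsModel (squareLaw P) (pairMap id φ φ) F η σ (fun v => (y v, y' v))) :
    Shadows.{v, 0} (squareLaw P) E (2 * κ)
      (empiricalDist σ (zipFun (applyCode q σ y, applyCode q σ y'))) := by
  let _ : MeasurableSpace V := ⊤
  refine shadows_of_code hφ hF hq hκ (uniformLaw V)
    (a := window σ F fun v => (y v, y' v))
    (b := fun v => pullbackName σ v (zipFun (applyCode q σ y, applyCode q σ y')))
    (fun _ => trivial) measurable_from_top (uniformLaw_map measurable_from_top).symm ?_ ?_
  · rw [uniformLaw_real]
    refine lt_of_le_of_lt (freq_mono ?_) hσ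
    rintro v ⟨g, hg, hv⟩ hcon
    exact hv (decodePair_window hF q hcon y y' hg).symm
  · intro S
    rw [uniformLaw_real]
    exact (hy S).trans_le hη

omit [Group G] [MetricSpace A] [CompactSpace A] [BorelSpace A] [Nonempty A] in
/-- The images of pairs of models are good models. -/
theorem le_squareLaw_pushCode (q : (D → T) → A) (σ : G → Equiv.Perm V)
    (m : ProbabilityMeasure (V → T)) (s : Set (V → A × A)) :
    ((m : Measure (V → T)).prod (m : Measure (V → T)))
      {u | zipFun (applyCode q σ u.1, applyCode q σ u.2) ∈ s} ≤
      (squareLaw (pushCode q σ m) : Measure (V → A × A)) s := by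
  rw [squareLaw_pushCode]
  exact Measure.le_map_apply (measurable_of_countable _).aemeasurable s

end PushCode

/-! ### Covering numbers of coded laws -/

section CoverBound

variable {G : Type v} [Group G] {A : Type u} [MetricSpace A] [CompactSpace A]
  [MeasurableSpace A] [BorelSpace A] {T : Type} [Fintype T] [MeasurableSpace T]
  [MeasurableSingletonClass T]

theorem measurable_hammingAvg {V : Type*} [Fintype V] (y : V → A) :
    Measurable fun x : V → A => hammingAvg x y :=
  (Finset.measurable_sum _ fun v _ =>
    (measurable_pi_apply v).dist measurable_const).div_const _

omit [MeasurableSpace T] [MeasurableSingletonClass T] in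
/-- If a code decodes most symbols approximately, then the images of two models are far apart
unless the models are close in the Hamming distance. -/
theorem exists_code_separation {P : ProbabilityMeasure (G → A)} (hP : ShiftInv P) {φ : A → T}
    (hφ : FinMeas φ) {δ₀ : ℝ} (hδ₀ : 0 < δ₀) :
    ∃ δ κ₀ : ℝ, 0 < δ ∧ 0 < κ₀ ∧ ∀ (V : Type) [Fintype V] [Nonempty V] (σ : G → Equiv.Perm V)
      (D E F : Finset G) (q : (D → T) → A) (κ η : ℝ), κ ≤ κ₀ → η ≤ κ₀ → 1 ∈ E → D ⊆ F → 1 ∈ F →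
      (P : Measure (G → A)).real (codeError φ D E q κ) < κ →
      ∀ y y' : V → T, IsModel P φ F η σ y → IsModel P φ F η σ y' →
        hammingAvg (applyCode q σ y) (applyCode q σ y') < δ → freq {v | y v ≠ y' v} ≤ δ₀ := by
  classical
  obtain ⟨K, κ, hκ, hKc, hKs, hKm, hsep⟩ := exists_separated_compacts (marginal P : Measure A) hφ
    (ε := δ₀ / 12) (by positivity)
  have hK : MeasurableSet (⋃ t, K t) := MeasurableSet.iUnion fun t => (hKc t).measurableSet
  refine ⟨κ / 3 * (δ₀ / 3), min (κ / 3) (δ₀ / 12), by positivity, by positivity, ?_⟩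
  intro V _ _ σ D E F q κ' η hκ' hη h1E hDF h1F hq y y' hy hy' hd
  -- Patterns whose decoded point is not near the compact of their symbol at `1`. They are rare,
  -- since both the complement of the compacts and the code error are small.
  set B : Set (F → T) := {p | ¬ ∃ a ∈ K (p ⟨1, h1F⟩),
    dist (q fun h => p ⟨h, hDF h.2⟩) a < κ / 3} with hB
  have hPB : (P : Measure (G → A)).real {z | readWindow φ F z ∈ B} ≤ δ₀ / 12 + κ' := by
    have hsub : {z : G → A | readWindow φ F z ∈ B} ⊆
        {z | z 1 ∈ (⋃ t, K t)ᶜ} ∪ codeError φ D E q κ' := by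
      intro z hz
      by_contra hcon
      simp only [mem_union, mem_ofPred_eq, mem_compl_iff, not_or, not_not] at hcon
      obtain ⟨h1, h2⟩ := hcon
      obtain ⟨t, ht⟩ := mem_iUnion.1 h1
      refine hz ⟨z 1, ?_, ?_⟩
      · have : φ (z 1) = t := hKs t ht
        simp only [readWindow]
        rwa [this]
      · simp only [codeError, mem_ofPred_eq, not_exists, not_and, not_le] at h2
        have := h2 1 h1E
        simp only [mul_one] at this
        exact this.trans_le (hκ'.trans (min_le_left _ _))
    refine (measureReal_mono hsub).trans ((measureReal_union_le _ _).trans ?_)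
    rw [hP.real_eval 1 hK.compl]
    exact add_le_add hKm hq.le
  have hfB : ∀ y : V → T, IsModel P φ F η σ y → freq {v | window σ F y v ∈ B} ≤ δ₀ / 4 := by
    intro y hy
    have h1 := (abs_lt.1 (hy B)).2
    have h2 := min_le_right (κ / 3) (δ₀ / 12)
    linarith
  have h5 : κ / 3 * freq {v | κ / 3 ≤ dist (applyCode q σ y v) (applyCode q σ y' v)} ≤
      hammingAvg (applyCode q σ y) (applyCode q σ y') :=
    mul_freq_le_sum_div (fun v => dist_nonneg) fun v hv => hv
  have h6 : freq {v | κ / 3 ≤ dist (applyCode q σ y v) (applyCode q σ y' v)} < δ₀ / 3 :=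
    lt_of_mul_lt_mul_left (h5.trans_lt hd) (by positivity)
  rw [← freq_perm (σ 1) {v | y v ≠ y' v}]
  have h7 : freq {v | σ 1 v ∈ {v | y v ≠ y' v}} ≤
      freq ({v | window σ F y v ∈ B} ∪ {v | window σ F y' v ∈ B}) +
        freq {v | κ / 3 ≤ dist (applyCode q σ y v) (applyCode q σ y' v)} := by
    refine freq_le_add fun v hv => ?_
    by_contra hcon
    simp only [mem_union, mem_ofPred_eq, not_or, hB, not_not, not_le] at hcon
    obtain ⟨⟨⟨a, ha, hda⟩, a', ha', hda'⟩, h2⟩ := hcon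
    have h3 := hsep _ _ hv a ha a' ha'
    have h4 := dist_triangle4 a (applyCode q σ y v) (applyCode q σ y' v) a'
    rw [dist_comm a (applyCode q σ y v)] at h4
    change dist (applyCode q σ y v) a < κ / 3 at hda
    change dist (applyCode q σ y' v) a' < κ / 3 at hda'
    linarith
  have h8 := freq_union_le {v | window σ F y v ∈ B} {v | window σ F y' v ∈ B}
  have h9 := hfB y hy
  have h10 := hfB y' hy'
  linarith

/-- The images under codes of laws of large entropy on models have large covering numbers. -/
theorem exists_cover_bound {P : ProbabilityMeasure (G → A)} (hP : ShiftInv P) {φ : A → T}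
    (hφ : FinMeas φ) {c c' : ℝ} (hc : c' < c) :
    ∃ ε δ κ₀ : ℝ, 0 < ε ∧ 0 < δ ∧ 0 < κ₀ ∧ ∀ (V : Type) [Fintype V] [Nonempty V] [DecidableEq V]
      (σ : G → Equiv.Perm V) (D E F : Finset G) (q : (D → T) → A) (κ η : ℝ)
      (m : ProbabilityMeasure (V → T)), κ ≤ κ₀ → η ≤ κ₀ → 1 ∈ E → D ⊆ F → 1 ∈ F →
      (P : Measure (G → A)).real (codeError φ D E q κ) < κ →
      c * Fintype.card V ≤ ∑ a, Real.negMulLog ((m : Measure (V → T)).real {a}) →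
      (m : Measure (V → T)).real {x | ¬ IsModel P φ F η σ x} ≤ η →
      (c' : EReal) ≤ logRate (measureCoverNumber hammingAvg ε δ (pushCode q σ m))
        (Fintype.card V) := by
  classical
  obtain ⟨ε, δ₀, hε, hδ₀, hpack⟩ := exists_packing_bound.{u, 0} T hc
  obtain ⟨δ, κ₀, hδ, hκ₀, hsep⟩ := exists_code_separation hP hφ hδ₀
  -- The cap `1` rules out an empty covering set. Half the radius puts words with a common centre
  -- within `δ`, and half of `ε` is kept for words that are not models.
  refine ⟨min (ε / 2) 1, δ / 2, min κ₀ (ε / 2), by positivity, by positivity, by positivity, ?_⟩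
  intro V _ _ _ σ D E F q κ η m hκ hη h1E hDF h1F hq hH hm
  refine le_logRate Fintype.card_pos (M := ⌈Real.exp (c' * Fintype.card V)⌉₊) ?_ (Nat.le_ceil _)
  refine le_sInf ?_
  rintro _ ⟨C, hC, rfl⟩
  rcases C.finite_or_infinite with hfin | hinf
  swap
  · rw [hinf.encard_eq]; exact le_top
  rw [hfin.encard_eq_coe_toFinset_card]
  have hfint : Fintype C := hfin.fintype
  have hcard : hfin.toFinset.card = Fintype.card C := by
    rw [← Set.toFinset_card]; congr 1; ext; simp
  rw [hcard]
  refine Nat.cast_le.2 (Nat.ceil_le.2 ?_)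
  set s : Set (V → A) := {z | ∃ y ∈ C, hammingAvg z y < δ / 2} with hs
  have hsm : MeasurableSet s := by
    have : s = ⋃ y ∈ C, {z | hammingAvg z y < δ / 2} := by ext z; simp [hs]
    rw [this]
    exact MeasurableSet.biUnion hfin.countable fun y _ =>
      measurableSet_lt (measurable_hammingAvg y) measurable_const
  have hms : (pushCode q σ m : Measure (V → A)).real s =
      (m : Measure (V → T)).real (applyCode q σ ⁻¹' s) :=
    map_measureReal_apply (measurable_applyCode q σ) hsm
  have hCne : Nonempty C := by
    by_contra hcon
    have : s = ∅ := by
      refine Set.eq_empty_iff_forall_notMem.2 ?_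
      rintro z ⟨y, hy, -⟩
      exact hcon ⟨y, hy⟩
    rw [this, measureReal_empty] at hC
    have := min_le_right (ε / 2) 1
    linarith
  have hchoice : ∀ x : V → T, ∃ i : C, applyCode q σ x ∈ s →
      hammingAvg (applyCode q σ x) i < δ / 2 := by
    intro x
    by_cases hx : applyCode q σ x ∈ s
    · obtain ⟨y, hy, h⟩ := hx
      exact ⟨⟨y, hy⟩, fun _ => h⟩
    · exact ⟨Classical.arbitrary C, fun h => absurd h hx⟩
  choose f hf using hchoice
  have hone : ∑ a, (m : Measure (V → T)).real {a} = 1 := by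
    rw [sum_measureReal_singleton, Finset.coe_univ, probReal_univ]
  refine hpack V (fun a => (m : Measure (V → T)).real {a}) (fun a => measureReal_nonneg) hone hH
    (Finset.univ.filter fun x => applyCode q σ x ∈ s ∧ IsModel P φ F η σ x) f ?_ ?_
  · have h1 := real_preimage_eq_sum (m : Measure (V → T)) (a := id) measurable_id.finMeas
      (Finset.univ.filter fun x => applyCode q σ x ∈ s ∧ IsModel P φ F η σ x)
    simp only [preimage_id, Finset.coe_filter, Finset.mem_univ, true_and] at h1
    rw [← h1]
    have h2 : (m : Measure (V → T)).real (applyCode q σ ⁻¹' s) ≤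
        (m : Measure (V → T)).real {x | applyCode q σ x ∈ s ∧ IsModel P φ F η σ x} +
        (m : Measure (V → T)).real {x | ¬ IsModel P φ F η σ x} := by
      refine (measureReal_mono fun x hx => ?_).trans (measureReal_union_le _ _)
      by_cases h : IsModel P φ F η σ x
      · exact Or.inl ⟨hx, h⟩
      · exact Or.inr h
    change 1 - min (ε / 2) 1 < (pushCode q σ m : Measure (V → A)).real s at hC
    have h3 := min_le_left (ε / 2) 1
    have h4 := min_le_right κ₀ (ε / 2)
    linarith
  · intro x hx x' hx' hxx'
    simp only [Finset.mem_filter, Finset.mem_univ, true_and] at hx hx'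
    refine hsep V σ D E F q κ η (hκ.trans (min_le_left _ _)) (hη.trans (min_le_left _ _)) h1E hDF
      h1F hq x x' hx.2 hx'.2 ?_
    have h1 := hf x hx.1
    have h2 := hf x' hx'.1
    have h3 := hammingAvg_triangle (applyCode q σ x) (f x : V → A) (applyCode q σ x')
    rw [← hxx', hammingAvg_comm] at h2
    linarith

end CoverBound

/-! ### Construction of a doubly-quenched sequence -/

section LowerBound

theorem exists_exhaustion (G : Type*) [Group G] [Countable G] :
    ∃ E : ℕ → Finset G, (∀ j, 1 ∈ E j) ∧ ∀ E₀ : Finset G, ∀ᶠ j in atTop, E₀ ⊆ E j := by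
  classical
  obtain ⟨f, hf⟩ := exists_surjective_nat G
  refine ⟨fun j => insert 1 ((Finset.range j).image f), fun j => Finset.mem_insert_self _ _, ?_⟩
  intro E₀
  refine (Filter.eventually_all_finset E₀).2 fun g _ => ?_
  obtain ⟨k, rfl⟩ := hf g
  filter_upwards [eventually_gt_atTop k] with j hj
  exact Finset.mem_insert_of_mem (Finset.mem_image_of_mem f (Finset.mem_range.2 hj))

theorem SoficApproximation.eventually_multiplicative {G : Type*} [Group G]
    (S : SoficApproximation G) (D E : Finset G) {κ : ℝ} (hκ : 0 < κ) :
    ∀ᶠ i in atTop,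
      freq {v | ¬ ∀ h ∈ D, ∀ g ∈ E, S.σ i h (S.σ i g v) = S.σ i (h * g) v} < κ := by
  classical
  have h1 : ∀ p ∈ D ×ˢ E, Tendsto (fun i => freq {v | ¬ S.σ i p.1 (S.σ i p.2 v) =
      S.σ i (p.1 * p.2) v}) atTop (𝓝 0) := by
    intro p _
    have h2 := (whp_iff.1 (S.asymp_mul p.1 p.2)).const_sub 1
    rw [sub_self] at h2
    refine h2.congr fun i => ?_
    rw [← freq_compl]
    rfl
  have h2 := tendsto_finsetSum _ h1
  rw [Finset.sum_const_zero] at h2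
  filter_upwards [h2.eventually_lt_const hκ] with i hi
  refine lt_of_le_of_lt ((freq_mono ?_).trans (freq_biUnion_le (D ×ˢ E) fun p =>
    {v | ¬ S.σ i p.1 (S.σ i p.2 v) = S.σ i (p.1 * p.2) v})) hi
  intro v hv
  simp only [mem_ofPred_eq, not_forall] at hv
  obtain ⟨h, hh, g, hg, hne⟩ := hv
  exact mem_biUnion (Finset.mem_coe.2 (Finset.mk_mem_product hh hg)) hne

variable {G : Type v} [Group G] [Countable G] {A : Type u} [MetricSpace A] [CompactSpace A]
  [MeasurableSpace A] [BorelSpace A] {T : Type} [Fintype T] [MeasurableSpace T]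
  [MeasurableSingletonClass T]

/-- If, for every `k`, there are many `k`-tuples of pairwise independent models, then the
doubly-quenched entropy is large. -/
theorem SoficApproximation.le_processDQEntropy (S : SoficApproximation G)
    {P : ProbabilityMeasure (G → A)} (hP : ShiftInv P) {φ : A → T} (hφ : FinMeas φ)
    (hgen : Generates P φ) {c c' : ℝ} (hc : c' < c)
    (hcount : ∀ (n : ℕ) (F : Finset G) (η : ℝ), 0 < η → ∃ᶠ i in atTop,
      Real.exp ((n + 1) * c * Fintype.card (S.V i)) ≤
        (pairwiseModels P φ F η (S.σ i) (n + 1)).ncard) :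
    (c' : EReal) ≤ S.processDQEntropy P := by
  classical
  have hne : Nonempty A := (marginal P).nonempty
  obtain ⟨ε, δ, κ₀, hε, hδ, hκ₀, hcover⟩ := exists_cover_bound hP hφ
    (show c' < (c + c') / 2 by linarith)
  obtain ⟨E, hE1, hE⟩ := exists_exhaustion G
  set κ : ℕ → ℝ := fun j => 1 / ((j : ℝ) + 1) with hκ
  have hκ0 : ∀ j, 0 < κ j := fun j => by positivity
  have hκlim : Tendsto κ atTop (𝓝 0) := tendsto_one_div_add_atTop_nhds_zero_nat
  choose D q hq using fun j => exists_code hP hφ hgen (E j) (hκ0 j)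
  -- The products of `D j` and `E j` allow decoding at the vertices `σ g v`, and `1` allows reading
  -- single symbols. The tolerance `η j` below is divided by the number of patterns so that errors
  -- summed over patterns stay below `2 * κ j`.
  set F : ℕ → Finset G := fun j => insert 1 (D j ∪ Finset.image₂ (· * ·) (D j) (E j)) with hF
  have h1F : ∀ j, 1 ∈ F j := fun j => Finset.mem_insert_self _ _
  have hDF : ∀ j, D j ⊆ F j := fun j =>
    Finset.subset_union_left.trans (Finset.subset_insert _ _)
  have hDE : ∀ j, ∀ h ∈ D j, ∀ g ∈ E j, h * g ∈ F j := fun j h hh g hg =>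
    Finset.mem_insert_of_mem (Finset.mem_union_right _ (Finset.mem_image₂_of_mem hh hg))
  set η : ℕ → ℝ := fun j => κ j / ((Nat.card (F j → T × T) : ℝ) + 1) with hη
  have hη0 : ∀ j, 0 < η j := fun j => div_pos (hκ0 j) (by positivity)
  have hηκ : ∀ j, η j ≤ κ j := fun j => div_le_self (hκ0 j).le (by
    have : (0 : ℝ) ≤ Nat.card (F j → T × T) := Nat.cast_nonneg _
    linarith)
  have hηN : ∀ j, Nat.card (F j → T × T) * (2 * η j) < 2 * κ j := fun j => by
    have h1 : ((Nat.card (F j → T × T) : ℝ) + 1) * η j = κ j := by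
      simp only [hη]; field_simp
    have := hη0 j
    linarith
  choose n η' hη' hlaw using fun j => exists_model_law P hφ (F j)
    (show (c + c') / 2 < c by linarith) (hη0 j)
  -- Diagonal choice: the stage `j` uses a later vertex set with enough tuples for its own window
  -- and tolerance, on which multiplicativity fails with frequency below `κ j`.
  obtain ⟨i, hi, hgood⟩ := extraction_forall_of_frequently fun j =>
    (hcount (n j) (F j) (η' j) (hη' j)).and_eventually
      (S.eventually_multiplicative (D j) (E j) (hκ0 j))
  choose m hH hpair hmod hloc using fun j => hlaw j (S.V (i j)) (S.σ (i j)) (hgood j).1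
  have hdq : DoublyQuenchedConverges (fun j => S.σ (i j))
      (fun j => pushCode (q j) (S.σ (i j)) (m j)) P := by
    have hev : ∀ O ∈ 𝓝 (squareLaw P), ∀ᶠ j in atTop, ∀ Q : ProbabilityMeasure (G → A × A),
        Shadows.{v, 0} (squareLaw P) (E j) (2 * κ j) Q → Q ∈ O := by
      intro O hO
      obtain ⟨E₀, κ₁, hκ₁, hO'⟩ := exists_shadows_subset.{v, 0} hO
      filter_upwards [hE E₀, hκlim.eventually_lt_const (half_pos hκ₁)] with j hj1 hj2 Q hQ
      exact hO' Q (hQ.mono hj1 (by linarith))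
    refine ⟨fun O hO => ?_, fun O hO => ?_⟩
    · rw [whp_iff]
      have hlow : Tendsto (fun j => 1 - 2 * κ j) atTop (𝓝 1) := by
        simpa using (hκlim.const_mul 2).const_sub 1
      refine tendsto_of_tendsto_of_tendsto_of_le_of_le' hlow tendsto_const_nhds ?_
        (Eventually.of_forall fun j => freq_le_one _)
      filter_upwards [hev O hO] with j hj
      rw [sub_le_comm, ← freq_compl]
      refine (freq_le_add (s := {v | ¬ ∀ h ∈ D j, ∀ g ∈ E j,
        S.σ (i j) h (S.σ (i j) g v) = S.σ (i j) (h * g) v}) (t := {v | ∃ p : F j → T, η j ≤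
          |(m j : Measure (S.V (i j) → T)).real {x | window (S.σ (i j)) (F j) x v = p} -
          (P : Measure (G → A)).real {z | readWindow φ (F j) z = p}|}) ?_).trans ?_
      · intro v hv
        by_contra hcon
        simp only [mem_union, mem_ofPred_eq, not_or, not_exists, not_le, not_not] at hcon
        exact hv (hj _ (shadows_local hφ (hDE j) (hq j) (hκ0 j) (hηN j) (m j) hcon.1 hcon.2))
      · have h1 := hloc j
        have h2 := (hgood j).2
        have h3 := hηκ j
        linarith
    · have hlow : Tendsto (fun j => ENNReal.ofReal (1 - κ j)) atTop (𝓝 1) := by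
        have := (ENNReal.continuous_ofReal.tendsto _).comp (hκlim.const_sub 1)
        simpa [Function.comp_def] using this
      refine tendsto_of_tendsto_of_tendsto_of_le_of_le' hlow tendsto_const_nhds ?_
        (Eventually.of_forall fun j => prob_le_one)
      filter_upwards [hev O hO] with j hj
      refine le_trans ?_ (le_squareLaw_pushCode (q j) (S.σ (i j)) (m j) (goodModels O (S.σ (i j))))
      rw [← ofReal_measureReal]
      refine ENNReal.ofReal_le_ofReal ?_
      set μ := ((m j : Measure (S.V (i j) → T)).prod (m j : Measure (S.V (i j) → T)))
      set B := {u : (S.V (i j) → T) × (S.V (i j) → T) | ¬ IsModel (squareLaw P)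
        (pairMap id φ φ) (F j) (η j) (S.σ (i j)) (fun v => (u.1 v, u.2 v))} with hB
      have h1 : μ.real Bᶜ = 1 - μ.real B :=
        probReal_compl_eq_one_sub (Set.toFinite B).measurableSet
      have h2 : μ.real B ≤ κ j := (hpair j).trans (hηκ j)
      refine (show 1 - κ j ≤ μ.real Bᶜ by linarith).trans (measureReal_mono fun u hu => ?_)
      simp only [hB, mem_compl_iff, mem_ofPred_eq, not_not] at hu
      refine hj _ (shadows_empirical hφ (hDE j) (hq j) (hκ0 j)
        ((hηκ j).trans (by linarith [hκ0 j])) ?_ hu)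
      have := (hgood j).2
      have := hκ0 j
      linarith
  refine le_iSup₂_of_le i hi (le_iSup₂_of_le (fun j => pushCode (q j) (S.σ (i j)) (m j)) hdq
    (le_iSup₂_of_le ε hε (le_iSup₂_of_le δ hδ ?_)))
  refine le_limsup_of_frequently_le (Eventually.frequently ?_)
  filter_upwards [hκlim.eventually_lt_const hκ₀] with j hj
  exact hcover (S.V (i j)) (S.σ (i j)) (D j) (E j) (F j) (q j) (κ j) (η j) (m j) hj.le
    ((hηκ j).trans hj.le) (hE1 j) (hDF j) (h1F j) (hq j) (hH j) (hmod j)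

end LowerBound

/-! ### The processes of products and powers -/

namespace GSystem

section Laws

variable {G : Type v} [Group G] (X Y : GSystem.{u, v} G)

theorem coe_processLaw : (X.processLaw : Measure (G → X.carrier)) =
    (X.law : Measure X.carrier).map X.orbitMap := rfl

/-- Shifting the orbit of `x` by `h` gives the orbit of `h • x`. -/
theorem shiftInv_processLaw : ShiftInv X.processLaw := by
  intro h
  have hs : Measurable fun (z : G → X.carrier) g => z (g * h) :=
    measurable_pi_iff.2 fun g => measurable_pi_apply _
  rw [coe_processLaw, Measure.map_map hs X.measurable_orbitMap]
  conv_rhs => rw [← (X.preserving h).map_eq, Measure.map_map X.measurable_orbitMap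
    (X.preserving h).measurable]
  congr 1
  funext x g
  exact mul_smul g h x

theorem isProdLaw_processLaw :
    IsProdLaw (MeasurableEquiv.refl (X.carrier × Y.carrier)) (X.prod Y).processLaw X.processLaw
      Y.processLaw := by
  refine (Measure.map_id (μ := ((X.prod Y).processLaw : Measure (G → (X.prod Y).carrier)))).trans ?_
  rw [coe_processLaw X, coe_processLaw Y,
    Measure.map_prod_map _ _ X.measurable_orbitMap Y.measurable_orbitMap,
    Measure.map_map measurable_zipFun (X.measurable_orbitMap.prodMap Y.measurable_orbitMap)]
  rfl

variable {X Y}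

/-- Factor maps induce maps of processes. -/
theorem map_processLaw {e : X.carrier → Y.carrier}
    (he : MeasurePreserving e (X.law : Measure X.carrier) Y.law)
    (hG : ∀ (g : G) x, e (g • x) = g • e x) :
    (X.processLaw : Measure (G → X.carrier)).map (fun z g => e (z g)) = Y.processLaw := by
  have hm : Measurable fun (z : G → X.carrier) g => e (z g) :=
    measurable_pi_iff.2 fun g => he.measurable.comp (measurable_pi_apply g)
  rw [coe_processLaw, coe_processLaw, Measure.map_map hm X.measurable_orbitMap, ← he.map_eq,
    Measure.map_map Y.measurable_orbitMap he.measurable]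
  congr 1
  funext x g
  exact hG g x

variable (X)

theorem measurePreserving_cons (k : ℕ) :
    MeasurePreserving (MeasurableEquiv.piFinSuccAbove (fun _ => X.carrier) 0).symm
      ((X.prod (X.pow k)).law : Measure (X.prod (X.pow k)).carrier)
      ((X.pow (k + 1)).law : Measure (X.pow (k + 1)).carrier) :=
  (measurePreserving_piFinSuccAbove (fun _ : Fin (k + 1) => (X.law : Measure X.carrier)) 0).symm

/-- Two coordinates of a power form the Cartesian square. -/
theorem map_processLaw_pow (k : ℕ) {i j : Fin k} (hij : i ≠ j) :
    ((X.pow k).processLaw : Measure (G → (X.pow k).carrier)).map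
      (fun z g => ((z g : Fin k → X.carrier) i, (z g : Fin k → X.carrier) j)) =
      squareLaw X.processLaw := by
  have hp : MeasurePreserving (fun x : Fin k → X.carrier => (x i, x j))
      (Measure.pi fun _ => (X.law : Measure X.carrier))
      ((X.law : Measure X.carrier).prod (X.law : Measure X.carrier)) := by
    refine ⟨(measurable_pi_apply i).prodMk (measurable_pi_apply j), ?_⟩
    have h1 := (ProbabilityTheory.iIndepFun_pi (μ := fun _ : Fin k => (X.law : Measure X.carrier))
      (X := fun _ => id) fun _ => aemeasurable_id).indepFun hij
    refine ((ProbabilityTheory.indepFun_iff_map_prod_eq_prod_map_map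
      (f := fun x : Fin k → X.carrier => x i) (g := fun x : Fin k → X.carrier => x j)
      (measurable_pi_apply i).aemeasurable (measurable_pi_apply j).aemeasurable).1 h1).trans ?_
    congr 1
    · exact (measurePreserving_eval (fun _ : Fin k => (X.law : Measure X.carrier)) i).map_eq
    · exact (measurePreserving_eval (fun _ : Fin k => (X.law : Measure X.carrier)) j).map_eq
  refine (map_processLaw (X := X.pow k) (Y := X.prod X) hp fun g x => rfl).trans ?_
  exact (Measure.map_id (μ := ((X.prod X).processLaw :
    Measure (G → (X.prod X).carrier)))).symm.trans (X.isProdLaw_processLaw X)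

/-- Carries the approximation from `X` to its process; the coordinate `1` of an orbit is the point
itself. -/
theorem generates_of_law {K : Type} [Finite K] {φ : X.carrier → K} (hφ : FinMeas φ)
    (h : ∀ (N : ℕ) (ψ : X.carrier → Fin N), FinMeas ψ → ∀ ε : ℝ, 0 < ε →
      ∃ (D : Finset G) (θ : (D → K) → Fin N),
        (X.law : Measure X.carrier).real {x | θ (fun g => φ ((g : G) • x)) ≠ ψ x} ≤ ε) :
    Generates X.processLaw φ := by
  intro N ψ hψ ε hε
  obtain ⟨D, θ, hθ⟩ := h N ψ hψ ε hε
  refine ⟨D, θ, le_trans (le_of_eq ?_) hθ⟩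
  have hm : MeasurableSet {z : G → X.carrier | θ (readWindow φ D z) ≠ ψ (z 1)} :=
    ((hφ.readWindow D).prodMk (hψ.comp_measurable (measurable_pi_apply (1 : G)))) {u | θ u.1 ≠ u.2}
  rw [coe_processLaw, map_measureReal_apply X.measurable_orbitMap hm]
  congr 1
  ext x
  simp only [mem_preimage, mem_ofPred_eq, orbitMap, one_smul]
  rfl

/-- A generator of `X` induces a generator of each power. -/
theorem generates_pow {r : ℕ} {φ : X.carrier → Fin r} (hφ : Measurable φ)
    (hgen : ∀ B : Set X.carrier, MeasurableSet B → ∃ C : Set X.carrier,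
      MeasurableSet[⨆ g : G, MeasurableSpace.comap (fun x => φ (g • x)) ⊤] C ∧
        B =ᵐ[(X.law : Measure X.carrier)] C) (k : ℕ) :
    Generates (X.pow k).processLaw
      (fun (x : Fin k → X.carrier) i => φ (x i)) := by
  classical
  have hφk : FinMeas (fun (x : Fin k → X.carrier) i => φ (x i)) :=
    FinMeas.pi (ψ := fun i (x : Fin k → X.carrier) => φ (x i)) fun i =>
      hφ.finMeas.comp_measurable (measurable_pi_apply i)
  refine generates_of_law (X.pow k) hφk fun N ψ hψ ε hε => ?_
  have hne : Nonempty X.carrier := X.law.nonempty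
  have hne' : Nonempty (Fin N) := ⟨ψ fun _ => Classical.arbitrary _⟩
  -- First `ψ` is approximated through one finite observable `ψ₁` of the coordinates, then `ψ₁`
  -- through windows of `φ`. The error `ε / 2 / (k + 1)` leaves room for a union bound over the `k`
  -- coordinates.
  obtain ⟨T₁, hT₁, ψ₁, θ, hψ₁, hθ⟩ := exists_pi_approx
    (MeasurableEquiv.refl (Fin k → X.carrier)) (Measure.pi fun _ => (X.law : Measure X.carrier))
    hψ (half_pos hε)
  have hneT : Nonempty T₁ := hne.map ψ₁
  obtain ⟨D, θ₁, hθ₁⟩ := X.exists_window_approx hφ hgen hψ₁ (ε := ε / 2 / (k + 1)) (by positivity)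
  have hBm : MeasurableSet {x | θ₁ (fun g : D => φ ((g : G) • x)) ≠ ψ₁ x} :=
    ((FinMeas.pi (ψ := fun (g : D) x => φ ((g : G) • x)) fun g =>
      hφ.finMeas.comp_measurable (X.preserving g).measurable).prodMk hψ₁) {u | θ₁ u.1 ≠ u.2}
  refine ⟨D, fun w => θ fun i => θ₁ fun g => w g i, ?_⟩
  have hsub : {x : Fin k → X.carrier | θ (fun i => θ₁ fun g : D => φ ((g : G) • x i)) ≠ ψ x} ⊆
      {x | θ (fun i => ψ₁ (x i)) ≠ ψ x} ∪
      ⋃ i, (fun x : Fin k → X.carrier => x i) ⁻¹'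
        {x | θ₁ (fun g : D => φ ((g : G) • x)) ≠ ψ₁ x} := by
    intro x hx
    by_contra hcon
    simp only [mem_union, mem_iUnion, mem_preimage, mem_ofPred_eq, not_or, not_exists, ne_eq,
      not_not] at hcon
    refine hx ?_
    rw [← hcon.1]
    exact congrArg θ (funext fun i => hcon.2 i)
  refine (measureReal_mono hsub).trans ((measureReal_union_le _ _).trans ?_)
  have h2 : ∀ i : Fin k, (Measure.pi fun _ => (X.law : Measure X.carrier)).real
      ((fun x : Fin k → X.carrier => x i) ⁻¹'
        {x | θ₁ (fun g : D => φ ((g : G) • x)) ≠ ψ₁ x}) ≤ ε / 2 / (k + 1) := by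
    intro i
    rw [((measurePreserving_eval (fun _ : Fin k => (X.law : Measure X.carrier)) i)
      ).measureReal_preimage hBm.nullMeasurableSet]
    exact hθ₁
  have h3 := (measureReal_iUnion_fintype_le (μ := (Measure.pi fun _ => (X.law : Measure X.carrier)))
    fun i : Fin k => (fun x : Fin k → X.carrier => x i) ⁻¹'
        {x | θ₁ (fun g : D => φ ((g : G) • x)) ≠ ψ₁ x}).trans
    (Finset.sum_le_sum fun i _ => h2 i)
  rw [Finset.sum_const, Finset.card_univ, Fintype.card_fin, nsmul_eq_mul] at h3
  have h4 : (k : ℝ) * (ε / 2 / (k + 1)) ≤ ε / 2 := by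
    rw [mul_div_assoc', div_le_iff₀ (by positivity)]
    nlinarith
  exact (add_le_add hθ (h3.trans h4)).trans (by linarith)

end Laws

end GSystem

/-! ### Entropies of systems -/

namespace SoficApproximation

variable {G : Type v} [Group G] [Countable G] (S : SoficApproximation G) (X Y : GSystem.{u, v} G)

theorem dqEntropy_add_le : S.dqEntropy X + S.lowerEntropy Y ≤ S.entropy (X.prod Y) := by
  let _ := (chosenMetric X.carrier).metric
  have := (chosenMetric X.carrier).compact
  have := (chosenMetric X.carrier).borel
  let _ := (chosenMetric Y.carrier).metric
  have := (chosenMetric Y.carrier).compact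
  have := (chosenMetric Y.carrier).borel
  let _ := (chosenMetric (X.prod Y).carrier).metric
  have := (chosenMetric (X.prod Y).carrier).compact
  have := (chosenMetric (X.prod Y).carrier).borel
  exact S.processDQEntropy_add_le (X.isProdLaw_processLaw Y) X.shiftInv_processLaw
    Y.shiftInv_processLaw (X.prod Y).shiftInv_processLaw

/-- The metrics chosen on the two carriers are unrelated, so invariance rests on the comparison for
arbitrary compact metrics. It is used to pass from `X.prod (X.pow k)` to `X.pow (k + 1)`. -/
theorem entropy_le_of_equiv {X Y : GSystem.{u, v} G} (e : X.carrier ≃ᵐ Y.carrier)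
    (he : MeasurePreserving e (X.law : Measure X.carrier) Y.law)
    (hG : ∀ (g : G) x, e (g • x) = g • e x) : S.entropy X ≤ S.entropy Y := by
  let _ := (chosenMetric X.carrier).metric
  have := (chosenMetric X.carrier).compact
  have := (chosenMetric X.carrier).borel
  let _ := (chosenMetric Y.carrier).metric
  have := (chosenMetric Y.carrier).compact
  have := (chosenMetric Y.carrier).borel
  exact S.processEntropy_le_of_equiv e X.shiftInv_processLaw Y.shiftInv_processLaw
    (GSystem.map_processLaw he hG)

theorem entropy_prod_pow_le (k : ℕ) : S.entropy (X.prod (X.pow k)) ≤ S.entropy (X.pow (k + 1)) := by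
  refine S.entropy_le_of_equiv (X := X.prod (X.pow k)) (Y := X.pow (k + 1))
    (MeasurableEquiv.piFinSuccAbove (fun _ => X.carrier) 0).symm
    (X.measurePreserving_cons k) fun g x => ?_
  funext i
  refine Fin.cases ?_ (fun i => ?_) i <;> rfl

/-- The base case of the induction over powers. -/
theorem entropy_pow_zero : S.entropy (X.pow 0) = 0 ∧ S.lowerEntropy (X.pow 0) = 0 := by
  let _ := (chosenMetric (X.pow 0).carrier).metric
  have := (chosenMetric (X.pow 0).carrier).compact
  have := (chosenMetric (X.pow 0).carrier).borel
  have : Subsingleton (X.pow 0).carrier := inferInstanceAs (Subsingleton (Fin 0 → X.carrier))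
  exact S.processEntropy_eq_zero _

theorem entropy_le_models {K : Type} [Finite K] {φ : X.carrier → K} (hφ : FinMeas φ)
    (hgen : Generates X.processLaw φ) (F : Finset G) {η : ℝ} (hη : 0 < η) :
    S.entropy X ≤ limsup (fun n => logRate
      (({y : S.V n → K | IsModel X.processLaw φ F η (S.σ n) y}.ncard : ℕ) : ℕ∞)
      (Fintype.card (S.V n))) atTop := by
  let _ := (chosenMetric X.carrier).metric
  have := (chosenMetric X.carrier).compact
  have := (chosenMetric X.carrier).borel
  exact S.processEntropy_le_models X.shiftInv_processLaw hφ hgen F hη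

/-- If the entropies of all powers grow at least linearly with slope `c`, then the
doubly-quenched entropy is at least `c`. -/
theorem le_dqEntropy {X : GSystem.{u, v} G} (hgen : X.HasFiniteGeneratingPartition) {c : ℝ}
    (h : ∀ k : ℕ, ((k * c : ℝ) : EReal) ≤ S.entropy (X.pow k)) : (c : EReal) ≤ S.dqEntropy X := by
  classical
  obtain ⟨r, φ, hφ, hgen⟩ := hgen
  refine EReal.ge_of_forall_gt_iff_ge.1 fun c' hc' => ?_
  have hc : c' < c := EReal.coe_lt_coe_iff.1 hc'
  let _ := (chosenMetric X.carrier).metric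
  have := (chosenMetric X.carrier).compact
  have := (chosenMetric X.carrier).borel
  have hne : Nonempty X.carrier := X.law.nonempty
  have hX : Generates X.processLaw φ := X.generates_of_law hφ.finMeas fun N ψ hψ ε hε => by
    have : Nonempty (Fin N) := hne.map ψ
    exact X.exists_window_approx hφ hgen hψ hε
  -- The midpoint leaves a gap below `c`, for a strict inequality in the count, and a gap above
  -- `c'`, as the construction requires.
  refine S.le_processDQEntropy X.shiftInv_processLaw hφ.finMeas hX (c := (c + c') / 2)
    (by linarith) fun n F η hη => ?_
  have hφk : FinMeas (fun (x : Fin (n + 1) → X.carrier) i => φ (x i)) :=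
    FinMeas.pi (ψ := fun i (x : Fin (n + 1) → X.carrier) => φ (x i)) fun i =>
      hφ.finMeas.comp_measurable (measurable_pi_apply i)
  have h1 := (h (n + 1)).trans (S.entropy_le_models (X.pow (n + 1)) hφk
    (X.generates_pow hφ hgen (n + 1)) F hη)
  have h2 : (((n + 1 : ℝ) * ((c + c') / 2) : ℝ) : EReal) < (((n + 1 : ℕ) * c : ℝ) : EReal) := by
    rw [EReal.coe_lt_coe_iff]
    push_cast
    have : (0 : ℝ) ≤ n := Nat.cast_nonneg n
    nlinarith
  refine (frequently_lt_of_lt_limsup (by isBoundedDefault) (h2.trans_le h1)).mono fun i hi => ?_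
  obtain ⟨M, hM, hlt⟩ := exists_nat_of_lt_logRate Fintype.card_pos hi
  refine hlt.le.trans ?_
  rw [Nat.cast_le]
  refine (Nat.cast_le.1 hM).trans ?_
  -- A word of tuples is read as a tuple of words; two coordinates of a model for the power form a
  -- model for the square.
  refine Set.ncard_le_ncard_of_injOn (fun y i v => y v i) (fun y hy => ?_) (fun y _ y' _ hyy' => ?_)
    (Set.toFinite _)
  · intro a b hab
    have h3 : IsModel (X.pow (n + 1)).processLaw
        (pairMap id φ φ ∘ fun x : Fin (n + 1) → X.carrier => (x a, x b)) F η (S.σ i)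
        (fun v => (y v a, y v b)) := IsModel.map hy fun t => (t a, t b)
    exact h3.of_map ((measurable_pi_apply a).prodMk (measurable_pi_apply b))
      (X.map_processLaw_pow (n + 1) hab) (FinMeas.pairMap measurable_id hφ.finMeas hφ.finMeas)
  · funext v i
    exact congrFun (congrFun hyy' i) v

end SoficApproximation

/-! ### The variational formula -/

theorem mainTheorem8 {G : Type v} [Group G] [Countable G] (S : SoficApproximation G)
    (X : GSystem.{u, v} G) (hgen : X.HasFiniteGeneratingPartition)
    (hpow : ∀ k : ℕ, 1 ≤ k → S.entropy (X.pow k) = S.lowerEntropy (X.pow k)) :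
    S.dqEntropy X =
        sInf {r : EReal | ∃ Y : GSystem.{u, v} G, S.entropy Y = S.lowerEntropy Y ∧
          SubWellDefined (S.entropy (X.prod Y)) (S.entropy Y) ∧
          r = S.entropy (X.prod Y) - S.entropy Y} ∧
      IsGreatest {c : EReal | ∀ Y : GSystem.{u, v} G, S.entropy Y = S.lowerEntropy Y →
          c + S.entropy Y ≤ S.entropy (X.prod Y)} (S.dqEntropy X) := by
  -- The zeroth power also serves as a test system, at the first step of the induction.
  have hpow' : ∀ k, S.entropy (X.pow k) = S.lowerEntropy (X.pow k) := by
    intro k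
    rcases Nat.eq_zero_or_pos k with rfl | hk
    · rw [(S.entropy_pow_zero X).1, (S.entropy_pow_zero X).2]
    · exact hpow k hk
  have hmem : ∀ Y : GSystem.{u, v} G, S.entropy Y = S.lowerEntropy Y →
      S.dqEntropy X + S.entropy Y ≤ S.entropy (X.prod Y) := fun Y hY => by
    rw [hY]
    exact S.dqEntropy_add_le X Y
  have hub : ∀ c : EReal, (∀ Y : GSystem.{u, v} G, S.entropy Y = S.lowerEntropy Y →
      c + S.entropy Y ≤ S.entropy (X.prod Y)) → c ≤ S.dqEntropy X := by
    intro c hc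
    -- The induction runs with a real `z < c`, which keeps infinities out of `k * z`; each step
    -- tests the assumption on `Y = X.pow k`.
    refine EReal.ge_of_forall_gt_iff_ge.1 fun z hz => S.le_dqEntropy hgen fun k => ?_
    induction k with
    | zero => simp [(S.entropy_pow_zero X).1]
    | succ k ih =>
      refine le_trans ?_ ((hc (X.pow k) (hpow' k)).trans (S.entropy_prod_pow_le X k))
      have : (((k + 1 : ℕ) * z : ℝ) : EReal) = (z : EReal) + ((k * z : ℝ) : EReal) := by
        rw [← EReal.coe_add]
        congr 1
        push_cast
        ring
      rw [this]
      exact add_le_add hz.le ih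
  -- The infimum itself satisfies the inequality defining the admissible constants, so it is at most
  -- their largest element.
  refine ⟨le_antisymm (le_sInf ?_) (hub _ fun Y hY => ?_), hmem, hub⟩
  · rintro _ ⟨Y, hY, ⟨hw1, hw2⟩, rfl⟩
    have h1 := hmem Y hY
    refine (EReal.le_sub_iff_add_le ?_ ?_).2 h1
    · tauto
    · tauto
  · by_cases hw : SubWellDefined (S.entropy (X.prod Y)) (S.entropy Y)
    · exact EReal.add_le_of_le_sub (sInf_le ⟨Y, hY, hw, rfl⟩)
    · have hw' : S.entropy (X.prod Y) = ⊤ ∨ S.entropy Y = ⊥ := by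
        by_contra! hcon
        exact hw ⟨fun h => hcon.1 h.1, fun h => hcon.2 h.2⟩
      rcases hw' with h | h
      · rw [h]; exact le_top
      · rw [h, EReal.add_bot]; exact bot_le
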